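/- Two independent sources $c\in\{1,2\}$ generate packets according to Poisson processes with rates $\lambda_1,\lambda_2>0$; put $\lambda=\lambda_1+\lambda_2$. One server without waiting room serves packets with i.i.d. service times, distributed as a nonnegative random variable $S$, independent of the arrivals (a two-source M/G/1/1 system). The source-aware preemptive policy is used: an arriving packet replaces the packet of the same source that is possibly under service, is blocked and cleared if a packet of the other source is under service, and starts service if the system is empty. The system starts at time $0$ in an arbitrary random state that is independent of the interarrival times and service times after time $0$. Let $t_{1,i}$ and $t'_{1,i}$ be the generation time and the delivery time of the $i$th delivered packet of source 1 after time $0$ ($i=1,2,\dots$). The age of information (AoI) of source 1 at time $t$ is $\delta_1(t)=t-U_1(t)$, where $U_1(t)$ is the generation time of the source 1 packet received last by time $t$. The peak AoI is $A_{1,i}=Y_{1,i-1}+T_{1,i-1}$ for $i\ge 2$, where $Y_{1,i}=t'_{1,i+1}-t'_{1,i}$ and $T_{1,i}=t'_{1,i}-t_{1,i}$. Write $L_r=\mathbb{E}[e^{-rS}]$ and $L'_r=\mathbb{E}[Se^{-rS}]$, and put $$\bar\Delta_1=\frac{L_{\lambda_1}^2\big(\lambda(1-L_{\lambda_2})-\lambda_1\lambda_2L'_{\lambda_2}\big)+L_{\lambda_2}^2\lambda_2(1-L_{\lambda_1})-\Psi}{\lambda_1\lambda_2L_{\lambda_1}L_{\lambda_2}(L_{\lambda_1}+L_{\lambda_2}-L_{\lambda_1}L_{\lambda_2})},\qquad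 \Psi=\lambda_1\lambda_2L_{\lambda_1}L_{\lambda_2}^2L'_{\lambda_1}-L_{\lambda_1}L_{\lambda_2}\lambda_2(1+\lambda_1L'_{\lambda_1}),$$ $$\bar A_1=\frac{L_{\lambda_1}+L_{\lambda_2}-L_{\lambda_1}L_{\lambda_2}+\lambda_1L_{\lambda_2}L'_{\lambda_1}}{\lambda_1L_{\lambda_1}L_{\lambda_2}}.$$ Then $\bar\Delta_1$ is the average AoI and $\bar A_1$ is the average peak AoI of source 1, in the following sense. 1. Almost surely $\frac1\tau\int_0^\tau\delta_1(t)\,dt\to\bar\Delta_1$ as $\tau\to\infty$. Moreover, if the initial state is such that $\delta_1(t)$ has the same distribution for all $t\ge 0$ (stationarity), then $\mathbb{E}[\delta_1(t)]=\bar\Delta_1$ for all $t\ge 0$. 2. Almost surely $\frac1n\sum_{i=2}^{n+1}A_{1,i}\to\bar A_1$ as $n\to\infty$, and $\mathbb{E}[A_{1,i}]=\bar A_1$ for every $i\ge 3$. -/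

import Mathlib

open MeasureTheory ProbabilityTheory Filter Topology

noncomputable section

namespace MG11

/-- A packet: its source (`0` is source 1 and `1` is source 2), its generation (= arrival) time, and
the time at which its service ends unless it is preempted earlier. -/
structure Packet where
  src : Fin 2
  gen : ℝ
  fin : ℝ

/-- The data of one sample path on the time axis `[0, ∞)`: the state at time `0` and the randomness
after it. The initial state consists of the time stamp `stamp₀` of the source 1 packet that was
received last before time `0`, and of the packet `pkt₀` that entered the server last before
time `0`; if `pkt₀.fin ≤ 0`, this packet has already left, so the system is empty at time `0`. -/
structure Path where
  stamp₀ : ℝ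
  pkt₀ : Packet
  /-- `X c 0` is the time until the first packet of source `c`, and `X c (n + 1)` is the
  time between its packets with indices `n` and `n + 1`. -/
  X : Fin 2 → ℕ → ℝ
  /-- `S c n` is the service time of the packet of source `c` with index `n`. -/
  S : Fin 2 → ℕ → ℝ

/-- The state of the system just after a packet arrival: the number of packets that each source has
generated since time `0`, and the packet that entered the server last. -/
structure State where
  count : Fin 2 → ℕ
  last : Packet

namespace Path

variable (p : Path)

/-- Generation time of the packet of source `c` with index `n` (indices start at `0`). -/
def gen (c : Fin 2) (n : ℕ) : ℝ := ∑ k ∈ Finset.range (n + 1), p.X c k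

/-- The source of the next arriving packet. -/
def nextSrc (s : State) : Fin 2 := if p.gen 0 (s.count 0) ≤ p.gen 1 (s.count 1) then 0 else 1

/-- The arrival time of the next arriving packet. -/
def nextTime (s : State) : ℝ := p.gen (p.nextSrc s) (s.count (p.nextSrc s))

/-- The next arriving packet. -/
def nextPacket (s : State) : Packet where
  src := p.nextSrc s
  gen := p.nextTime s
  fin := p.nextTime s + p.S (p.nextSrc s) (s.count (p.nextSrc s))

open Classical in
/-- The source-aware preemptive policy. The arriving packet is blocked and cleared if a packet of the
other source is under service; otherwise it enters the server, where it replaces the packet of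
the same source that is possibly under service. -/
def step (s : State) : State where
  count := Function.update s.count (p.nextSrc s) (s.count (p.nextSrc s) + 1)
  last := if p.nextTime s < s.last.fin ∧ s.last.src ≠ p.nextSrc s then s.last else p.nextPacket s

/-- The state after `n` arrivals (from both sources together). -/
def state : ℕ → State
  | 0 => ⟨fun _ => 0, p.pkt₀⟩
  | n + 1 => p.step (state n)

/-- Between the arrivals number `n` and `n + 1` (in the total count, arrival number `0` being
time `0`), a packet of source `c` completes its service and is delivered to the sink. -/
def Delivers (c : Fin 2) (n : ℕ) : Prop :=
  (p.state n).last.src = c ∧ (p.state n).last.fin ≤ p.nextTime (p.state n) ∧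
    (n = 0 → 0 < (p.state n).last.fin)

/-- The `i`th delivered packet of source `c` (counted from `i = 0`, in the order of delivery). -/
def delivered (c : Fin 2) (i : ℕ) : Packet := (p.state (Nat.nth (p.Delivers c) i)).last

/-- The time `t'_{c,i}` at which the `i`th delivered packet of source `c` arrives at the sink. -/
def deliveryTime (c : Fin 2) (i : ℕ) : ℝ := (p.delivered c i).fin

/-- The index `N_c(t) = max {i | t'_{c,i} ≤ t}` of the packet of source `c` received last. -/
def lastIndex (c : Fin 2) (t : ℝ) : ℕ := sSup {i | p.deliveryTime c i ≤ t}

open Classical in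
/-- The time stamp `U_1(t)` of the source 1 packet that was received last at time `t`. -/
def stamp (t : ℝ) : ℝ :=
  if ∃ i, p.deliveryTime 0 i ≤ t then (p.delivered 0 (p.lastIndex 0 t)).gen else p.stamp₀

/-- The age of information `δ_1(t) = t - U_1(t)` of source 1. -/
def age (t : ℝ) : ℝ := t - p.stamp t

/-- The interdeparture time `Y_{1,i} = t'_{1,i+1} - t'_{1,i}`. -/
def interdeparture (i : ℕ) : ℝ := p.deliveryTime 0 (i + 1) - p.deliveryTime 0 i

/-- The system time `T_{1,i} = t'_{1,i} - t_{1,i}`. -/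
def systemTime (i : ℕ) : ℝ := p.deliveryTime 0 i - (p.delivered 0 i).gen

/-- The peak age `Y_{1,i} + T_{1,i}` of source 1: the age immediately before the reception of its
delivered packet with index `i + 1`. -/
def peakAge (i : ℕ) : ℝ := p.interdeparture i + p.systemTime i

end Path

/-- The sample path with the given initial state (time stamp received last; source, generation time
and end of service of the packet that entered the server last), interarrival and service times. -/
def mkPath (init : ℝ × Fin 2 × ℝ × ℝ) (X S : Fin 2 → ℕ → ℝ) : Path where
  stamp₀ := init.1
  pkt₀ := ⟨init.2.1, init.2.2.1, init.2.2.2⟩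
  X := X
  S := S

/-- The stochastic assumptions on a two-source M/G/1/1 system. After time `0`, source `c` generates
packets according to a Poisson process with rate `lam c` (i.i.d. exponential interarrival times),
the service times have law `ν`, all these variables are mutually independent, and they are
independent of the state at time `0`, whose law is arbitrary. -/
structure IsTwoSource {Ω : Type*} [MeasurableSpace Ω] (P : Measure Ω) (lam : Fin 2 → ℝ)
    (ν : Measure ℝ) (init : Ω → ℝ × Fin 2 × ℝ × ℝ) (X S : Ω → Fin 2 → ℕ → ℝ) : Prop where
  aemeasurable_init : AEMeasurable init P
  law_interarrival : ∀ c n, HasLaw (fun ω => X ω c n) (expMeasure (lam c)) P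
  law_service : ∀ c n, HasLaw (fun ω => S ω c n) ν P
  indep : iIndepFun
    (fun (k : (Fin 2 × ℕ) ⊕ (Fin 2 × ℕ)) (ω : Ω) =>
      k.elim (fun a => X ω a.1 a.2) (fun a => S ω a.1 a.2)) P
  indep_init : IndepFun init
    (fun (ω : Ω) (k : (Fin 2 × ℕ) ⊕ (Fin 2 × ℕ)) =>
      k.elim (fun a => X ω a.1 a.2) (fun a => S ω a.1 a.2)) P

/-- `L_r = E[exp (-r S)]` for a service time `S` with law `ν`. -/
def L (ν : Measure ℝ) (r : ℝ) : ℝ := ∫ s, Real.exp (-r * s) ∂ν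

/-- `L'_r = E[S exp (-r S)]` for a service time `S` with law `ν`. -/
def L' (ν : Measure ℝ) (r : ℝ) : ℝ := ∫ s, s * Real.exp (-r * s) ∂ν

/-- The value of the average age of information of source 1, for arrival rates `l₁`, `l₂` and
`L₁ = L_{l₁}`, `L₂ = L_{l₂}`, `D₁ = L'_{l₁}`, `D₂ = L'_{l₂}`. -/
def ageValue (l₁ l₂ L₁ L₂ D₁ D₂ : ℝ) : ℝ :=
  (L₁ ^ 2 * ((l₁ + l₂) * (1 - L₂) - l₁ * l₂ * D₂) + L₂ ^ 2 * (l₂ * (1 - L₁))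
      - (l₁ * l₂ * L₁ * L₂ ^ 2 * D₁ - L₁ * L₂ * l₂ * (1 + l₁ * D₁))) /
    (l₁ * l₂ * L₁ * L₂ * (L₁ + L₂ - L₁ * L₂))

/-- The value of the average peak age of information of source 1 (notation as for `ageValue`). -/
def peakAgeValue (l₁ L₁ L₂ D₁ : ℝ) : ℝ :=
  (L₁ + L₂ - L₁ * L₂ + l₁ * L₂ * D₁) / (l₁ * L₁ * L₂)

end MG11

end

open scoped ENNReal

set_option linter.unusedSectionVars false

noncomputable section

namespace MG11

section

/-! ### The exponential distribution -/

/-! The system regenerates at the deliveries of source 1. Such a delivery leaves the server empty,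
and by lack of memory the two sources then look like two fresh Poisson streams, independent of the
past. Hence the cycles between successive deliveries, recorded as pairs (length Y, service time T of
the packet delivered at the end), are i.i.d. (`isRenewal_cycle`); the initial state only influences
what happens up to the first delivery. A packet that enters the server does so on arrival, so its
system time, if delivered, is its service time. Between two deliveries the age rises with slope 1
from T to T + Y, where T belongs to the cycle just ended and Y to the next one, so T and Y are
independent. Renewal-reward gives the average age E[T] + E[Y²] / (2 E[Y]) and the average peak age
E[Y] + E[T].

The moments come from a race: a service of length s of source c is completed if no packet of source
c arrives before, that is, if it beats an exponential time of rate `lam c`; otherwise a new service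
of source c starts. Arrivals of the other source are blocked and do not matter. So a delivered
service time has law ν tilted by exp (-λ₁ s), whence E[T] = L'/L at λ₁ (`map_service_idle`), and the
first two moments of the time to the next delivery satisfy linear equations (`IsMoments`), solved in
`exists_isMoments`.

That the solutions really are the moments is optional stopping along the chain of arrivals. The
functions y² + 2yb + q of the clock y are preserved in mean (`IsValue.avg_run`); since they are
finite and dominate y², a delivery occurs almost surely (`IsValue.ae_stops`), and the delivery time
D has a finite second moment (`IsValue.lintegral_final_le`). Then D² dominates the boundary term,
which therefore vanishes (`IsMoments.lintegral_sq_deliveryTime`).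

The almost sure statements follow from strong laws for the cycles and for pairs of consecutive
cycles, together with a deterministic sandwich on each path (`Path.Regular.tendsto_average`). In the
stationary case nothing is known beforehand about the integrability of the age. The mean of a
truncated age equals its almost sure time average, by Fubini and dominated convergence
(`mean_eq_of_tendsto_average`); then the truncation is removed. -/

instance isProbabilityMeasure_expMeasure_of_fact (l : ℝ) [hl : Fact (0 < l)] :
    IsProbabilityMeasure (expMeasure l) :=
  isProbabilityMeasure_expMeasure hl.out

lemma lintegral_expMeasure (l : ℝ) {F : ℝ → ℝ≥0∞} (hF : Measurable F) :
    ∫⁻ x, F x ∂(expMeasure l) =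
      ∫⁻ x in Set.Ici 0, ENNReal.ofReal (l * Real.exp (-(l * x))) * F x := by
  have h : expMeasure l = volume.withDensity (exponentialPDF l) := rfl
  have hm : Measurable (exponentialPDF l) := (measurable_exponentialPDFReal l).ennreal_ofReal
  rw [h, lintegral_withDensity_eq_lintegral_mul _ hm hF, ← lintegral_indicator measurableSet_Ici]
  refine lintegral_congr fun x => ?_
  by_cases hx : 0 ≤ x
  · simp [Set.indicator, hx, exponentialPDF_of_nonneg hx]
  · simp [Set.indicator, hx, exponentialPDF_of_neg (not_le.1 hx)]

/-- Lack of memory, by translating the integral by t. Integrating over the event of survival,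
instead of conditioning on it, keeps the factor exp (-l t) explicit. -/
lemma lintegral_expMeasure_memoryless (l : ℝ) {t : ℝ} (ht : 0 ≤ t) {F : ℝ → ℝ≥0∞}
    (hF : Measurable F) :
    ∫⁻ x, (if t ≤ x then F (x - t) else 0) ∂(expMeasure l) =
      ENNReal.ofReal (Real.exp (-(l * t))) * ∫⁻ x, F x ∂(expMeasure l) := by
  have hm : Measurable fun x => if t ≤ x then F (x - t) else 0 :=
    Measurable.ite measurableSet_Ici (hF.comp (measurable_id.sub_const t)) measurable_const
  rw [lintegral_expMeasure l hm, lintegral_expMeasure l hF, ← lintegral_const_mul _ (by fun_prop),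
    ← lintegral_indicator measurableSet_Ici, ← lintegral_indicator measurableSet_Ici,
    ← lintegral_add_right_eq_self _ t]
  refine lintegral_congr fun x => ?_
  by_cases hx : 0 ≤ x
  · have h1 : 0 ≤ x + t := by positivity
    simp only [Set.indicator, Set.mem_Ici, h1, hx, if_true, le_add_iff_nonneg_left, add_sub_cancel_right]
    rw [← mul_assoc, ← ENNReal.ofReal_mul (Real.exp_pos _).le]
    congr 2
    rw [mul_add, neg_add, Real.exp_add]
    ring
  · simp [Set.indicator, hx]

instance nullSingletonClass_expMeasure (l : ℝ) : NullSingletonClass (expMeasure l) := by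
  have h : expMeasure l = volume.withDensity (exponentialPDF l) := rfl
  rw [h]
  infer_instance

lemma ae_pos_expMeasure (l : ℝ) : ∀ᵐ x ∂(expMeasure l), 0 < x := by
  have h : expMeasure l (Set.Iio 0) = 0 := by
    rw [← lintegral_indicator_one measurableSet_Iio,
      lintegral_expMeasure l (measurable_one.indicator measurableSet_Iio)]
    rw [setLIntegral_congr_fun (g := fun _ => 0) measurableSet_Ici]
    · simp
    · intro x hx
      simp only [Set.mem_Ici] at hx
      simp [Set.indicator, not_lt.2 hx]
  rw [ae_iff]
  have h2 : {a : ℝ | ¬ 0 < a} = Set.Iio 0 ∪ {0} := by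
    ext x
    simp [le_iff_lt_or_eq]
  rw [h2]
  exact measure_union_null h (measure_singleton 0)

/-- The strict version serves source 2, because simultaneous arrivals are resolved in favour of
source 1; the two versions differ on a null set. -/
lemma lintegral_expMeasure_memoryless' (l : ℝ) {t : ℝ} (ht : 0 ≤ t) {F : ℝ → ℝ≥0∞}
    (hF : Measurable F) :
    ∫⁻ x, (if t < x then F (x - t) else 0) ∂(expMeasure l) =
      ENNReal.ofReal (Real.exp (-(l * t))) * ∫⁻ x, F x ∂(expMeasure l) := by
  rw [← lintegral_expMeasure_memoryless l ht hF]
  refine lintegral_congr_ae ?_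
  have h : ∀ᵐ x ∂(expMeasure l), x ≠ t := by simp [ae_iff]
  filter_upwards [h] with x hx
  simp [lt_iff_le_and_ne, hx.symm]

/-! ### Arrival streams -/

/-- The future of a source: the time until its next arrival, and for each packet that arrives
its service time together with the time between its arrival and the following one. -/
abbrev Stream := ℝ × (ℕ → ℝ × ℝ)

namespace Stream

/-- The service time of the next packet. -/
def serv (a : Stream) : ℝ := (a.2 0).1

/-- The future of the source just after the arrival of the next packet. -/
def pop (a : Stream) : Stream := ((a.2 0).2, fun n => a.2 (n + 1))

/-- The future of the source after a time `t` without arrivals. -/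
def delay (t : ℝ) (a : Stream) : Stream := (a.1 - t, a.2)

@[fun_prop]
lemma measurable_serv : Measurable serv := by unfold serv; fun_prop

@[fun_prop]
lemma measurable_pop : Measurable pop := by unfold pop; fun_prop

@[fun_prop]
lemma measurable_delay : Measurable fun x : ℝ × Stream => delay x.1 x.2 := by
  unfold delay; fun_prop

end Stream

/-- The law of the pairs of service times and interarrival times of a source. -/
def pairMeasure (l : ℝ) (ν : Measure ℝ) : Measure (ℕ → ℝ × ℝ) :=
  Measure.infinitePi fun _ => ν.prod (expMeasure l)

/-- The law of the future of a Poisson source of rate `l` with service time law `ν`. -/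
def streamMeasure (l : ℝ) (ν : Measure ℝ) : Measure Stream := (expMeasure l).prod (pairMeasure l ν)

variable (l : ℝ) [Fact (0 < l)] (ν : Measure ℝ) [IsProbabilityMeasure ν]

instance : IsProbabilityMeasure (pairMeasure l ν) := by unfold pairMeasure; infer_instance

instance : IsProbabilityMeasure (streamMeasure l ν) := by unfold streamMeasure; infer_instance

/-- Splits off the first term of an i.i.d. sequence. Both measures agree on boxes, which determine
an infinite product. -/
lemma infinitePi_eq_map_cons {α : Type*} [MeasurableSpace α] (m : Measure α)
    [IsProbabilityMeasure m] :
    Measure.infinitePi (fun _ : ℕ => m) =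
      (m.prod (Measure.infinitePi fun _ : ℕ => m)).map
        (fun q => (fun n => Nat.casesOn n q.1 q.2 : ℕ → α)) := by
  have hmeas : Measurable (fun q : α × (ℕ → α) => (fun n => Nat.casesOn n q.1 q.2 : ℕ → α)) := by
    rw [measurable_pi_iff]
    intro n
    cases n with
    | zero => exact measurable_fst
    | succ n => exact (measurable_pi_apply n).comp measurable_snd
  symm
  refine Measure.eq_infinitePi _ fun s t ht => ?_
  obtain ⟨N, hN⟩ : ∃ N, s ⊆ Finset.range (N + 1) :=
    ⟨s.sup id, fun x hx => Finset.mem_range.2 (Nat.lt_succ_of_le (Finset.le_sup (f := id) hx))⟩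
  classical
  -- The box is padded with `univ` so that its index set becomes an initial segment, which contains
  -- 0 and is compatible with the index shift.
  set t' : ℕ → Set α := fun n => if n ∈ s then t n else Set.univ with ht'
  have hms : ∀ n, MeasurableSet (t' n) := fun n => by
    by_cases h : n ∈ s <;> simp [ht', h, ht n]
  have e1 : Set.pi (↑s) t = Set.pi (↑(Finset.range (N + 1))) t' := by
    ext f
    simp only [Set.mem_pi, Finset.mem_coe, ht']
    constructor
    · intro h n _
      by_cases hn : n ∈ s <;> simp [hn, h n]
    · intro h n hn
      simpa [hn] using h n (hN hn)
  have e2 : ∏ i ∈ s, m (t i) = ∏ i ∈ Finset.range (N + 1), m (t' i) := by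
    rw [← Finset.prod_subset hN]
    · exact Finset.prod_congr rfl fun n hn => by simp [ht', hn]
    · intro n _ hn
      simp [ht', hn]
  have e3 : (fun q : α × (ℕ → α) => (fun n => Nat.casesOn n q.1 q.2 : ℕ → α)) ⁻¹'
      (Set.pi (↑(Finset.range (N + 1))) t') =
      t' 0 ×ˢ Set.pi (↑(Finset.range N)) (fun n => t' (n + 1)) := by
    ext q
    simp only [Set.mem_preimage, Set.mem_pi, Finset.coe_range, Set.mem_Iio, Set.mem_prod]
    constructor
    · intro h
      exact ⟨h 0 (by omega), fun n hn => h (n + 1) (by omega)⟩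
    · rintro ⟨h0, h1⟩ n hn
      cases n with
      | zero => exact h0
      | succ n => exact h1 n (by omega)
  rw [e1, e2, Measure.map_apply hmeas (MeasurableSet.pi (Finset.countable_toSet _) fun n _ => hms n),
    e3, Measure.prod_prod, Measure.infinitePi_pi _ (fun n _ => hms (n + 1)), Finset.prod_range_succ',
    mul_comm]

/-- Pairing each service time with the following interarrival time makes `pop` a shift of an i.i.d.
sequence: the time, the service time and the stream after the arrival are independent, and the last
is again a stream. -/
lemma lintegral_streamMeasure {F : ℝ → ℝ → Stream → ℝ≥0∞}
    (hF : Measurable fun q : ℝ × ℝ × Stream => F q.1 q.2.1 q.2.2) :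
    ∫⁻ a, F a.1 a.serv a.pop ∂(streamMeasure l ν) =
      ∫⁻ t, ∫⁻ s, ∫⁻ a, F t s a ∂(streamMeasure l ν) ∂ν ∂(expMeasure l) := by
  have hm : Measurable fun a : Stream => F a.1 a.serv a.pop :=
    hF.comp (by fun_prop : Measurable fun a : Stream => (a.1, a.serv, a.pop))
  rw [streamMeasure, lintegral_prod _ hm.aemeasurable]
  refine lintegral_congr fun t => ?_
  have hmeas : Measurable (fun q : (ℝ × ℝ) × (ℕ → ℝ × ℝ) =>
      (fun n => Nat.casesOn n q.1 q.2 : ℕ → ℝ × ℝ)) := by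
    rw [measurable_pi_iff]
    intro n
    cases n with
    | zero => exact measurable_fst
    | succ n => exact (measurable_pi_apply n).comp measurable_snd
  have hm' : Measurable fun b : ℕ → ℝ × ℝ => F t (Stream.serv (t, b)) (Stream.pop (t, b)) :=
    hm.comp (by fun_prop : Measurable fun b : ℕ → ℝ × ℝ => ((t, b) : Stream))
  conv_lhs => rw [pairMeasure, infinitePi_eq_map_cons]
  rw [lintegral_map hm' hmeas, lintegral_prod _ (by exact (hm'.comp hmeas).aemeasurable), lintegral_prod]
  · refine lintegral_congr fun s => ?_
    rw [lintegral_prod]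
    · rfl
    · exact (hF.comp (by fun_prop : Measurable fun a : Stream => (t, s, a))).aemeasurable
  · refine Measurable.aemeasurable ?_
    refine Measurable.lintegral_prod_right' (f := fun q : (ℝ × ℝ) × (ℕ → ℝ × ℝ) => F t q.1.1 (q.1.2, q.2)) ?_
    exact hF.comp (by fun_prop : Measurable fun q : (ℝ × ℝ) × (ℕ → ℝ × ℝ) => (t, q.1.1, (q.1.2, q.2)))

lemma lintegral_stream_delay {t : ℝ} (ht : 0 ≤ t) {F : Stream → ℝ≥0∞} (hF : Measurable F) :
    ∫⁻ a, (if t ≤ a.1 then F (a.delay t) else 0) ∂(streamMeasure l ν) =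
      ENNReal.ofReal (Real.exp (-(l * t))) * ∫⁻ a, F a ∂(streamMeasure l ν) := by
  have hm : Measurable fun a : Stream => if t ≤ a.1 then F (a.delay t) else 0 :=
    Measurable.ite (measurableSet_le measurable_const measurable_fst)
      (hF.comp (by unfold Stream.delay; fun_prop)) measurable_const
  rw [streamMeasure, lintegral_prod_symm _ hm.aemeasurable, lintegral_prod_symm _ hF.aemeasurable,
    ← lintegral_const_mul _ (hF.lintegral_prod_left')]
  refine lintegral_congr fun b => ?_
  exact lintegral_expMeasure_memoryless l ht (F := fun x => F (x, b)) (by fun_prop)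

lemma lintegral_stream_delay' {t : ℝ} (ht : 0 ≤ t) {F : Stream → ℝ≥0∞} (hF : Measurable F) :
    ∫⁻ a, (if t < a.1 then F (a.delay t) else 0) ∂(streamMeasure l ν) =
      ENNReal.ofReal (Real.exp (-(l * t))) * ∫⁻ a, F a ∂(streamMeasure l ν) := by
  have hm : Measurable fun a : Stream => if t < a.1 then F (a.delay t) else 0 :=
    Measurable.ite (measurableSet_lt measurable_const measurable_fst)
      (hF.comp (by unfold Stream.delay; fun_prop)) measurable_const
  rw [streamMeasure, lintegral_prod_symm _ hm.aemeasurable, lintegral_prod_symm _ hF.aemeasurable,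
    ← lintegral_const_mul _ (hF.lintegral_prod_left')]
  refine lintegral_congr fun b => ?_
  exact lintegral_expMeasure_memoryless' l ht (F := fun x => F (x, b)) (by fun_prop)

end

section

/-! ### The future of the two sources -/

/-- The future of both sources. -/
abbrev Input := Stream × Stream

namespace Input

/-- The stream of source `c`. -/
def stream (c : Fin 2) (J : Input) : Stream := if c = 0 then J.1 else J.2

/-- The time until the next arrival. -/
def wait (J : Input) : ℝ := min J.1.1 J.2.1

/-- The source of the next arrival. -/
def src (J : Input) : Fin 2 := if J.1.1 ≤ J.2.1 then 0 else 1

/-- The service time of the next arriving packet. -/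
def serv (J : Input) : ℝ := if J.1.1 ≤ J.2.1 then J.1.serv else J.2.serv

/-- The future just after the next arrival. -/
def pop (J : Input) : Input :=
  if J.1.1 ≤ J.2.1 then (J.1.pop, J.2.delay J.1.1) else (J.1.delay J.2.1, J.2.pop)

/-- The future after a time `t` without arrivals. -/
def delay (t : ℝ) (J : Input) : Input := (J.1.delay t, J.2.delay t)

lemma measurableSet_le_wait : MeasurableSet {J : Input | J.1.1 ≤ J.2.1} :=
  measurableSet_le (by fun_prop) (by fun_prop)

@[fun_prop]
lemma measurable_wait : Measurable wait := by unfold wait; fun_prop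

@[fun_prop]
lemma measurable_src : Measurable src :=
  Measurable.ite measurableSet_le_wait measurable_const measurable_const

@[fun_prop]
lemma measurable_serv : Measurable serv :=
  Measurable.ite measurableSet_le_wait (by fun_prop) (by fun_prop)

@[fun_prop]
lemma measurable_delay : Measurable fun x : ℝ × Input => delay x.1 x.2 := by
  unfold delay; fun_prop

@[fun_prop]
lemma measurable_pop : Measurable pop := by
  refine Measurable.ite measurableSet_le_wait ?_ ?_
  · exact (Stream.measurable_pop.comp measurable_fst).prodMk
      (Stream.measurable_delay.comp (by fun_prop : Measurable fun J : Input => (J.1.1, J.2)))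
  · exact (Stream.measurable_delay.comp (by fun_prop : Measurable fun J : Input => (J.2.1, J.1))).prodMk
      (Stream.measurable_pop.comp measurable_snd)

end Input

/-- The law of the future of two independent Poisson sources. -/
def inputMeasure (lam : Fin 2 → ℝ) (ν : Measure ℝ) : Measure Input :=
  (streamMeasure (lam 0) ν).prod (streamMeasure (lam 1) ν)

variable (lam : Fin 2 → ℝ) [hlam : ∀ c, Fact (0 < lam c)] (ν : Measure ℝ) [IsProbabilityMeasure ν]

instance : IsProbabilityMeasure (inputMeasure lam ν) := by unfold inputMeasure; infer_instance

/-- Lack of memory for both sources at once; the survival probabilities multiply, so the rates add.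
-/
lemma lintegral_input_delay {t : ℝ} (ht : 0 ≤ t) {F : Input → ℝ≥0∞} (hF : Measurable F) :
    ∫⁻ J, (if t ≤ J.wait then F (J.delay t) else 0) ∂(inputMeasure lam ν) =
      ENNReal.ofReal (Real.exp (-((lam 0 + lam 1) * t))) * ∫⁻ J, F J ∂(inputMeasure lam ν) := by
  have hd : Measurable fun a : Stream => a.delay t :=
    Stream.measurable_delay.comp (by fun_prop : Measurable fun a : Stream => (t, a))
  have hm : Measurable fun J : Input => if t ≤ J.wait then F (J.delay t) else 0 :=
    Measurable.ite (measurableSet_le measurable_const (by fun_prop))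
      (hF.comp (Input.measurable_delay.comp (by fun_prop : Measurable fun J : Input => (t, J))))
      measurable_const
  have hG : Measurable fun a : Stream => ∫⁻ b, F (a, b) ∂(streamMeasure (lam 1) ν) :=
    hF.lintegral_prod_right'
  rw [inputMeasure, lintegral_prod _ hm.aemeasurable, lintegral_prod _ hF.aemeasurable]
  have h1 : ∀ a : Stream, ∫⁻ b, (if t ≤ Input.wait (a, b) then F (Input.delay t (a, b)) else 0)
      ∂(streamMeasure (lam 1) ν) = ENNReal.ofReal (Real.exp (-(lam 1 * t))) *
        (if t ≤ a.1 then (fun a => ∫⁻ b, F (a, b) ∂(streamMeasure (lam 1) ν)) (a.delay t) else 0) := by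
    intro a
    by_cases ha : t ≤ a.1
    · rw [if_pos ha, ← lintegral_stream_delay (lam 1) ν ht (F := fun b => F (a.delay t, b)) (by fun_prop)]
      refine lintegral_congr fun b => ?_
      simp [Input.wait, ha, Input.delay]
    · simp [Input.wait, ha]
  simp_rw [h1]
  rw [lintegral_const_mul, lintegral_stream_delay (lam 0) ν ht hG, ← mul_assoc,
    ← ENNReal.ofReal_mul (Real.exp_pos _).le, ← Real.exp_add]
  · congr 3
    ring_nf
  · exact Measurable.ite (measurableSet_le measurable_const (by fun_prop)) (hG.comp hd) measurable_const

/-- The integral of a function of the next arrival: the source, the time, the service time. -/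
def arrival (k : Fin 2 → ℝ → ℝ → ℝ≥0∞) : ℝ≥0∞ :=
  ∑ c, ∫⁻ t, ENNReal.ofReal (Real.exp (-(lam (1 - c) * t))) * ∫⁻ s, k c t s ∂ν ∂(expMeasure (lam c))

/-- Competing exponentials: if source c arrives first at time t, the other source has survived until
t, with probability exp (-(lam (1 - c) t)), and its remaining time is fresh. So the future after the
arrival has the original law and is independent of the arrival. -/
lemma lintegral_input_arrival {K : Fin 2 → ℝ → ℝ → Input → ℝ≥0∞}
    (hK : ∀ c, Measurable fun q : ℝ × ℝ × Input => K c q.1 q.2.1 q.2.2) :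
    ∫⁻ J, K J.src J.wait J.serv J.pop ∂(inputMeasure lam ν) =
      arrival lam ν fun c t s => ∫⁻ J, K c t s J ∂(inputMeasure lam ν) := by
  set μ₀ := streamMeasure (lam 0) ν
  set μ₁ := streamMeasure (lam 1) ν
  have hle : MeasurableSet {J : Input | J.1.1 ≤ J.2.1} := Input.measurableSet_le_wait
  have hlt : MeasurableSet {J : Input | J.2.1 < J.1.1} :=
    measurableSet_lt (by fun_prop) (by fun_prop)
  have hd1 : Measurable fun J : Input => J.2.delay J.1.1 :=
    Stream.measurable_delay.comp (by fun_prop : Measurable fun J : Input => (J.1.1, J.2))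
  have hd0 : Measurable fun J : Input => J.1.delay J.2.1 :=
    Stream.measurable_delay.comp (by fun_prop : Measurable fun J : Input => (J.2.1, J.1))
  have hm0 : Measurable fun J : Input =>
      if J.1.1 ≤ J.2.1 then K 0 J.1.1 J.1.serv (J.1.pop, J.2.delay J.1.1) else 0 :=
    Measurable.ite hle ((hK 0).comp (by fun_prop : Measurable fun J : Input =>
      (J.1.1, J.1.serv, ((J.1.pop, J.2.delay J.1.1) : Input)))) measurable_const
  have hm1 : Measurable fun J : Input =>
      if J.2.1 < J.1.1 then K 1 J.2.1 J.2.serv (J.1.delay J.2.1, J.2.pop) else 0 :=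
    Measurable.ite hlt ((hK 1).comp (by fun_prop : Measurable fun J : Input =>
      (J.2.1, J.2.serv, ((J.1.delay J.2.1, J.2.pop) : Input)))) measurable_const
  have hsplit : ∀ J : Input, K J.src J.wait J.serv J.pop =
      (if J.1.1 ≤ J.2.1 then K 0 J.1.1 J.1.serv (J.1.pop, J.2.delay J.1.1) else 0) +
      (if J.2.1 < J.1.1 then K 1 J.2.1 J.2.serv (J.1.delay J.2.1, J.2.pop) else 0) := by
    intro J
    by_cases h : J.1.1 ≤ J.2.1
    · simp [Input.src, Input.wait, Input.serv, Input.pop, h, not_lt.2 h]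
    · have h' := not_le.1 h
      simp [Input.src, Input.wait, Input.serv, Input.pop, h, h', h'.le]
  simp_rw [hsplit]
  rw [lintegral_add_left hm0, arrival, Fin.sum_univ_two]
  congr 1
  · rw [inputMeasure, lintegral_prod _ hm0.aemeasurable]
    have hmm : Measurable fun q : (ℝ × ℝ × Stream) × Stream => K 0 q.1.1 q.1.2.1 (q.1.2.2, q.2) :=
      (hK 0).comp (by fun_prop : Measurable fun q : (ℝ × ℝ × Stream) × Stream =>
        (q.1.1, q.1.2.1, ((q.1.2.2, q.2) : Input)))
    have hF : Measurable fun q : ℝ × ℝ × Stream => ENNReal.ofReal (Real.exp (-(lam 1 * q.1))) *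
        ∫⁻ b, K 0 q.1 q.2.1 (q.2.2, b) ∂μ₁ :=
      Measurable.mul (by fun_prop) hmm.lintegral_prod_right'
    have h1 : ∀ᵐ a ∂μ₀, ∫⁻ b, (if a.1 ≤ b.1 then K 0 a.1 a.serv (a.pop, b.delay a.1) else 0) ∂μ₁ =
        ENNReal.ofReal (Real.exp (-(lam 1 * a.1))) * ∫⁻ b, K 0 a.1 a.serv (a.pop, b) ∂μ₁ := by
      have hpos : ∀ᵐ a ∂μ₀, 0 < a.1 :=
        Measure.quasiMeasurePreserving_fst.ae (ae_pos_expMeasure (lam 0))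
      filter_upwards [hpos] with a ha
      exact lintegral_stream_delay (lam 1) ν ha.le (F := fun b => K 0 a.1 a.serv (a.pop, b))
        (hmm.comp (by fun_prop : Measurable fun b : Stream => ((a.1, a.serv, a.pop), b)))
    rw [lintegral_congr_ae h1, lintegral_streamMeasure (lam 0) ν (F := fun t s a =>
      ENNReal.ofReal (Real.exp (-(lam 1 * t))) * ∫⁻ b, K 0 t s (a, b) ∂μ₁) hF]
    refine lintegral_congr fun t => ?_
    have hmt : ∀ s, Measurable fun q : Stream × Stream => K 0 t s (q.1, q.2) := fun s =>
      hmm.comp (by fun_prop : Measurable fun q : Stream × Stream => ((t, s, q.1), q.2))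
    have hmt' : Measurable fun q : ℝ × (Stream × Stream) => K 0 t q.1 q.2 :=
      (hK 0).comp (by fun_prop : Measurable fun q : ℝ × (Stream × Stream) => (t, q.1, q.2))
    rw [← lintegral_const_mul _ hmt'.lintegral_prod_right']
    refine lintegral_congr fun s => ?_
    rw [lintegral_const_mul _ (hmt s).lintegral_prod_right', lintegral_prod _ (hmt s).aemeasurable]
    rfl
  · rw [inputMeasure, lintegral_prod_symm _ hm1.aemeasurable]
    have hmm : Measurable fun q : (ℝ × ℝ × Stream) × Stream => K 1 q.1.1 q.1.2.1 (q.2, q.1.2.2) :=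
      (hK 1).comp (by fun_prop : Measurable fun q : (ℝ × ℝ × Stream) × Stream =>
        (q.1.1, q.1.2.1, ((q.2, q.1.2.2) : Input)))
    have hF : Measurable fun q : ℝ × ℝ × Stream => ENNReal.ofReal (Real.exp (-(lam 0 * q.1))) *
        ∫⁻ b, K 1 q.1 q.2.1 (b, q.2.2) ∂μ₀ :=
      Measurable.mul (by fun_prop) hmm.lintegral_prod_right'
    have h1 : ∀ᵐ a ∂μ₁, ∫⁻ b, (if a.1 < b.1 then K 1 a.1 a.serv (b.delay a.1, a.pop) else 0) ∂μ₀ =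
        ENNReal.ofReal (Real.exp (-(lam 0 * a.1))) * ∫⁻ b, K 1 a.1 a.serv (b, a.pop) ∂μ₀ := by
      have hpos : ∀ᵐ a ∂μ₁, 0 < a.1 :=
        Measure.quasiMeasurePreserving_fst.ae (ae_pos_expMeasure (lam 1))
      filter_upwards [hpos] with a ha
      exact lintegral_stream_delay' (lam 0) ν ha.le (F := fun b => K 1 a.1 a.serv (b, a.pop))
        (hmm.comp (by fun_prop : Measurable fun b : Stream => ((a.1, a.serv, a.pop), b)))
    rw [lintegral_congr_ae h1, lintegral_streamMeasure (lam 1) ν (F := fun t s a =>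
      ENNReal.ofReal (Real.exp (-(lam 0 * t))) * ∫⁻ b, K 1 t s (b, a) ∂μ₀) hF]
    refine lintegral_congr fun t => ?_
    have hmt : ∀ s, Measurable fun q : Stream × Stream => K 1 t s (q.1, q.2) := fun s =>
      hmm.comp (by fun_prop : Measurable fun q : Stream × Stream => ((t, s, q.2), q.1))
    have hmt' : Measurable fun q : ℝ × (Stream × Stream) => K 1 t q.1 q.2 :=
      (hK 1).comp (by fun_prop : Measurable fun q : ℝ × (Stream × Stream) => (t, q.1, q.2))
    simp only [Fin.isValue, sub_self]
    rw [← lintegral_const_mul _ hmt'.lintegral_prod_right']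
    refine lintegral_congr fun s => ?_
    rw [lintegral_const_mul _ (hmt s).lintegral_prod_left', lintegral_prod_symm _ (hmt s).aemeasurable]

end

section

section Arrival

variable (lam : Fin 2 → ℝ) [hlam : ∀ c, Fact (0 < lam c)] (ν : Measure ℝ) [IsProbabilityMeasure ν]

lemma arrival_congr {k k' : Fin 2 → ℝ → ℝ → ℝ≥0∞}
    (h : ∀ c t, 0 < t → ∫⁻ s, k c t s ∂ν = ∫⁻ s, k' c t s ∂ν) :
    arrival lam ν k = arrival lam ν k' := by
  refine Finset.sum_congr rfl fun c _ => lintegral_congr_ae ?_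
  filter_upwards [ae_pos_expMeasure (lam c)] with t ht
  rw [h c t ht]

lemma arrival_mono {k k' : Fin 2 → ℝ → ℝ → ℝ≥0∞}
    (h : ∀ c t, 0 < t → ∫⁻ s, k c t s ∂ν ≤ ∫⁻ s, k' c t s ∂ν) :
    arrival lam ν k ≤ arrival lam ν k' := by
  refine Finset.sum_le_sum fun c _ => lintegral_mono_ae ?_
  filter_upwards [ae_pos_expMeasure (lam c)] with t ht
  exact mul_le_mul_right (h c t ht) _

/-- Finiteness of `a` allows the constant to be pulled out of all integrals without measurability of
`k`. -/
lemma arrival_mul_const (k : Fin 2 → ℝ → ℝ → ℝ≥0∞) {a : ℝ≥0∞} (ha : a ≠ ∞) :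
    arrival lam ν (fun c t s => k c t s * a) = arrival lam ν k * a := by
  simp only [arrival, Finset.sum_mul]
  refine Finset.sum_congr rfl fun c _ => ?_
  rw [← lintegral_mul_const' _ _ ha]
  refine lintegral_congr fun t => ?_
  rw [lintegral_mul_const' _ _ ha, mul_assoc]

end Arrival

/-! ### The system seen at its arrivals -/

/-- A configuration of the system: source, residual service time and total service time of the
packet that entered the server last, the clock, and the future arrivals. -/
abbrev Conf := (Fin 2 × ℝ × ℝ) × ℝ × Input

namespace Conf

/-- A packet of source 1 is delivered before the next arrival. -/
def Done (s : Conf) : Prop := s.1.1 = 0 ∧ s.1.2.1 ≤ s.2.2.wait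

/-- The configuration just after the next arrival. -/
def next (s : Conf) : Conf :=
  (if s.2.2.wait < s.1.2.1 ∧ s.1.1 ≠ s.2.2.src then (s.1.1, s.1.2.1 - s.2.2.wait, s.1.2.2)
    else (s.2.2.src, s.2.2.serv, s.2.2.serv), s.2.1 + s.2.2.wait, s.2.2.pop)

lemma measurableSet_done : MeasurableSet {s : Conf | s.Done} :=
  (measurable_fst.fst (measurableSet_singleton (0 : Fin 2))).inter
    (measurableSet_le (f := fun s : Conf => s.1.2.1) (g := fun s : Conf => s.2.2.wait)
      (by fun_prop) (by fun_prop))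

lemma measurable_next : Measurable next := by
  refine Measurable.prodMk (Measurable.ite ?_ (by fun_prop) (by fun_prop)) (by fun_prop)
  refine (measurableSet_lt (f := fun s : Conf => s.2.2.wait) (g := fun s : Conf => s.1.2.1)
    (by fun_prop) (by fun_prop)).inter ?_
  exact (measurableSet_eq_fun (f := fun s : Conf => s.1.1) (g := fun s : Conf => s.2.2.src)
    (by fun_prop) (by fun_prop)).compl

open Classical in
/-- Run the system through at most `n` arrivals: the value is `H` of the configuration in which
source 1 delivers for the first time, and `G` of the last configuration if it did not deliver. -/
def run (G H : Conf → ℝ≥0∞) : ℕ → Conf → ℝ≥0∞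
  | 0, s => G s
  | n + 1, s => if s.Done then H s else run G H n s.next

lemma measurable_run {G H : Conf → ℝ≥0∞} (hG : Measurable G) (hH : Measurable H) (n : ℕ) :
    Measurable (run G H n) := by
  induction n with
  | zero => exact hG
  | succ n ih => exact Measurable.ite measurableSet_done hH (ih.comp measurable_next)

/-- Separates the reward collected at a delivery from the boundary term that has to vanish in the
limit. -/
lemma run_add (G H : Conf → ℝ≥0∞) (n : ℕ) (s : Conf) :
    run G H n s = run 0 H n s + run G 0 n s := by
  induction n generalizing s with
  | zero => simp [run]
  | succ n ih =>
    by_cases h : s.Done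
    · simp [run, h]
    · simp only [run, h, if_false, ih]

/-- The value of a delivery, for a function `h` of the delivery time and of the service time, and
a function `f` of the future. -/
def reward (h : ℝ → ℝ → ℝ≥0∞) (f : Input → ℝ≥0∞) (s : Conf) : ℝ≥0∞ :=
  h (s.2.1 + s.1.2.1) s.1.2.2 * f (s.2.2.delay s.1.2.1)

lemma measurable_reward {h : ℝ → ℝ → ℝ≥0∞} (hh : Measurable fun q : ℝ × ℝ => h q.1 q.2)
    {f : Input → ℝ≥0∞} (hf : Measurable f) : Measurable (reward h f) := by
  refine Measurable.mul ?_ ?_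
  · exact hh.comp (by fun_prop : Measurable fun s : Conf => (s.2.1 + s.1.2.1, s.1.2.2))
  · exact hf.comp (Input.measurable_delay.comp
      (by fun_prop : Measurable fun s : Conf => (s.1.2.1, s.2.2)))

variable (lam : Fin 2 → ℝ) [hlam : ∀ c, Fact (0 < lam c)] (ν : Measure ℝ) [IsProbabilityMeasure ν]

/-- The mean over the future. -/
def avg (F : Conf → ℝ≥0∞) (m : Fin 2 × ℝ × ℝ) (y : ℝ) : ℝ≥0∞ :=
  ∫⁻ J, F (m, y, J) ∂(inputMeasure lam ν)

/-- The contribution of an arrival during a service. -/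
def busyPart (φ : Fin 2 × ℝ × ℝ → ℝ → ℝ≥0∞) (c : Fin 2) (r z y : ℝ) : ℝ≥0∞ :=
  arrival lam ν fun c' t s =>
    if t < r then φ (if c ≠ c' then (c, r - t, z) else (c', s, s)) (y + t) else 0

/-- The contribution of an arrival to the empty system. -/
def freshPart (φ : Fin 2 × ℝ × ℝ → ℝ → ℝ≥0∞) (y : ℝ) : ℝ≥0∞ :=
  arrival lam ν fun c t s => φ (c, s, s) (y + t)

/-- An arrival of the other source only shortens the residual service; an arrival of the same source
restarts it with a fresh service time. -/
lemma lintegral_next_of_wait_lt {F : Conf → ℝ≥0∞} (hF : Measurable F) (c : Fin 2) (r z y : ℝ) :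
    ∫⁻ J, (if J.wait < r then F (next ((c, r, z), y, J)) else 0) ∂(inputMeasure lam ν) =
      busyPart lam ν (avg lam ν F) c r z y := by
  have h := lintegral_input_arrival lam ν (K := fun c' t s J =>
    if t < r then F (if c ≠ c' then (c, r - t, z) else (c', s, s), y + t, J) else 0) ?_
  · calc _ = _ := ?_
      _ = _ := h
      _ = _ := ?_
    · refine lintegral_congr fun J => ?_
      by_cases hJ : J.wait < r
      · by_cases hc : c = J.src <;> simp [hJ, next, hc]
      · simp [hJ]
    · refine arrival_congr lam ν fun c' t _ => lintegral_congr fun s => ?_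
      by_cases ht : t < r
      · simp [ht, avg]
      · simp [ht]
  · intro c'
    refine Measurable.ite (measurableSet_lt (by fun_prop) (by fun_prop)) ?_ measurable_const
    by_cases hc : c = c'
    · simp only [hc, ne_eq, not_true_eq_false, if_false]
      fun_prop
    · simp only [hc, ne_eq, not_false_eq_true, if_true]
      fun_prop

/-- At the completion of the service the sources are fresh again, so the next packet is that of an
empty system at time y + r. -/
lemma lintegral_next_of_le_wait {F : Conf → ℝ≥0∞} (hF : Measurable F) (c : Fin 2) {r : ℝ}
    (hr : 0 ≤ r) (z y : ℝ) :
    ∫⁻ J, (if r ≤ J.wait then F (next ((c, r, z), y, J)) else 0) ∂(inputMeasure lam ν) =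
      ENNReal.ofReal (Real.exp (-((lam 0 + lam 1) * r))) *
        freshPart lam ν (avg lam ν F) (y + r) := by
  have h := lintegral_input_arrival lam ν (K := fun c' t s J => F ((c', s, s), y + r + t, J)) ?_
  · calc _ = ∫⁻ J, (if r ≤ J.wait then (fun J => F ((J.src, J.serv, J.serv), y + r + J.wait, J.pop))
        (J.delay r) else 0) ∂(inputMeasure lam ν) := ?_
      _ = _ := lintegral_input_delay lam ν hr (F := fun J =>
        F ((J.src, J.serv, J.serv), y + r + J.wait, J.pop)) (by fun_prop)
      _ = _ := by rw [h]; rfl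
    refine lintegral_congr fun J => ?_
    by_cases hJ : r ≤ J.wait
    · have e1 : (J.delay r).wait = J.wait - r := by
        simp [Input.delay, Input.wait, Stream.delay, min_sub_sub_right]
      have e2 : (J.delay r).src = J.src := by
        simp [Input.delay, Input.src, Stream.delay]
      have e3 : (J.delay r).serv = J.serv := by
        simp [Input.delay, Input.serv, Stream.delay, Stream.serv]
      have e4 : (J.delay r).pop = J.pop := by
        by_cases hle : J.1.1 ≤ J.2.1 <;>
        simp [Input.delay, Input.pop, Stream.delay, Stream.pop, hle]
      simp only [hJ, if_true, next, not_lt.2 hJ, false_and, if_false, e1, e2, e3, e4]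
      congr 3
      ring
    · simp [hJ]
  · intro c'
    fun_prop

lemma lintegral_const_of_le_wait {r : ℝ} (hr : 0 ≤ r) (a : ℝ≥0∞) :
    ∫⁻ J : Input, (if r ≤ J.wait then a else 0) ∂(inputMeasure lam ν) =
      ENNReal.ofReal (Real.exp (-((lam 0 + lam 1) * r))) * a := by
  rw [lintegral_input_delay lam ν hr (F := fun _ => a) measurable_const]
  simp

-- First-step analysis while a packet of source 1 is in service: either it is delivered, and the
-- future at that moment is fresh, or the chain moves to the next arrival.
open Classical in
lemma avg_step_zero {F : Conf → ℝ≥0∞} (hF : Measurable F) {h : ℝ → ℝ → ℝ≥0∞}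
    {f : Input → ℝ≥0∞} (hf : Measurable f) {r : ℝ} (hr : 0 ≤ r) (z y : ℝ) :
    avg lam ν (fun s => if s.Done then reward h f s else F s.next) (0, r, z) y =
      ENNReal.ofReal (Real.exp (-((lam 0 + lam 1) * r))) *
        (h (y + r) z * ∫⁻ J, f J ∂(inputMeasure lam ν)) +
      busyPart lam ν (avg lam ν F) 0 r z y := by
  have hsplit : ∀ J : Input, (if Done ((0, r, z), y, J) then reward h f ((0, r, z), y, J)
      else F (next ((0, r, z), y, J))) =
      (if r ≤ J.wait then (fun J => h (y + r) z * f J) (J.delay r) else 0) +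
      (if J.wait < r then F (next ((0, r, z), y, J)) else 0) := by
    intro J
    by_cases hJ : r ≤ J.wait
    · simp [Done, hJ, not_lt.2 hJ, reward]
    · simp [Done, hJ, not_le.1 hJ]
  have hm : Measurable fun J : Input => if J.wait < r then F (next ((0, r, z), y, J)) else 0 :=
    Measurable.ite (measurableSet_lt (by fun_prop) (by fun_prop))
      ((hF.comp measurable_next).comp (by fun_prop)) measurable_const
  simp only [avg, hsplit]
  rw [lintegral_add_right _ hm, lintegral_next_of_wait_lt lam ν hF,
    lintegral_input_delay lam ν hr (F := fun J => h (y + r) z * f J) (by fun_prop),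
    lintegral_const_mul _ hf]

-- While a packet of source 2 is in service no delivery of source 1 can occur; its completion leads
-- to the empty system.
open Classical in
lemma avg_step_one {F : Conf → ℝ≥0∞} (hF : Measurable F) (H : Conf → ℝ≥0∞) {r : ℝ} (hr : 0 ≤ r)
    (z y : ℝ) :
    avg lam ν (fun s => if s.Done then H s else F s.next) (1, r, z) y =
      ENNReal.ofReal (Real.exp (-((lam 0 + lam 1) * r))) * freshPart lam ν (avg lam ν F) (y + r) +
      busyPart lam ν (avg lam ν F) 1 r z y := by
  have hsplit : ∀ J : Input, (if Done ((1, r, z), y, J) then H ((1, r, z), y, J)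
      else F (next ((1, r, z), y, J))) =
      (if r ≤ J.wait then F (next ((1, r, z), y, J)) else 0) +
      (if J.wait < r then F (next ((1, r, z), y, J)) else 0) := by
    intro J
    by_cases hJ : r ≤ J.wait
    · simp [Done, hJ, not_lt.2 hJ]
    · simp [Done, hJ, not_le.1 hJ]
  have hm : Measurable fun J : Input => if J.wait < r then F (next ((1, r, z), y, J)) else 0 :=
    Measurable.ite (measurableSet_lt (by fun_prop) (by fun_prop))
      ((hF.comp measurable_next).comp (by fun_prop)) measurable_const
  simp only [avg, hsplit]
  rw [lintegral_add_right _ hm, lintegral_next_of_wait_lt lam ν hF,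
    lintegral_next_of_le_wait lam ν hF _ hr]

section

variable {lam ν}

/-- Nonnegativity of the service times keeps the next configuration in the region where the two
functions are known to agree; this is what inductions over the number of arrivals need. -/
lemma busyPart_congr (hν : ∀ᵐ s ∂ν, 0 ≤ s) {φ ψ : Fin 2 × ℝ × ℝ → ℝ → ℝ≥0∞}
    (h : ∀ c r z y, 0 ≤ r → 0 ≤ y → φ (c, r, z) y = ψ (c, r, z) y) (c : Fin 2) (r z : ℝ) {y : ℝ}
    (hy : 0 ≤ y) : busyPart lam ν φ c r z y = busyPart lam ν ψ c r z y := by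
  refine arrival_congr lam ν fun c' t ht => lintegral_congr_ae ?_
  filter_upwards [hν] with s hs
  by_cases htr : t < r
  · by_cases hc : c = c'
    · simp [htr, hc, h _ _ _ _ hs (by positivity : 0 ≤ y + t)]
    · simp [htr, hc, h _ _ _ _ (sub_nonneg.2 htr.le) (by positivity : 0 ≤ y + t)]
  · simp [htr]

lemma freshPart_congr (hν : ∀ᵐ s ∂ν, 0 ≤ s) {φ ψ : Fin 2 × ℝ × ℝ → ℝ → ℝ≥0∞}
    (h : ∀ c r z y, 0 ≤ r → 0 ≤ y → φ (c, r, z) y = ψ (c, r, z) y) {y : ℝ} (hy : 0 ≤ y) :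
    freshPart lam ν φ y = freshPart lam ν ψ y := by
  refine arrival_congr lam ν fun c' t ht => lintegral_congr_ae ?_
  filter_upwards [hν] with s hs
  exact h _ _ _ _ hs (by positivity)

lemma busyPart_mul_const (φ : Fin 2 × ℝ × ℝ → ℝ → ℝ≥0∞) {a : ℝ≥0∞} (ha : a ≠ ∞) (c : Fin 2)
    (r z y : ℝ) :
    busyPart lam ν (fun m y => φ m y * a) c r z y = busyPart lam ν φ c r z y * a := by
  rw [busyPart, busyPart, ← arrival_mul_const lam ν _ ha]
  congr 1
  ext c' t s
  split_ifs <;> simp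

lemma freshPart_mul_const (φ : Fin 2 × ℝ × ℝ → ℝ → ℝ≥0∞) {a : ℝ≥0∞} (ha : a ≠ ∞) (y : ℝ) :
    freshPart lam ν (fun m y => φ m y * a) y = freshPart lam ν φ y * a := by
  rw [freshPart, freshPart, ← arrival_mul_const lam ν _ ha]

/-- The future after the first delivery of source 1 is independent of the past. -/
lemma avg_run_reward (hν : ∀ᵐ s ∂ν, 0 ≤ s) {h : ℝ → ℝ → ℝ≥0∞}
    (hh : Measurable fun q : ℝ × ℝ => h q.1 q.2)
    {f : Input → ℝ≥0∞} (hf : Measurable f) (hfi : ∫⁻ J, f J ∂(inputMeasure lam ν) ≠ ∞) (n : ℕ) :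
    ∀ c r z y, 0 ≤ r → 0 ≤ y →
    avg lam ν (run 0 (reward h f) n) (c, r, z) y =
      avg lam ν (run 0 (reward h 1) n) (c, r, z) y * ∫⁻ J, f J ∂(inputMeasure lam ν) := by
  classical
  induction n with
  | zero => intro c r z y _ _; simp [avg, run]
  | succ n ih =>
    intro c r z y hr hy
    have hF := measurable_run (G := 0) measurable_zero (measurable_reward hh hf) n
    have hF1 := measurable_run (G := 0) measurable_zero
      (measurable_reward hh (f := 1) measurable_one) n
    have e : ∀ f : Input → ℝ≥0∞, run 0 (reward h f) (n + 1) =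
      fun s => if s.Done then reward h f s else run 0 (reward h f) n s.next := fun f => by
        ext s; simp [run]
    rw [e, e]
    set ψ : Fin 2 × ℝ × ℝ → ℝ → ℝ≥0∞ := fun m y =>
      avg lam ν (run 0 (reward h 1) n) m y * ∫⁻ J, f J ∂(inputMeasure lam ν)
    rcases (by omega : c = 0 ∨ c = 1) with rfl | rfl
    · rw [avg_step_zero lam ν hF hf hr, avg_step_zero lam ν hF1 measurable_one hr,
        busyPart_congr hν (ψ := ψ) ih _ _ _ hy, busyPart_mul_const _ hfi]
      simp only [Pi.one_apply, lintegral_one, measure_univ, mul_one]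
      ring
    · rw [avg_step_one lam ν hF _ hr, avg_step_one lam ν hF1 _ hr,
        busyPart_congr hν (ψ := ψ) ih _ _ _ hy, busyPart_mul_const _ hfi,
        freshPart_congr hν (ψ := ψ) ih (by positivity), freshPart_mul_const _ hfi]
      ring

end

end Conf

end

/-! ### Value functions and optional stopping -/

section

namespace Conf

variable (lam : Fin 2 → ℝ) [hlam : ∀ c, Fact (0 < lam c)] (ν : Measure ℝ) [IsProbabilityMeasure ν]

/-- The value of a configuration in which a packet of source `c` with residual service time `r` is
under service: the service is completed, with value `a`, unless another packet of
source `c` arrives before, which has value `k`. -/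
def busyValue (a : Fin 2 → ℝ → ℝ → ℝ≥0∞) (k : Fin 2 → ℝ → ℝ≥0∞) (m : Fin 2 × ℝ × ℝ) (y : ℝ) : ℝ≥0∞ :=
  ∫⁻ J, (if m.2.1 ≤ (Input.stream m.1 J).1 then a m.1 (y + m.2.1) m.2.2
    else k m.1 (y + (Input.stream m.1 J).1)) ∂(inputMeasure lam ν)

/-- The value `a` of the completion of a service: `h` for source 1, and for source 2 the value `e` of
the empty system. -/
def completion (h : ℝ → ℝ → ℝ≥0∞) (e : ℝ → ℝ≥0∞) (c : Fin 2) (y z : ℝ) : ℝ≥0∞ :=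
  if c = 0 then h y z else e y

/-- `k c y` and `e y` are the values at time `y` of the configurations in which a
packet of source `c` has just arrived, or the system is empty, when the value of a delivery of
source 1 at time `y` with service time `z` is `h y z`. -/
structure IsValue (h : ℝ → ℝ → ℝ≥0∞) (e : ℝ → ℝ≥0∞) (k : Fin 2 → ℝ → ℝ≥0∞) : Prop where
  meas_h : Measurable fun q : ℝ × ℝ => h q.1 q.2
  meas_e : Measurable e
  meas_k : ∀ c, Measurable (k c)
  start : ∀ c y, 0 ≤ y → ∫⁻ s, busyValue lam ν (completion h e) k (c, s, s) y ∂ν = k c y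
  empty : ∀ y, 0 ≤ y → e y = ∑ c, ∫⁻ t, ENNReal.ofReal (Real.exp (-(lam (1 - c) * t))) *
    k c (y + t) ∂(expMeasure (lam c))

variable {lam ν}
variable {h : ℝ → ℝ → ℝ≥0∞} {e : ℝ → ℝ≥0∞} {k : Fin 2 → ℝ → ℝ≥0∞}

lemma measurable_stream (c : Fin 2) : Measurable (Input.stream c) := by
  unfold Input.stream
  split_ifs <;> fun_prop

lemma IsValue.measurable_completion (hv : IsValue lam ν h e k) (c : Fin 2) :
    Measurable fun q : ℝ × ℝ => completion h e c q.1 q.2 := by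
  unfold completion
  split_ifs
  · exact hv.meas_h
  · exact hv.meas_e.comp measurable_fst

lemma IsValue.measurable_integrand (hv : IsValue lam ν h e k) (c : Fin 2) :
    Measurable fun q : (ℝ × ℝ × ℝ) × Input => if q.1.1 ≤ (Input.stream c q.2).1
      then completion h e c (q.1.2.2 + q.1.1) q.1.2.1
      else k c (q.1.2.2 + (Input.stream c q.2).1) := by
  have hs : Measurable fun q : (ℝ × ℝ × ℝ) × Input => (Input.stream c q.2).1 :=
    ((measurable_stream c).comp measurable_snd).fst
  refine Measurable.ite (measurableSet_le (by fun_prop) hs) ?_ ?_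
  · exact (hv.measurable_completion c).comp
      (by fun_prop : Measurable fun q : (ℝ × ℝ × ℝ) × Input => (q.1.2.2 + q.1.1, q.1.2.1))
  · exact (hv.meas_k c).comp (Measurable.add (by fun_prop) hs)

lemma IsValue.measurable_busyValue (hv : IsValue lam ν h e k) :
    Measurable fun q : (Fin 2 × ℝ × ℝ) × ℝ => busyValue lam ν (completion h e) k q.1 q.2 := by
  have h1 : ∀ c, Measurable fun q : ℝ × ℝ × ℝ =>
      busyValue lam ν (completion h e) k (c, q.1, q.2.1) q.2.2 := fun c =>
    (hv.measurable_integrand c).lintegral_prod_right'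
  have h2 : Measurable fun q : Fin 2 × ℝ × ℝ × ℝ =>
      busyValue lam ν (completion h e) k (q.1, q.2.1, q.2.2.1) q.2.2.2 :=
    measurable_from_prod_countable_right fun c => h1 c
  exact h2.comp (by fun_prop : Measurable fun q : (Fin 2 × ℝ × ℝ) × ℝ =>
    (q.1.1, q.1.2.1, q.1.2.2, q.2))

/-- The value as a function of the configuration. -/
def value (lam : Fin 2 → ℝ) (ν : Measure ℝ) (h : ℝ → ℝ → ℝ≥0∞) (e : ℝ → ℝ≥0∞)
    (k : Fin 2 → ℝ → ℝ≥0∞) (s : Conf) : ℝ≥0∞ :=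
  busyValue lam ν (completion h e) k s.1 s.2.1

lemma IsValue.measurable_value (hv : IsValue lam ν h e k) : Measurable (value lam ν h e k) :=
  hv.measurable_busyValue.comp (by fun_prop : Measurable fun s : Conf => (s.1, s.2.1))

lemma avg_value (m : Fin 2 × ℝ × ℝ) (y : ℝ) :
    avg lam ν (value lam ν h e k) m y = busyValue lam ν (completion h e) k m y := by
  simp [avg, value]

/-- The race defining `busyValue` only looks at the next arrival of source c. Stopping it at the
first arrival of either source shows that it is harmonic for the chain: an arrival of the other
source leaves, by lack of memory, the same race with residual r - t, and an arrival of source c has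
value `k c` by `IsValue.start`. -/
lemma IsValue.busyValue_eq (hv : IsValue lam ν h e k) (c : Fin 2) {r : ℝ} (hr : 0 ≤ r) (z : ℝ) {y : ℝ}
    (hy : 0 ≤ y) :
    busyValue lam ν (completion h e) k (c, r, z) y =
      ENNReal.ofReal (Real.exp (-((lam 0 + lam 1) * r))) * completion h e c (y + r) z +
      busyPart lam ν (busyValue lam ν (completion h e) k) c r z y := by
  set ψ : Input → ℝ≥0∞ := fun J => if r ≤ (Input.stream c J).1 then completion h e c (y + r) z
    else k c (y + (Input.stream c J).1) with hψ
  have hψm : Measurable ψ := (hv.measurable_integrand c).comp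
    (by fun_prop : Measurable fun J : Input => ((r, z, y), J))
  have hsplit : ∀ J : Input, ψ J = (if r ≤ J.wait then completion h e c (y + r) z else 0) +
      (if J.wait < r then ψ J else 0) := by
    intro J
    by_cases hJ : r ≤ J.wait
    · have : r ≤ (Input.stream c J).1 := by
        refine hJ.trans ?_
        unfold Input.wait Input.stream
        split_ifs
        · exact min_le_left _ _
        · exact min_le_right _ _
      simp [hψ, hJ, not_lt.2 hJ, this]
    · simp [hJ, not_le.1 hJ]
  have h0 : busyValue lam ν (completion h e) k (c, r, z) y = ∫⁻ J, ψ J ∂(inputMeasure lam ν) := rfl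
  have hm : Measurable fun J : Input => if J.wait < r then ψ J else 0 :=
    Measurable.ite (measurableSet_lt (by fun_prop) (by fun_prop)) hψm measurable_const
  rw [h0]
  rw [lintegral_congr hsplit]
  rw [lintegral_add_right _ hm, lintegral_const_of_le_wait lam ν hr]
  congr 1
  have harr := lintegral_input_arrival lam ν (K := fun c' t s J =>
    if t < r then (if c ≠ c' then (if r - t ≤ (Input.stream c J).1
      then completion h e c (y + t + (r - t)) z else k c (y + t + (Input.stream c J).1))
      else k c (y + t)) else 0) ?_
  · calc _ = _ := ?_
      _ = _ := harr
      _ = _ := ?_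
    · refine lintegral_congr fun J => ?_
      by_cases hJ : J.wait < r
      · simp only [hJ, if_true, hψ]
        rcases (by omega : c = 0 ∨ c = 1) with rfl | rfl
        -- If the next arrival belongs to source c, it decides the race as it comes before r.
        -- Otherwise it only delays the stream of source c, and clock plus remaining time is
        -- unchanged.
        · by_cases hle : J.1.1 ≤ J.2.1
          · have e1 : J.wait = J.1.1 := by simp [Input.wait, hle]
            have : ¬ r ≤ J.1.1 := by rw [e1] at hJ; exact not_le.2 hJ
            simp [Input.src, Input.stream, hle, e1, this]
          · have e1 : J.wait = J.2.1 := by simp [Input.wait, (not_le.1 hle).le]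
            simp [Input.src, Input.stream, hle, e1, Input.pop, Stream.delay]
        · by_cases hle : J.1.1 ≤ J.2.1
          · have e1 : J.wait = J.1.1 := by simp [Input.wait, hle]
            simp [Input.src, Input.stream, hle, e1, Input.pop, Stream.delay]
          · have e1 : J.wait = J.2.1 := by simp [Input.wait, (not_le.1 hle).le]
            have : ¬ r ≤ J.2.1 := by rw [e1] at hJ; exact not_le.2 hJ
            simp [Input.src, Input.stream, hle, e1, this]
      · simp [hJ]
    · refine arrival_congr lam ν fun c' t ht => ?_
      by_cases htr : t < r
      · by_cases hc : c = c'
        · subst hc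
          simp only [htr, if_true, ne_eq, not_true_eq_false, if_false]
          rw [hv.start c (y + t) (by positivity)]
          simp
        · simp [htr, hc, busyValue]
      · simp [htr]
  · intro c'
    refine Measurable.ite (measurableSet_lt (by fun_prop) (by fun_prop)) ?_ measurable_const
    by_cases hc : c = c'
    · simp only [hc, ne_eq, not_true_eq_false, if_false]
      exact (hv.meas_k _).comp (by fun_prop)
    · simp only [hc, ne_eq, not_false_eq_true, if_true]
      exact (hv.measurable_integrand c).comp
        (by fun_prop : Measurable fun q : ℝ × ℝ × Input => ((r - q.1, z, y + q.1), q.2.2))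

lemma IsValue.freshPart_eq (hv : IsValue lam ν h e k) {y : ℝ} (hy : 0 ≤ y) :
    freshPart lam ν (busyValue lam ν (completion h e) k) y = e y := by
  rw [hv.empty y hy, freshPart, arrival]
  refine Finset.sum_congr rfl fun c _ => lintegral_congr_ae ?_
  filter_upwards [ae_pos_expMeasure (lam c)] with t ht
  rw [hv.start c (y + t) (by positivity)]

/-- Optional stopping: the value is preserved by running the system. -/
lemma IsValue.avg_run (hv : IsValue lam ν h e k) (hν : ∀ᵐ s ∂ν, 0 ≤ s) (n : ℕ) :
    ∀ c r z y, 0 ≤ r → 0 ≤ y →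
    avg lam ν (run (value lam ν h e k) (reward h 1) n) (c, r, z) y =
      busyValue lam ν (completion h e) k (c, r, z) y := by
  classical
  induction n with
  | zero => intro c r z y _ _; exact avg_value _ _
  | succ n ih =>
    intro c r z y hr hy
    have hF := measurable_run hv.measurable_value (measurable_reward hv.meas_h (f := 1) measurable_one) n
    have e1 : run (value lam ν h e k) (reward h 1) (n + 1) = fun s => if s.Done then reward h 1 s
        else run (value lam ν h e k) (reward h 1) n s.next := by
      ext s; simp [run]
    rw [e1, hv.busyValue_eq c hr z hy]
    rcases (by omega : c = 0 ∨ c = 1) with rfl | rfl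
    · rw [avg_step_zero lam ν hF measurable_one hr,
        busyPart_congr hν (ψ := busyValue lam ν (completion h e) k) ih _ _ _ hy]
      simp [completion]
    · rw [avg_step_one lam ν hF _ hr,
        busyPart_congr hν (ψ := busyValue lam ν (completion h e) k) ih _ _ _ hy,
        freshPart_congr hν (ψ := busyValue lam ν (completion h e) k) ih (by positivity),
        hv.freshPart_eq (by positivity)]
      simp [completion]

end Conf

end

section

/-! ### Moments of the exponential distribution -/

lemma lintegral_pow_mul_exp {r : ℝ} (hr : 0 < r) (n : ℕ) :
    ∫⁻ x in Set.Ici (0 : ℝ), ENNReal.ofReal (x ^ n * Real.exp (-(r * x))) =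
      ENNReal.ofReal (n.factorial / r ^ (n + 1)) := by
  have h := Real.integral_rpow_mul_exp_neg_mul_Ioi (a := n + 1) (r := r) (by positivity) hr
  have hval : (1 / r) ^ ((n : ℝ) + 1) * Real.Gamma (n + 1) = n.factorial / r ^ (n + 1) := by
    rw [Real.Gamma_nat_eq_factorial]
    have : ((n : ℝ) + 1) = ((n + 1 : ℕ) : ℝ) := by push_cast; ring
    rw [this, Real.rpow_natCast, one_div, inv_pow]
    ring
  rw [hval] at h
  have h2 : ∫ t in Set.Ioi (0 : ℝ), t ^ n * Real.exp (-(r * t)) = n.factorial / r ^ (n + 1) := by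
    rw [← h]
    refine setIntegral_congr_fun measurableSet_Ioi fun t _ => ?_
    simp [Real.rpow_natCast]
  rw [setLIntegral_congr Ioi_ae_eq_Ici.symm, ← h2, ofReal_integral_eq_lintegral_ofReal]
  -- A non-integrable function has Bochner integral 0, whereas the value just found is positive.
  · by_contra hni
    rw [← IntegrableOn, ] at hni
    have := integral_undef hni
    rw [this] at h2
    have : 0 < (n.factorial : ℝ) / r ^ (n + 1) := by positivity
    linarith
  · filter_upwards [ae_restrict_mem measurableSet_Ioi] with t ht
    have : (0 : ℝ) < t := ht
    positivity

lemma lintegral_exp_mul_quadratic (l : ℝ) [hl : Fact (0 < l)] {κ : ℝ} (hκ : 0 ≤ κ) {α β γ : ℝ}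
    (hα : 0 ≤ α) (hβ : 0 ≤ β) (hγ : 0 ≤ γ) :
    ∫⁻ x, ENNReal.ofReal (Real.exp (-(κ * x))) * ENNReal.ofReal (α + β * x + γ * x ^ 2)
      ∂(expMeasure l) =
      ENNReal.ofReal (l / (l + κ) * (α + β / (l + κ) + 2 * γ / (l + κ) ^ 2)) := by
  have hl := hl.out
  have hs : 0 < l + κ := by positivity
  rw [lintegral_expMeasure l (by fun_prop)]
  have h1 : ∀ x ∈ Set.Ici (0 : ℝ), ENNReal.ofReal (l * Real.exp (-(l * x))) *
      (ENNReal.ofReal (Real.exp (-(κ * x))) * ENNReal.ofReal (α + β * x + γ * x ^ 2)) =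
      ENNReal.ofReal (l * α) * ENNReal.ofReal (x ^ 0 * Real.exp (-((l + κ) * x))) +
      ENNReal.ofReal (l * β) * ENNReal.ofReal (x ^ 1 * Real.exp (-((l + κ) * x))) +
      ENNReal.ofReal (l * γ) * ENNReal.ofReal (x ^ 2 * Real.exp (-((l + κ) * x))) := by
    intro x hx
    have hx : 0 ≤ x := hx
    simp only [← ENNReal.ofReal_mul (mul_nonneg hl.le hα), ← ENNReal.ofReal_mul (mul_nonneg hl.le hβ),
      ← ENNReal.ofReal_mul (mul_nonneg hl.le hγ)]
    rw [← ENNReal.ofReal_mul (by positivity), ← ENNReal.ofReal_mul (by positivity),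
      ← ENNReal.ofReal_add (by positivity) (by positivity),
      ← ENNReal.ofReal_add (by positivity) (by positivity)]
    congr 1
    rw [add_mul, neg_add, Real.exp_add]
    ring
  rw [setLIntegral_congr_fun measurableSet_Ici h1, lintegral_add_right _ (by fun_prop),
    lintegral_add_right _ (by fun_prop), lintegral_const_mul _ (by fun_prop),
    lintegral_const_mul _ (by fun_prop), lintegral_const_mul _ (by fun_prop),
    lintegral_pow_mul_exp hs, lintegral_pow_mul_exp hs, lintegral_pow_mul_exp hs,
    ← ENNReal.ofReal_mul (by positivity), ← ENNReal.ofReal_mul (by positivity),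
    ← ENNReal.ofReal_mul (by positivity), ← ENNReal.ofReal_add (by positivity) (by positivity),
    ← ENNReal.ofReal_add (by positivity) (by positivity)]
  congr 1
  simp only [Nat.factorial]
  push_cast
  field_simp

lemma lintegral_exp_quadratic (l : ℝ) [hl : Fact (0 < l)] {α β γ : ℝ}
    (hα : 0 ≤ α) (hβ : 0 ≤ β) (hγ : 0 ≤ γ) :
    ∫⁻ x, ENNReal.ofReal (α + β * x + γ * x ^ 2) ∂(expMeasure l) =
      ENNReal.ofReal (α + β / l + 2 * γ / l ^ 2) := by
  have h := lintegral_exp_mul_quadratic l le_rfl hα hβ hγ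
  simpa [div_self hl.out.ne'] using h

/-- The part of the quadratic on x < s is its full integral minus its tail on s ≤ x, and the tail
follows from lack of memory. The tail is added on both sides first, since subtraction in `ℝ≥0∞` is
truncated. -/
lemma lintegral_exp_service (l : ℝ) [hl : Fact (0 < l)] {α β γ v s : ℝ}
    (hα : 0 ≤ α) (hβ : 0 ≤ β) (hγ : 0 ≤ γ) (hv : 0 ≤ v) (hs : 0 ≤ s) :
    ∫⁻ x, (if s ≤ x then ENNReal.ofReal v else ENNReal.ofReal (α + β * x + γ * x ^ 2))
      ∂(expMeasure l) =
      ENNReal.ofReal (Real.exp (-(l * s)) * v + (α + β / l + 2 * γ / l ^ 2) -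
        Real.exp (-(l * s)) *
          ((α + β * s + γ * s ^ 2) + (β + 2 * γ * s) / l + 2 * γ / l ^ 2)) := by
  have hl' := hl.out
  have hmeas : Measurable fun x => if s ≤ x then ENNReal.ofReal (α + β * x + γ * x ^ 2) else 0 :=
    Measurable.ite measurableSet_Ici (by fun_prop) measurable_const
  have h1 : ∫⁻ x, (if s ≤ x then ENNReal.ofReal (α + β * x + γ * x ^ 2) else 0) ∂(expMeasure l) =
      ENNReal.ofReal (Real.exp (-(l * s)) *
        ((α + β * s + γ * s ^ 2) + (β + 2 * γ * s) / l + 2 * γ / l ^ 2)) := by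
    rw [ENNReal.ofReal_mul (Real.exp_pos _).le, ← lintegral_exp_quadratic l (by positivity)
      (by positivity) hγ, ← lintegral_expMeasure_memoryless l hs (by fun_prop)]
    refine lintegral_congr fun x => ?_
    congr 2
    ring
  have h2 : ∫⁻ x, (if s ≤ x then ENNReal.ofReal v else 0) ∂(expMeasure l) =
      ENNReal.ofReal (Real.exp (-(l * s)) * v) := by
    rw [lintegral_expMeasure_memoryless l hs (F := fun _ => ENNReal.ofReal v) measurable_const,
      ENNReal.ofReal_mul (Real.exp_pos _).le]
    simp
  have h3 := lintegral_exp_quadratic l hα hβ hγ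
  have hsum : ∫⁻ x, (if s ≤ x then ENNReal.ofReal v else ENNReal.ofReal (α + β * x + γ * x ^ 2))
      ∂(expMeasure l) + ∫⁻ x, (if s ≤ x then ENNReal.ofReal (α + β * x + γ * x ^ 2) else 0)
        ∂(expMeasure l) = ∫⁻ x, (if s ≤ x then ENNReal.ofReal v else 0) ∂(expMeasure l) +
      ∫⁻ x, ENNReal.ofReal (α + β * x + γ * x ^ 2) ∂(expMeasure l) := by
    rw [← lintegral_add_right _ hmeas, ← lintegral_add_right _ (by fun_prop)]
    refine lintegral_congr fun x => ?_
    by_cases hx : s ≤ x <;> simp [hx]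
  rw [h1, h2, h3, ← ENNReal.ofReal_add (by positivity) (by positivity)] at hsum
  rw [ENNReal.ofReal_sub _ (by positivity)]
  exact ENNReal.eq_sub_of_add_eq ENNReal.ofReal_ne_top hsum

/-! ### The transform of the service times -/

section Service

variable (ν : Measure ℝ) [IsProbabilityMeasure ν] {l : ℝ}

lemma integrable_exp_service (hν : ∀ᵐ s ∂ν, 0 ≤ s) (hl : 0 < l) :
    Integrable (fun s => Real.exp (-l * s)) ν := by
  refine Integrable.of_bound (by fun_prop) 1 ?_
  filter_upwards [hν] with s hs
  rw [Real.norm_of_nonneg (Real.exp_pos _).le]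
  exact Real.exp_le_one_iff.2 (by nlinarith)

/-- The difference of the two sides is, for s ≥ 0, the mean of an exponential time on the event that
it is below s. It bounds s exp (-l s) uniformly, so no moment of the service time has to be finite.
-/
lemma mul_exp_le {s : ℝ} (hl : 0 < l) : s * Real.exp (-l * s) ≤ (1 - Real.exp (-l * s)) / l := by
  rw [le_div_iff₀ hl]
  have h1 := Real.add_one_le_exp (l * s)
  have h2 : Real.exp (-l * s) * Real.exp (l * s) = 1 := by rw [← Real.exp_add]; simp
  nlinarith [Real.exp_pos (-l * s)]

lemma integrable_mul_exp_service (hν : ∀ᵐ s ∂ν, 0 ≤ s) (hl : 0 < l) :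
    Integrable (fun s => s * Real.exp (-l * s)) ν := by
  refine Integrable.of_bound (by fun_prop) (1 / l) ?_
  filter_upwards [hν] with s hs
  rw [Real.norm_of_nonneg (by positivity)]
  refine (mul_exp_le hl).trans ?_
  gcongr
  linarith [Real.exp_pos (-l * s)]

lemma L_pos (hν : ∀ᵐ s ∂ν, 0 ≤ s) (hl : 0 < l) : 0 < L ν l := by
  rw [L, integral_pos_iff_support_of_nonneg (fun s => (Real.exp_pos _).le)
    (integrable_exp_service ν hν hl)]
  simp [Function.support, Real.exp_ne_zero]

lemma L_le_one (hν : ∀ᵐ s ∂ν, 0 ≤ s) (hl : 0 < l) : L ν l ≤ 1 := by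
  have h : ∫ s, Real.exp (-l * s) ∂ν ≤ ∫ _, (1 : ℝ) ∂ν := by
    refine integral_mono_ae (integrable_exp_service ν hν hl) (integrable_const _) ?_
    filter_upwards [hν] with s hs
    exact Real.exp_le_one_iff.2 (by nlinarith)
  simpa [L] using h

lemma L'_nonneg (hν : ∀ᵐ s ∂ν, 0 ≤ s) : 0 ≤ L' ν l := by
  refine integral_nonneg_of_ae ?_
  filter_upwards [hν] with s hs
  have := Real.exp_pos (-l * s)
  simp only [Pi.zero_apply]
  positivity

lemma integral_service_affine (hν : ∀ᵐ s ∂ν, 0 ≤ s) (hl : 0 < l) (c₀ c₁ c₂ : ℝ) :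
    Integrable (fun s => c₀ + c₁ * Real.exp (-l * s) + c₂ * (s * Real.exp (-l * s))) ν ∧
    ∫ s, (c₀ + c₁ * Real.exp (-l * s) + c₂ * (s * Real.exp (-l * s))) ∂ν =
      c₀ + c₁ * L ν l + c₂ * L' ν l := by
  have h1 := (integrable_exp_service ν hν hl).const_mul c₁
  have h2 := (integrable_mul_exp_service ν hν hl).const_mul c₂
  have h0 : Integrable (fun _ : ℝ => c₀) ν := integrable_const _
  have h01 : Integrable (fun s => c₀ + c₁ * Real.exp (-l * s)) ν := h0.add h1
  refine ⟨h01.add h2, ?_⟩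
  rw [integral_add h01 h2, integral_add h0 h1, integral_const_mul, integral_const_mul]
  simp [L, L']

lemma L'_le (hν : ∀ᵐ s ∂ν, 0 ≤ s) (hl : 0 < l) : L' ν l ≤ (1 - L ν l) / l := by
  obtain ⟨h1, h2⟩ := integral_service_affine ν hν hl (1 / l) (-(1 / l)) (-1)
  have h3 : 0 ≤ ∫ s, (1 / l + -(1 / l) * Real.exp (-l * s) + -1 * (s * Real.exp (-l * s))) ∂ν := by
    refine integral_nonneg fun s => ?_
    have := mul_exp_le (s := s) hl
    have h4 : (1 - Real.exp (-l * s)) / l = 1 / l + -(1 / l) * Real.exp (-l * s) := by ring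
    simp only [Pi.zero_apply]
    linarith
  rw [h2] at h3
  have h4 : (1 - L ν l) / l = 1 / l + -(1 / l) * L ν l := by ring
  linarith

end Service

/-- The conditional value of a trial of a service of length `s`. -/
def trialValue (l a g b q y s : ℝ) : ℝ :=
  y ^ 2 + 2 * y * ((1 - Real.exp (-l * s)) * (1 / l + b) + a * Real.exp (-l * s)) +
    (2 * a * (s * Real.exp (-l * s)) + g * Real.exp (-l * s) + (2 / l + 2 * b) *
      ((1 - Real.exp (-l * s)) / l - s * Real.exp (-l * s)) + q * (1 - Real.exp (-l * s)))

section Quadratic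

variable {l : ℝ} [hl : Fact (0 < l)] {a g b q y s : ℝ}

lemma trialValue_nonneg (ha : 0 ≤ a) (hg : 0 ≤ g) (hb : 0 ≤ b) (hq : 0 ≤ q)
    (hy : 0 ≤ y) (hs : 0 ≤ s) : 0 ≤ trialValue l a g b q y s := by
  have hl := hl.out
  have e1 : Real.exp (-l * s) ≤ 1 := Real.exp_le_one_iff.2 (by nlinarith)
  have e3 := sub_nonneg.2 e1
  have e4 := sub_nonneg.2 (mul_exp_le (s := s) hl)
  unfold trialValue
  positivity

/-- The bound does not depend on the service time `s`; this makes the value function at most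
quadratic in the clock. -/
lemma trialValue_le (ha : 0 ≤ a) (hg : 0 ≤ g) (hb : 0 ≤ b) (hq : 0 ≤ q)
    (hy : 0 ≤ y) (hs : 0 ≤ s) : trialValue l a g b q y s ≤
      y ^ 2 + 2 * y * (1 / l + b + a) + (2 * a * (1 / l) + g + (2 / l + 2 * b) * (1 / l) + q) := by
  have hl := hl.out
  have e0 := Real.exp_pos (-l * s)
  have e1 : Real.exp (-l * s) ≤ 1 := Real.exp_le_one_iff.2 (by nlinarith)
  have e2 := mul_exp_le (s := s) hl
  have e3 : (1 - Real.exp (-l * s)) / l ≤ 1 / l := by gcongr; linarith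
  have e5 : 1 - Real.exp (-l * s) ≤ 1 := by linarith
  have e6 : 0 ≤ s * Real.exp (-l * s) := by positivity
  unfold trialValue
  gcongr
  · exact mul_le_of_le_one_left (by positivity) e5
  · exact mul_le_of_le_one_right ha e1
  · exact e2.trans e3
  · exact mul_le_of_le_one_right hg e1
  · linarith
  · exact mul_le_of_le_one_right hq e5

/-- Here y² + 2ya + g stands for E[(y + A)²] with E[A] = a and E[A²] = g. The terms s² exp (-l s)
from success and failure cancel, so only exp (-l s) and s exp (-l s) remain, whose means are L and
L'. -/
lemma lintegral_trial_quadratic (ha : 0 ≤ a) (hg : 0 ≤ g) (hb : 0 ≤ b) (hq : 0 ≤ q)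
    (hy : 0 ≤ y) (hs : 0 ≤ s) :
    ∫⁻ x, (if s ≤ x then ENNReal.ofReal ((y + s) ^ 2 + 2 * (y + s) * a + g)
      else ENNReal.ofReal ((y + x) ^ 2 + 2 * (y + x) * b + q)) ∂(expMeasure l) =
      ENNReal.ofReal (trialValue l a g b q y s) := by
  have hl := hl.out
  have h := lintegral_exp_service l (α := y ^ 2 + 2 * y * b + q) (β := 2 * y + 2 * b) (γ := 1)
    (v := (y + s) ^ 2 + 2 * (y + s) * a + g) (s := s) (by positivity) (by positivity)
    (by positivity) (by positivity) hs
  convert h using 2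
  · refine funext fun x => ?_
    congr 2
    ring
  · rw [trialValue, neg_mul]
    field_simp
    ring

/-- The conditions `hb'` and `hq'` are the fixed point equations for the first two moments:
averaging a trial over the service time must return the quadratic that a failed trial restarts with.
-/
lemma lintegral_start_quadratic (ν : Measure ℝ) [IsProbabilityMeasure ν]
    (hν : ∀ᵐ s ∂ν, 0 ≤ s) (ha : 0 ≤ a) (hg : 0 ≤ g) (hb : 0 ≤ b) (hq : 0 ≤ q)
    (hy : 0 ≤ y) (hb' : b * L ν l = (1 - L ν l) / l + a * L ν l)
    (hq' : q * L ν l = 2 * a * L' ν l + g * L ν l + (2 / l + 2 * b) * ((1 - L ν l) / l - L' ν l)) :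
    ∫⁻ s, ∫⁻ x, (if s ≤ x then ENNReal.ofReal ((y + s) ^ 2 + 2 * (y + s) * a + g)
      else ENNReal.ofReal ((y + x) ^ 2 + 2 * (y + x) * b + q)) ∂(expMeasure l) ∂ν =
      ENNReal.ofReal (y ^ 2 + 2 * y * b + q) := by
  have hl' := hl.out
  -- The trial value sorted by 1, exp (-l s) and s exp (-l s), ready for integration over the
  -- service time.
  set c₀ : ℝ := y ^ 2 + 2 * y * (1 / l + b) + 2 / l ^ 2 + 2 * b / l + q
  set c₁ : ℝ := 2 * y * (a - 1 / l - b) + g - 2 / l ^ 2 - 2 * b / l - q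
  set c₂ : ℝ := 2 * a - 2 / l - 2 * b
  obtain ⟨h1, h2⟩ := integral_service_affine ν hν hl' c₀ c₁ c₂
  have h4 : ∀ s, trialValue l a g b q y s =
      c₀ + c₁ * Real.exp (-l * s) + c₂ * (s * Real.exp (-l * s)) := by
    intro s
    simp only [trialValue, c₀, c₁, c₂]
    field_simp
    ring
  have h3 : ∀ᵐ s ∂ν, ∫⁻ x, (if s ≤ x then ENNReal.ofReal ((y + s) ^ 2 + 2 * (y + s) * a + g)
      else ENNReal.ofReal ((y + x) ^ 2 + 2 * (y + x) * b + q)) ∂(expMeasure l) =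
      ENNReal.ofReal (c₀ + c₁ * Real.exp (-l * s) + c₂ * (s * Real.exp (-l * s))) := by
    filter_upwards [hν] with s hs
    rw [lintegral_trial_quadratic ha hg hb hq hy hs, h4]
  rw [lintegral_congr_ae h3, ← ofReal_integral_eq_lintegral_ofReal h1, h2]
  · congr 1
    have : c₀ + c₁ * L ν l + c₂ * L' ν l = y ^ 2 + 2 * y * ((1 - L ν l) / l + a * L ν l + b
      - b * L ν l) + (2 * a * L' ν l + g * L ν l + (2 / l + 2 * b) * ((1 - L ν l) / l - L' ν l)
        + q - q * L ν l) := by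
      simp only [c₀, c₁, c₂]
      field_simp
      ring
    rw [this, ← hb', ← hq']
    ring
  · filter_upwards [hν] with s hs
    rw [Pi.zero_apply, ← h4]
    exact trialValue_nonneg ha hg hb hq hy hs

end Quadratic

end

/-! ### The first delivery of source 1: almost sure occurrence and passage to the limit -/

section

/-- All interarrival and service times are nonnegative. -/
def Stream.Good (a : Stream) : Prop := 0 ≤ a.1 ∧ ∀ n, 0 ≤ (a.2 n).1 ∧ 0 ≤ (a.2 n).2

/-- All interarrival and service times are nonnegative. -/
def Input.Good (J : Input) : Prop := J.1.Good ∧ J.2.Good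

lemma Stream.Good.pop {a : Stream} (ha : a.Good) : a.pop.Good :=
  ⟨(ha.2 0).2, fun n => ha.2 (n + 1)⟩

lemma Stream.Good.delay {a : Stream} (ha : a.Good) {t : ℝ} (ht : t ≤ a.1) : (a.delay t).Good :=
  ⟨sub_nonneg.2 ht, ha.2⟩

namespace Input.Good

variable {J : Input} (hJ : J.Good)
include hJ

lemma wait_nonneg : 0 ≤ J.wait := le_min hJ.1.1 hJ.2.1

lemma serv_nonneg : 0 ≤ J.serv := by
  unfold Input.serv Stream.serv
  split_ifs
  · exact (hJ.1.2 0).1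
  · exact (hJ.2.2 0).1

lemma pop : J.pop.Good := by
  unfold Input.pop
  split_ifs with h
  · exact ⟨hJ.1.pop, hJ.2.delay h⟩
  · exact ⟨hJ.1.delay (not_le.1 h).le, hJ.2.pop⟩

end Input.Good

lemma ae_good_stream (l : ℝ) [Fact (0 < l)] (ν : Measure ℝ) [IsProbabilityMeasure ν]
    (hν : ∀ᵐ s ∂ν, 0 ≤ s) : ∀ᵐ a ∂(streamMeasure l ν), a.Good := by
  have hp : ∀ᵐ q ∂(ν.prod (expMeasure l)), 0 ≤ q.1 ∧ 0 ≤ q.2 := by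
    have h1 : ∀ᵐ q ∂(ν.prod (expMeasure l)), 0 ≤ q.1 :=
      Measure.quasiMeasurePreserving_fst.ae hν
    have h2 : ∀ᵐ q ∂(ν.prod (expMeasure l)), 0 < q.2 :=
      Measure.quasiMeasurePreserving_snd.ae (ae_pos_expMeasure l)
    filter_upwards [h1, h2] with q h1 h2 using ⟨h1, h2.le⟩
  have hb : ∀ᵐ b ∂(pairMeasure l ν), ∀ n, 0 ≤ (b n).1 ∧ 0 ≤ (b n).2 := by
    rw [ae_all_iff]
    intro n
    exact (measurePreserving_eval_infinitePi (fun _ : ℕ => ν.prod (expMeasure l)) n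
      ).quasiMeasurePreserving.ae hp
  have h1 : ∀ᵐ a ∂(streamMeasure l ν), 0 < a.1 :=
    Measure.quasiMeasurePreserving_fst.ae (ae_pos_expMeasure l)
  have h2 : ∀ᵐ a ∂(streamMeasure l ν), ∀ n, 0 ≤ (a.2 n).1 ∧ 0 ≤ (a.2 n).2 :=
    Measure.quasiMeasurePreserving_snd.ae hb
  filter_upwards [h1, h2] with a h1 h2 using ⟨h1.le, h2⟩

variable (lam : Fin 2 → ℝ) [hlam : ∀ c, Fact (0 < lam c)] (ν : Measure ℝ) [IsProbabilityMeasure ν]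

lemma ae_good (hν : ∀ᵐ s ∂ν, 0 ≤ s) : ∀ᵐ J ∂(inputMeasure lam ν), J.Good := by
  have h1 : ∀ᵐ J ∂(inputMeasure lam ν), J.1.Good :=
    Measure.quasiMeasurePreserving_fst.ae (ae_good_stream (lam 0) ν hν)
  have h2 : ∀ᵐ J ∂(inputMeasure lam ν), J.2.Good :=
    Measure.quasiMeasurePreserving_snd.ae (ae_good_stream (lam 1) ν hν)
  filter_upwards [h1, h2] with J h1 h2 using ⟨h1, h2⟩

namespace Conf

/-- A configuration with nonnegative residual service time, clock and future. -/
def Good (s : Conf) : Prop := 0 ≤ s.1.2.1 ∧ 0 ≤ s.2.1 ∧ s.2.2.Good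

lemma Good.next {s : Conf} (hs : s.Good) : s.next.Good := by
  refine ⟨?_, add_nonneg hs.2.1 hs.2.2.wait_nonneg, hs.2.2.pop⟩
  unfold Conf.next
  split_ifs with h
  · exact sub_nonneg.2 h.1.le
  · exact hs.2.2.serv_nonneg

lemma Good.iterate {s : Conf} (hs : s.Good) (n : ℕ) : (Conf.next^[n] s).Good := by
  induction n with
  | zero => exact hs
  | succ n ih => rw [Function.iterate_succ_apply']; exact ih.next

lemma Good.clock_le {s : Conf} (hs : s.Good) (n : ℕ) : s.2.1 ≤ (Conf.next^[n] s).2.1 := by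
  induction n with
  | zero => exact le_rfl
  | succ n ih =>
    rw [Function.iterate_succ_apply']
    exact ih.trans (le_add_of_nonneg_right (hs.iterate n).2.2.wait_nonneg)

/-- Source 1 eventually delivers a packet. -/
def Stops (s : Conf) : Prop := ∃ n, (next^[n] s).Done

/-- The number of arrivals before the first delivery of source 1. -/
def stopIndex (s : Conf) : ℕ := sInf {n | (next^[n] s).Done}

/-- The configuration in which source 1 delivers for the first time. -/
def final (s : Conf) : Conf := next^[stopIndex s] s

lemma Stops.done_final {s : Conf} (hs : s.Stops) : s.final.Done := Nat.sInf_mem hs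

lemma not_done_of_lt {s : Conf} {n : ℕ} (h : n < s.stopIndex) : ¬ (next^[n] s).Done :=
  Nat.notMem_of_lt_sInf h

lemma stopIndex_le {s : Conf} {n : ℕ} (h : (next^[n] s).Done) : s.stopIndex ≤ n := Nat.sInf_le h

lemma stopIndex_eq {s : Conf} {n : ℕ} (h : (next^[n] s).Done) (h' : ∀ k < n, ¬ (next^[k] s).Done) :
    s.stopIndex = n :=
  le_antisymm (stopIndex_le h) (not_lt.1 fun hlt => h' _ hlt (Nat.sInf_mem (s := {n | (next^[n] s).Done}) ⟨n, h⟩))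

lemma final_of_done {s : Conf} (h : s.Done) : s.final = s := by
  rw [final, stopIndex_eq (n := 0) h (by simp)]
  rfl

lemma final_of_not_done {s : Conf} (h : ¬ s.Done) (hs : s.next.Stops) : s.final = s.next.final := by
  have : s.stopIndex = s.next.stopIndex + 1 := by
    refine stopIndex_eq ?_ ?_
    · exact hs.done_final
    · intro k hk
      cases k with
      | zero => exact h
      | succ k => exact not_done_of_lt (s := s.next) (by omega)
  rw [final, this]
  rfl

-- Turns the recursion into a statement about `final`, so that limits in n can be taken pointwise.
open Classical in
lemma run_eq (G H : Conf → ℝ≥0∞) (n : ℕ) (s : Conf) :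
    run G H n s = if ∃ k < n, (next^[k] s).Done then H s.final else G (next^[n] s) := by
  induction n generalizing s with
  | zero => simp [run]
  | succ n ih =>
    by_cases h : s.Done
    · have : ∃ k < n + 1, (next^[k] s).Done := ⟨0, by omega, h⟩
      rw [if_pos this, run, if_pos h, final_of_done h]
    · rw [run, if_neg h, ih]
      have hiff : (∃ k < n, (next^[k] s.next).Done) ↔ ∃ k < n + 1, (next^[k] s).Done := by
        constructor
        · rintro ⟨k, hk, hd⟩
          exact ⟨k + 1, by omega, hd⟩
        · rintro ⟨k, hk, hd⟩
          cases k with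
          | zero => exact absurd hd h
          | succ k => exact ⟨k, by omega, hd⟩
      by_cases h2 : ∃ k < n, (next^[k] s.next).Done
      · rw [if_pos h2, if_pos (hiff.1 h2), final_of_not_done h (h2.imp fun _ => And.right)]
      · rw [if_neg h2, if_neg (fun h3 => h2 (hiff.2 h3))]
        rfl

lemma measurable_iterate (n : ℕ) : Measurable (next^[n]) := measurable_next.iterate n

lemma measurableSet_stops : MeasurableSet {s : Conf | s.Stops} := by
  have : {s : Conf | s.Stops} = ⋃ n, next^[n] ⁻¹' {s | s.Done} := by
    ext s; simp [Stops]
  rw [this]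
  exact MeasurableSet.iUnion fun n => measurable_iterate n measurableSet_done

lemma measurable_stopIndex : Measurable stopIndex := by
  refine measurable_to_countable' fun n => ?_
  have hdn : ∀ k, MeasurableSet (next^[k] ⁻¹' {s | s.Done}) := fun k =>
    measurable_iterate k measurableSet_done
  have hmin : ∀ n, MeasurableSet ((next^[n] ⁻¹' {s : Conf | s.Done}) ∩
      ⋂ k : Fin n, (next^[(k : ℕ)] ⁻¹' {s : Conf | s.Done})ᶜ) := fun n =>
    (hdn n).inter (MeasurableSet.iInter fun k => (hdn k).compl)
  cases n with
  | zero =>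
    -- Since `sInf ∅ = 0`, the fibre over 0 also contains the configurations that never deliver.
    have : stopIndex ⁻¹' {0} = (next^[0] ⁻¹' {s : Conf | s.Done}) ∪ {s | s.Stops}ᶜ := by
      ext s
      simp only [Set.mem_preimage, Set.mem_singleton_iff, Set.mem_union, Set.mem_compl_iff,
        Set.mem_ofPred_eq]
      constructor
      · intro h
        by_cases hs : s.Stops
        · left
          have := hs.done_final
          rwa [final, h] at this
        · exact Or.inr hs
      · rintro (h | h)
        · exact stopIndex_eq h (by simp)
        · have : {n | (next^[n] s).Done} = ∅ := by
            ext n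
            simp only [Set.mem_ofPred_eq, Set.mem_empty_iff_false, iff_false]
            exact fun hn => h ⟨n, hn⟩
          rw [stopIndex, this, Nat.sInf_empty]
    rw [this]
    exact (hdn 0).union measurableSet_stops.compl
  | succ n =>
    have : stopIndex ⁻¹' {n + 1} = ((next^[n + 1] ⁻¹' {s : Conf | s.Done}) ∩
      ⋂ k : Fin (n + 1), (next^[(k : ℕ)] ⁻¹' {s : Conf | s.Done})ᶜ) := by
      ext s
      simp only [Set.mem_preimage, Set.mem_singleton_iff, Set.mem_inter_iff, Set.mem_iInter,
        Set.mem_compl_iff, Set.mem_ofPred_eq]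
      constructor
      · intro h
        have hs : s.Stops := by
          by_contra hs
          have : {n | (next^[n] s).Done} = ∅ := by
            ext n
            simp only [Set.mem_ofPred_eq, Set.mem_empty_iff_false, iff_false]
            exact fun hn => hs ⟨n, hn⟩
          rw [stopIndex, this, Nat.sInf_empty] at h
          omega
        have h2 := hs.done_final
        rw [final, h] at h2
        exact ⟨h2, fun k => not_done_of_lt (by omega)⟩
      · rintro ⟨h1, h2⟩
        exact stopIndex_eq h1 fun k hk => h2 ⟨k, hk⟩
    rw [this]
    exact hmin (n + 1)

lemma measurable_final : Measurable final := by
  have h : Measurable fun q : ℕ × Conf => next^[q.1] q.2 :=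
    measurable_from_prod_countable_right fun n => measurable_iterate n
  exact h.comp (measurable_stopIndex.prodMk measurable_id)

variable {lam ν}

/-- Without a delivery, the clock grows exponentially fast. -/
lemma lintegral_next (F : Conf → ℝ≥0∞) (hF : Measurable F) (c : Fin 2) (r z y : ℝ) :
    ∫⁻ J, F (next ((c, r, z), y, J)) ∂(inputMeasure lam ν) = arrival lam ν fun c' t s =>
      avg lam ν F (if t < r ∧ c ≠ c' then (c, r - t, z) else (c', s, s)) (y + t) := by
  refine lintegral_input_arrival lam ν (K := fun c' t s J =>
    F (if t < r ∧ c ≠ c' then (c, r - t, z) else (c', s, s), y + t, J)) fun c' => ?_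
  refine hF.comp (Measurable.prodMk (Measurable.ite ?_ (by fun_prop) (by fun_prop)) (by fun_prop))
  exact (measurableSet_lt (f := fun q : ℝ × ℝ × Input => q.1) (g := fun _ => r) (by fun_prop)
    (by fun_prop)).inter (MeasurableSet.const _)

/-- Waiting times between arrivals are exponential of rate λ = `lam 0 + lam 1`, whatever the state,
so each arrival multiplies the mean of exp (-clock) by λ / (λ + 1); killing at a delivery only
decreases it. -/
lemma avg_run_exp_le (n : ℕ) : ∀ m y,
    avg lam ν (run (fun s => ENNReal.ofReal (Real.exp (-s.2.1))) 0 n) m y ≤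
      ENNReal.ofReal ((lam 0 + lam 1) / (lam 0 + lam 1 + 1)) ^ n * ENNReal.ofReal (Real.exp (-y)) := by
  have h0 := (hlam 0).out
  have h1 := (hlam 1).out
  set ρ := ENNReal.ofReal ((lam 0 + lam 1) / (lam 0 + lam 1 + 1)) with hρ
  set G : Conf → ℝ≥0∞ := fun s => ENNReal.ofReal (Real.exp (-s.2.1)) with hG
  have hGm : Measurable G := by fun_prop
  induction n with
  | zero => intro m y; simp [avg, run, hG]
  | succ n ih =>
    rintro ⟨c, r, z⟩ y
    have hR := measurable_run hGm (H := 0) measurable_zero n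
    calc avg lam ν (run G 0 (n + 1)) (c, r, z) y
        ≤ ∫⁻ J, run G 0 n (next ((c, r, z), y, J)) ∂(inputMeasure lam ν) := by
          refine lintegral_mono fun J => ?_
          simp only [run]
          split_ifs <;> simp
      _ = _ := lintegral_next _ hR c r z y
      _ ≤ arrival lam ν fun _ t _ => ENNReal.ofReal (Real.exp (-t)) *
            (ρ ^ n * ENNReal.ofReal (Real.exp (-y))) := by
          refine arrival_mono lam ν fun c' t ht => lintegral_mono fun s => (ih _ _).trans (le_of_eq ?_)
          rw [neg_add, Real.exp_add, ENNReal.ofReal_mul (Real.exp_pos _).le]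
          ring
      _ = (arrival lam ν fun _ t _ => ENNReal.ofReal (Real.exp (-t))) *
            (ρ ^ n * ENNReal.ofReal (Real.exp (-y))) := by
          refine arrival_mul_const lam ν _ ?_
          exact ENNReal.mul_ne_top (ENNReal.pow_ne_top ENNReal.ofReal_ne_top) ENNReal.ofReal_ne_top
      _ = _ := by
          have e : ∀ c : Fin 2, ∫⁻ t, ENNReal.ofReal (Real.exp (-(lam (1 - c) * t))) *
              ∫⁻ _, ENNReal.ofReal (Real.exp (-t)) ∂ν ∂(expMeasure (lam c)) =
              ENNReal.ofReal (lam c / (lam c + (lam (1 - c) + 1))) := by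
            intro c
            have h2 := (hlam (1 - c)).out
            have h := lintegral_exp_mul_quadratic (lam c) (κ := lam (1 - c) + 1) (α := 1) (β := 0)
              (γ := 0) (by positivity) zero_le_one le_rfl le_rfl
            simp only [zero_mul, add_zero, zero_div, mul_zero, mul_one, ENNReal.ofReal_one] at h
            rw [← h]
            refine lintegral_congr fun t => ?_
            rw [lintegral_const, measure_univ, mul_one, ← ENNReal.ofReal_mul (Real.exp_pos _).le,
              ← Real.exp_add]
            congr 2
            ring
          have hsum : (arrival lam ν fun _ t _ => ENNReal.ofReal (Real.exp (-t))) = ρ := by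
            rw [arrival, Fin.sum_univ_two, e 0, e 1, ← ENNReal.ofReal_add (by simp; positivity)
              (by simp; positivity), hρ]
            simp only [Fin.isValue, sub_zero, sub_self]
            congr 1
            field_simp
            ring
          rw [hsum, pow_succ]
          ring

/-- Let n tend to infinity for fixed K, then K to infinity. -/
lemma eq_zero_of_forall_le_pow {p w ρ a : ℝ≥0∞} (hρ : ρ < 1) (hw : w ≠ ∞) (ha : a ≠ ∞)
    (h : ∀ (n : ℕ) (K : ℝ), 0 < K →
      p ≤ ENNReal.ofReal (Real.exp K) * (ρ ^ n * a) + ENNReal.ofReal (1 / K ^ 2) * w) : p = 0 := by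
  have hK : ∀ K : ℝ, 0 < K → p ≤ ENNReal.ofReal (1 / K ^ 2) * w := by
    intro K hK
    refine ge_of_tendsto' (f := fun n : ℕ => ENNReal.ofReal (Real.exp K) *
      (ρ ^ n * a) + ENNReal.ofReal (1 / K ^ 2) * w) (x := atTop) ?_ fun n => h n K hK
    have t1 := ENNReal.tendsto_pow_atTop_nhds_zero_of_lt_one hρ
    have t2 := ENNReal.Tendsto.mul_const (b := a) t1 (Or.inr ha)
    have t3 := ENNReal.Tendsto.const_mul (a := ENNReal.ofReal (Real.exp K)) t2
      (Or.inr ENNReal.ofReal_ne_top)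
    have t4 := t3.add_const (ENNReal.ofReal (1 / K ^ 2) * w)
    rwa [zero_mul, mul_zero, zero_add] at t4
  refine nonpos_iff_eq_zero.1 ?_
  refine ge_of_tendsto (f := fun K : ℝ => ENNReal.ofReal (1 / K ^ 2) * w) (x := atTop) ?_
    (eventually_atTop.2 ⟨1, fun K h1 => hK K (by linarith)⟩)
  have t1 : Tendsto (fun K : ℝ => 1 / K ^ 2) atTop (𝓝 0) := by
    simp only [one_div]
    exact (tendsto_pow_atTop (two_ne_zero)).inv_tendsto_atTop
  have t2 := ENNReal.Tendsto.mul_const (b := w) (ENNReal.tendsto_ofReal t1) (Or.inr hw)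
  rwa [ENNReal.ofReal_zero, zero_mul] at t2

/-- If the system has a finite quadratic value, then source 1 eventually delivers. -/
lemma IsValue.ae_stops {e : ℝ → ℝ≥0∞} {k : Fin 2 → ℝ → ℝ≥0∞} {h : ℝ → ℝ → ℝ≥0∞}
    (hv : IsValue lam ν h e k) (hν : ∀ᵐ s ∂ν, 0 ≤ s)
    (hge : ∀ s : Conf, s.Good → ENNReal.ofReal (s.2.1 ^ 2) ≤ value lam ν h e k s)
    {c : Fin 2} {r z y : ℝ} (hr : 0 ≤ r) (hy : 0 ≤ y)
    (hfin : busyValue lam ν (completion h e) k (c, r, z) y ≠ ∞) :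
    ∀ᵐ J ∂(inputMeasure lam ν), Stops ((c, r, z), y, J) := by
  classical
  set μ := inputMeasure lam ν
  set w := busyValue lam ν (completion h e) k (c, r, z) y
  set ρ := ENNReal.ofReal ((lam 0 + lam 1) / (lam 0 + lam 1 + 1)) with hρ
  have h0 := (hlam 0).out
  have h1 := (hlam 1).out
  have hρ1 : ρ < 1 := by
    rw [hρ, ENNReal.ofReal_lt_one, div_lt_one (by positivity)]
    linarith
  rw [ae_iff]
  set p := μ {J | ¬ Stops ((c, r, z), y, J)}
  have hmain : ∀ (n : ℕ) (K : ℝ), 0 < K → p ≤ ENNReal.ofReal (Real.exp K) * (ρ ^ n * ENNReal.ofReal (Real.exp (-y))) +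
      ENNReal.ofReal (1 / K ^ 2) * w := by
    intro n K hK
    have hG : Measurable fun s : Conf => ENNReal.ofReal (Real.exp (-s.2.1)) := by fun_prop
    have hm1 : Measurable fun J : Input => run (fun s => ENNReal.ofReal (Real.exp (-s.2.1))) 0 n ((c, r, z), y, J) :=
      (measurable_run hG (H := 0) measurable_zero n).comp (by fun_prop)
    have hm2 : Measurable fun J : Input => run (value lam ν h e k) (reward h 1) n ((c, r, z), y, J) :=
      (measurable_run hv.measurable_value (measurable_reward hv.meas_h (f := 1) measurable_one) n).comp (by fun_prop)
    calc p = ∫⁻ J, {J | ¬ Stops ((c, r, z), y, J)}.indicator 1 J ∂μ := by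
          rw [lintegral_indicator_one]
          exact (measurableSet_stops.compl).preimage
            (by fun_prop : Measurable fun J : Input => (((c, r, z), y, J) : Conf))
      _ ≤ ∫⁻ J, (ENNReal.ofReal (Real.exp K) * run (fun s => ENNReal.ofReal (Real.exp (-s.2.1))) 0 n ((c, r, z), y, J) +
            ENNReal.ofReal (1 / K ^ 2) * run (value lam ν h e k) (reward h 1) n ((c, r, z), y, J)) ∂μ := by
          refine lintegral_mono_ae ?_
          filter_upwards [ae_good lam ν hν] with J hJ
          by_cases hns : Stops ((c, r, z), y, J)
          · simp [hns]
          have hn : ¬ ∃ k < n, (next^[k] ((c, r, z), y, J)).Done := fun ⟨k, _, hk⟩ => hns ⟨k, hk⟩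
          have hg : Good ((c, r, z), y, J) := ⟨hr, hy, hJ⟩
          have hgn := hg.iterate n
          rw [run_eq, run_eq, if_neg hn, if_neg hn, Set.indicator_of_mem (by exact hns)]
          set t := (next^[n] ((c, r, z), y, J)).2.1
          by_cases ht : t ≤ K
          · refine le_trans ?_ le_self_add
            rw [← ENNReal.ofReal_mul (Real.exp_pos _).le, ← Real.exp_add]
            simpa using ht
          · refine le_trans ?_ le_add_self
            refine le_trans ?_ (mul_le_mul_right (hge _ hgn) _)
            rw [← ENNReal.ofReal_mul (by positivity)]
            simp only [Pi.one_apply, ENNReal.one_le_ofReal]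
            rw [one_div_mul_eq_div, one_le_div (by positivity)]
            exact pow_le_pow_left₀ hK.le (not_le.1 ht).le 2
      _ = _ := by
          rw [lintegral_add_left (hm1.const_mul _), lintegral_const_mul _ hm1, lintegral_const_mul _ hm2]
      _ ≤ _ := by
          refine add_le_add (mul_le_mul_right (avg_run_exp_le n _ _) _) (le_of_eq ?_)
          exact congrArg _ (hv.avg_run hν n c r z y hr hy)
  exact eq_zero_of_forall_le_pow hρ1 hfin ENNReal.ofReal_ne_top hmain

open Classical in
lemma tendsto_run_zero (H : Conf → ℝ≥0∞) {s : Conf} (hs : s.Stops) :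
    ∀ᶠ n in atTop, run 0 H n s = H s.final := by
  obtain ⟨k, hk⟩ := hs
  filter_upwards [eventually_gt_atTop k] with n hn
  rw [run_eq, if_pos ⟨k, hn, hk⟩]

lemma run_mono (H : Conf → ℝ≥0∞) (s : Conf) : Monotone fun n => run 0 H n s := by
  classical
  refine monotone_nat_of_le_succ fun n => ?_
  simp only [run_eq, Pi.zero_apply]
  by_cases h : ∃ k < n, (next^[k] s).Done
  · have h' : ∃ k < n + 1, (next^[k] s).Done := h.imp fun k hk => ⟨by omega, hk.2⟩
    rw [if_pos h, if_pos h']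
  · rw [if_neg h]
    exact zero_le

/-- Monotone convergence: on almost every path the run is eventually constant. -/
lemma tendsto_avg_run {H : Conf → ℝ≥0∞} (hH : Measurable H) {m : Fin 2 × ℝ × ℝ} {y : ℝ}
    (hs : ∀ᵐ J ∂(inputMeasure lam ν), Stops (m, y, J)) :
    Tendsto (fun n => avg lam ν (run 0 H n) m y) atTop
      (𝓝 (∫⁻ J, H (final (m, y, J)) ∂(inputMeasure lam ν))) := by
  refine lintegral_tendsto_of_tendsto_of_monotone (fun n => ?_) ?_ ?_
  · exact ((measurable_run (G := 0) measurable_zero hH n).comp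
      (by fun_prop : Measurable fun J : Input => ((m, y, J) : Conf))).aemeasurable
  · exact Eventually.of_forall fun J => run_mono H _
  · filter_upwards [hs] with J hJ
    exact tendsto_const_nhds.congr' ((tendsto_run_zero H hJ).mono fun n hn => hn.symm)

/-- The future after the first delivery of source 1 is independent of the past. -/
lemma lintegral_reward_final (hν : ∀ᵐ s ∂ν, 0 ≤ s) {c : Fin 2} {r z y : ℝ} (hr : 0 ≤ r) (hy : 0 ≤ y)
    (hs : ∀ᵐ J ∂(inputMeasure lam ν), Stops ((c, r, z), y, J)) {h : ℝ → ℝ → ℝ≥0∞}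
    (hh : Measurable fun q : ℝ × ℝ => h q.1 q.2)
    {f : Input → ℝ≥0∞} (hf : Measurable f) (hfi : ∫⁻ J, f J ∂(inputMeasure lam ν) ≠ ∞) :
    ∫⁻ J, reward h f (final ((c, r, z), y, J)) ∂(inputMeasure lam ν) =
      (∫⁻ J, reward h 1 (final ((c, r, z), y, J)) ∂(inputMeasure lam ν)) *
        ∫⁻ J, f J ∂(inputMeasure lam ν) := by
  have h1 := tendsto_avg_run (measurable_reward hh hf) hs
  have h2 := tendsto_avg_run (measurable_reward hh (f := 1) measurable_one) hs
  have h3 := ENNReal.Tendsto.mul_const h2 (Or.inr hfi)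
  refine tendsto_nhds_unique h1 (h3.congr fun n => ?_)
  rw [avg_run_reward hν hh hf hfi n c r z y hr hy]

/-- The mean value of the first delivery of source 1. -/
lemma IsValue.lintegral_final {e : ℝ → ℝ≥0∞} {k : Fin 2 → ℝ → ℝ≥0∞} {h : ℝ → ℝ → ℝ≥0∞}
    (hv : IsValue lam ν h e k) (hν : ∀ᵐ s ∂ν, 0 ≤ s)
    {c : Fin 2} {r z y : ℝ} (hr : 0 ≤ r) (hy : 0 ≤ y)
    (hs : ∀ᵐ J ∂(inputMeasure lam ν), Stops ((c, r, z), y, J))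
    (h0 : Tendsto (fun n => avg lam ν (run (value lam ν h e k) 0 n) (c, r, z) y) atTop (𝓝 0)) :
    ∫⁻ J, reward h 1 (final ((c, r, z), y, J)) ∂(inputMeasure lam ν) =
      busyValue lam ν (completion h e) k (c, r, z) y := by
  have hH := measurable_reward hv.meas_h (f := 1) measurable_one
  have h1 := (tendsto_avg_run hH hs).add h0
  rw [add_zero] at h1
  refine tendsto_nhds_unique h1 (tendsto_const_nhds.congr fun n => ?_)
  rw [← hv.avg_run hν n c r z y hr hy, avg, avg, avg, ← lintegral_add_left]
  · refine lintegral_congr fun J => ?_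
    rw [run_add]
  · exact (measurable_run (G := 0) measurable_zero hH n).comp
      (by fun_prop : Measurable fun J : Input => (((c, r, z), y, J) : Conf))

/-- The boundary term is eventually zero on each path that stops. The majorant is only required up
to the first delivery, since later the run contributes 0. -/
lemma tendsto_avg_run_of_dominated {G : Conf → ℝ≥0∞} (hG : Measurable G) {m : Fin 2 × ℝ × ℝ} {y : ℝ}
    (hs : ∀ᵐ J ∂(inputMeasure lam ν), Stops (m, y, J)) (B : Input → ℝ≥0∞)
    (hB : ∫⁻ J, B J ∂(inputMeasure lam ν) ≠ ∞)
    (hGB : ∀ᵐ J ∂(inputMeasure lam ν), ∀ n, n ≤ stopIndex (m, y, J) → G (next^[n] (m, y, J)) ≤ B J) :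
    Tendsto (fun n => avg lam ν (run G 0 n) m y) atTop (𝓝 0) := by
  classical
  have h : Tendsto (fun n => avg lam ν (run G 0 n) m y) atTop
      (𝓝 (∫⁻ _, 0 ∂(inputMeasure lam ν))) := by
    refine tendsto_lintegral_of_dominated_convergence B (fun n => ?_) (fun n => ?_) hB ?_
    · exact (measurable_run hG (H := 0) measurable_zero n).comp
        (by fun_prop : Measurable fun J : Input => ((m, y, J) : Conf))
    · filter_upwards [hGB, hs] with J hJ hst
      rw [run_eq]
      split_ifs with hd
      · exact zero_le
      · exact hJ n (not_lt.1 fun hlt => hd ⟨_, hlt, hst.done_final⟩)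
    · filter_upwards [hs] with J hJ
      obtain ⟨k, hk⟩ := hJ
      refine tendsto_const_nhds.congr' ?_
      filter_upwards [eventually_gt_atTop k] with n hn
      rw [run_eq, if_pos ⟨k, hn, hk⟩]
      rfl
  simpa using h

end Conf

end

/-! ### Moments of the time of the first delivery -/

section

namespace Conf

/-- Advance the clock. -/
def shift (d : ℝ) (s : Conf) : Conf := (s.1, d + s.2.1, s.2.2)

lemma next_shift (d : ℝ) (s : Conf) : (s.shift d).next = s.next.shift d := by
  refine Prod.ext rfl (Prod.ext ?_ rfl)
  exact add_assoc _ _ _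

lemma iterate_shift (d : ℝ) (n : ℕ) (s : Conf) : next^[n] (s.shift d) = (next^[n] s).shift d := by
  induction n generalizing s with
  | zero => rfl
  | succ n ih => rw [Function.iterate_succ_apply, next_shift, ih, Function.iterate_succ_apply]

lemma done_shift (d : ℝ) (s : Conf) : (s.shift d).Done ↔ s.Done := Iff.rfl

lemma stopIndex_shift (d : ℝ) (s : Conf) : (s.shift d).stopIndex = s.stopIndex := by
  simp only [stopIndex, iterate_shift, done_shift]

lemma final_shift (d : ℝ) (s : Conf) : (s.shift d).final = s.final.shift d := by
  rw [final, stopIndex_shift, iterate_shift, final]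

/-- The time of the first delivery of source 1. -/
def deliveryTime (s : Conf) : ℝ := s.final.2.1 + s.final.1.2.1

/-- The service time of the packet of source 1 that is delivered first. -/
def service (s : Conf) : ℝ := s.final.1.2.2

/-- The future after the first delivery of source 1. -/
def rest (s : Conf) : Input := s.final.2.2.delay s.final.1.2.1

lemma deliveryTime_shift (d : ℝ) (s : Conf) : (s.shift d).deliveryTime = d + s.deliveryTime := by
  rw [deliveryTime, final_shift, deliveryTime]
  exact add_assoc _ _ _

lemma reward_final (h : ℝ → ℝ → ℝ≥0∞) (f : Input → ℝ≥0∞) (s : Conf) :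
    reward h f s.final = h s.deliveryTime s.service * f s.rest := rfl

lemma measurable_deliveryTime : Measurable deliveryTime :=
  measurable_final.snd.fst.add measurable_final.fst.snd.fst

lemma measurable_service : Measurable service := measurable_final.fst.snd.snd

lemma measurable_rest : Measurable rest :=
  Input.measurable_delay.comp (measurable_final.fst.snd.fst.prodMk measurable_final.snd.snd)

lemma Good.final {s : Conf} (hs : s.Good) : s.final.Good := hs.iterate _

lemma Good.clock_le_deliveryTime {s : Conf} (hs : s.Good) {n : ℕ} (hn : n ≤ s.stopIndex) :
    (Conf.next^[n] s).2.1 ≤ s.deliveryTime := by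
  have h := (hs.iterate n).clock_le (s.stopIndex - n)
  rw [← Function.iterate_add_apply, Nat.sub_add_cancel hn] at h
  exact h.trans (le_add_of_nonneg_right hs.final.1)

end Conf

variable (lam : Fin 2 → ℝ) [hlam : ∀ c, Fact (0 < lam c)] (ν : Measure ℝ) [IsProbabilityMeasure ν]

lemma measurePreserving_stream_fst (c : Fin 2) :
    MeasurePreserving (fun J : Input => (Input.stream c J).1) (inputMeasure lam ν)
      (expMeasure (lam c)) := by
  rcases (by omega : c = 0 ∨ c = 1) with rfl | rfl
  · exact (measurePreserving_fst (μ := expMeasure (lam 0)) (ν := pairMeasure (lam 0) ν)).comp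
      (measurePreserving_fst (μ := streamMeasure (lam 0) ν) (ν := streamMeasure (lam 1) ν))
  · exact (measurePreserving_fst (μ := expMeasure (lam 1)) (ν := pairMeasure (lam 1) ν)).comp
      (measurePreserving_snd (μ := streamMeasure (lam 0) ν) (ν := streamMeasure (lam 1) ν))

variable {lam ν}

namespace Conf

/-- The race depends on the future only through one exponential time, which reduces it to a
one-dimensional integral. -/
lemma busyValue_eq_lintegral_exp {a : Fin 2 → ℝ → ℝ → ℝ≥0∞} {k : Fin 2 → ℝ → ℝ≥0∞}
    (hk : ∀ c, Measurable (k c)) (c : Fin 2) (r z y : ℝ) :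
    busyValue lam ν a k (c, r, z) y =
      ∫⁻ x, (if r ≤ x then a c (y + r) z else k c (y + x)) ∂(expMeasure (lam c)) := by
  have hm : Measurable fun x : ℝ => if r ≤ x then a c (y + r) z else k c (y + x) :=
    Measurable.ite measurableSet_Ici measurable_const ((hk c).comp (by fun_prop))
  rw [← (measurePreserving_stream_fst lam ν c).lintegral_comp hm]
  rfl

/-- Dropping the nonnegative boundary term costs an inequality but needs no domination. It provides
the integrability with which domination, and hence equality, is proved later. -/
lemma IsValue.lintegral_final_le {e : ℝ → ℝ≥0∞} {k : Fin 2 → ℝ → ℝ≥0∞} {h : ℝ → ℝ → ℝ≥0∞}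
    (hv : IsValue lam ν h e k) (hν : ∀ᵐ s ∂ν, 0 ≤ s)
    {c : Fin 2} {r z y : ℝ} (hr : 0 ≤ r) (hy : 0 ≤ y)
    (hs : ∀ᵐ J ∂(inputMeasure lam ν), Stops ((c, r, z), y, J)) :
    ∫⁻ J, reward h 1 (final ((c, r, z), y, J)) ∂(inputMeasure lam ν) ≤
      busyValue lam ν (completion h e) k (c, r, z) y := by
  refine le_of_tendsto' (tendsto_avg_run (measurable_reward hv.meas_h (f := 1) measurable_one) hs)
    fun n => ?_
  rw [← hv.avg_run hν n c r z y hr hy]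
  refine lintegral_mono fun J => ?_
  rw [run_add (value lam ν h e k)]
  exact le_self_add

end Conf

/-- The first two moments of the time until the next delivery of source 1: `b c`, `q c` if a packet
of source `c` has just arrived, `M`, `Q` if the system is empty, and `a c`, `g c` after the
completion of a service of source `c`. -/
structure IsMoments (lam : Fin 2 → ℝ) (ν : Measure ℝ) (M Q : ℝ) (a g b q : Fin 2 → ℝ) : Prop where
  a_zero : a 0 = 0
  a_one : a 1 = M
  g_zero : g 0 = 0
  g_one : g 1 = Q
  a_nonneg : ∀ c, 0 ≤ a c
  g_nonneg : ∀ c, 0 ≤ g c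
  b_nonneg : ∀ c, 0 ≤ b c
  q_nonneg : ∀ c, 0 ≤ q c
  b_eq : ∀ c, b c * L ν (lam c) = (1 - L ν (lam c)) / lam c + a c * L ν (lam c)
  q_eq : ∀ c, q c * L ν (lam c) = 2 * a c * L' ν (lam c) + g c * L ν (lam c) +
    (2 / lam c + 2 * b c) * ((1 - L ν (lam c)) / lam c - L' ν (lam c))
  M_eq : M * (lam 0 + lam 1) = 1 + lam 0 * b 0 + lam 1 * b 1
  Q_eq : Q * (lam 0 + lam 1) = 2 / (lam 0 + lam 1) + 2 / (lam 0 + lam 1) *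
    (lam 0 * b 0 + lam 1 * b 1) + lam 0 * q 0 + lam 1 * q 1

namespace IsMoments

variable {M Q : ℝ} {a g b q : Fin 2 → ℝ} (hm : IsMoments lam ν M Q a g b q)
include hm

lemma M_nonneg : 0 ≤ M := hm.a_one ▸ hm.a_nonneg 1

lemma Q_nonneg : 0 ≤ Q := hm.g_one ▸ hm.g_nonneg 1

lemma completion_eq (c : Fin 2) (y z : ℝ) :
    Conf.completion (fun y _ => ENNReal.ofReal (y ^ 2))
      (fun y => ENNReal.ofReal (y ^ 2 + 2 * y * M + Q)) c y z =
      ENNReal.ofReal (y ^ 2 + 2 * y * a c + g c) := by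
  rcases (by omega : c = 0 ∨ c = 1) with rfl | rfl
  · simp [Conf.completion, hm.a_zero, hm.g_zero]
  · simp [Conf.completion, hm.a_one, hm.g_one]

lemma busyValue_eq (c : Fin 2) {r y : ℝ} (z : ℝ) (hr : 0 ≤ r) (hy : 0 ≤ y) :
    Conf.busyValue lam ν (Conf.completion (fun y _ => ENNReal.ofReal (y ^ 2))
      (fun y => ENNReal.ofReal (y ^ 2 + 2 * y * M + Q)))
      (fun c y => ENNReal.ofReal (y ^ 2 + 2 * y * b c + q c)) (c, r, z) y =
      ENNReal.ofReal (trialValue (lam c) (a c) (g c) (b c) (q c) y r) := by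
  rw [Conf.busyValue_eq_lintegral_exp (by intro c; fun_prop),
    ← lintegral_trial_quadratic (hm.a_nonneg c) (hm.g_nonneg c) (hm.b_nonneg c) (hm.q_nonneg c) hy hr,
    hm.completion_eq]

/-- With first moment b c and second moment q c of the remaining time, the mean square of the
delivery time from clock y is y² + 2 y b c + q c. The equations in `IsMoments` are exactly the
consistency of these quadratics. -/
lemma isValue (hν : ∀ᵐ s ∂ν, 0 ≤ s) : Conf.IsValue lam ν (fun y _ => ENNReal.ofReal (y ^ 2))
    (fun y => ENNReal.ofReal (y ^ 2 + 2 * y * M + Q))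
    (fun c y => ENNReal.ofReal (y ^ 2 + 2 * y * b c + q c)) where
  meas_h := by fun_prop
  meas_e := by fun_prop
  meas_k := by intro c; fun_prop
  start c y hy := by
    rw [← lintegral_start_quadratic (l := lam c) ν hν (hm.a_nonneg c) (hm.g_nonneg c) (hm.b_nonneg c)
      (hm.q_nonneg c) hy (hm.b_eq c) (hm.q_eq c)]
    refine lintegral_congr fun s => ?_
    rw [Conf.busyValue_eq_lintegral_exp (by intro c; fun_prop), hm.completion_eq]
  empty y hy := by
    have h0 := (hlam 0).out
    have h1 := (hlam 1).out
    have hb := hm.b_nonneg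
    have hq := hm.q_nonneg
    have e : ∀ c : Fin 2, ∫⁻ t, ENNReal.ofReal (Real.exp (-(lam (1 - c) * t))) *
        ENNReal.ofReal ((y + t) ^ 2 + 2 * (y + t) * b c + q c) ∂(expMeasure (lam c)) =
        ENNReal.ofReal (lam c / (lam c + lam (1 - c)) * ((y ^ 2 + 2 * y * b c + q c) +
          (2 * y + 2 * b c) / (lam c + lam (1 - c)) + 2 * 1 / (lam c + lam (1 - c)) ^ 2)) := by
      intro c
      have := hb c
      have := hq c
      rw [← lintegral_exp_mul_quadratic (lam c) (hlam (1 - c)).out.le (by positivity) (by positivity)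
        zero_le_one]
      refine lintegral_congr fun t => ?_
      congr 2
      ring
    have := hb 0
    have := hq 0
    have := hb 1
    have := hq 1
    rw [Fin.sum_univ_two, e 0, e 1, ← ENNReal.ofReal_add (by simp; positivity) (by simp; positivity)]
    congr 1
    simp only [Fin.isValue, sub_zero, sub_self]
    have hs : lam 0 + lam 1 ≠ 0 := by positivity
    have hM : M = (1 + lam 0 * b 0 + lam 1 * b 1) / (lam 0 + lam 1) := by
      rw [← hm.M_eq]; field_simp
    have hQ : Q = (2 / (lam 0 + lam 1) + 2 / (lam 0 + lam 1) *
        (lam 0 * b 0 + lam 1 * b 1) + lam 0 * q 0 + lam 1 * q 1) / (lam 0 + lam 1) := by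
      rw [← hm.Q_eq]; field_simp
    rw [hM, hQ, add_comm (lam 1) (lam 0)]
    field_simp
    ring

lemma ae_stops (hν : ∀ᵐ s ∂ν, 0 ≤ s) (c : Fin 2) {r y : ℝ} (z : ℝ) (hr : 0 ≤ r) (hy : 0 ≤ y) :
    ∀ᵐ J ∂(inputMeasure lam ν), Conf.Stops ((c, r, z), y, J) := by
  refine (hm.isValue hν).ae_stops hν ?_ hr hy ?_
  · rintro ⟨⟨c, r, z⟩, y, J⟩ ⟨hr, hy, hJ⟩
    simp only at hr hy
    have := hm.a_nonneg c
    have := hm.b_nonneg c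
    have := hm.g_nonneg c
    have := hm.q_nonneg c
    rw [Conf.value, Conf.busyValue_eq_lintegral_exp (by intro c; fun_prop)]
    calc ENNReal.ofReal (y ^ 2) = ∫⁻ _, ENNReal.ofReal (y ^ 2) ∂(expMeasure (lam c)) := by simp
      _ ≤ _ := by
        refine lintegral_mono_ae ?_
        filter_upwards [ae_pos_expMeasure (lam c)] with x hx
        split_ifs
        · rw [hm.completion_eq]
          refine ENNReal.ofReal_le_ofReal ?_
          have h1 : y ^ 2 ≤ (y + r) ^ 2 := pow_le_pow_left₀ hy (by linarith) 2
          have h2 : 0 ≤ 2 * (y + r) * a c + g c := by positivity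
          linarith
        · refine ENNReal.ofReal_le_ofReal ?_
          have h1 : y ^ 2 ≤ (y + x) ^ 2 := pow_le_pow_left₀ hy (by linarith) 2
          have h2 : 0 ≤ 2 * (y + x) * b c + q c := by positivity
          linarith
  · rw [hm.busyValue_eq c z hr hy]
    exact ENNReal.ofReal_ne_top

/-- Optional stopping for the quadratic value, started from the empty system at clock y. Keeping y
general makes this one identity contain both moments. -/
lemma lintegral_sq_deliveryTime (hν : ∀ᵐ s ∂ν, 0 ≤ s) {y : ℝ} (hy : 0 ≤ y) :
    ∫⁻ J, ENNReal.ofReal ((Conf.deliveryTime ((1, 0, 0), y, J)) ^ 2) ∂(inputMeasure lam ν) =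
      ENNReal.ofReal (y ^ 2 + 2 * y * M + Q) := by
  have hv := hm.isValue hν
  have hs := hm.ae_stops hν 1 0 le_rfl hy
  have hD : Measurable fun J : Input => Conf.deliveryTime ((1, 0, 0), y, J) :=
    Conf.measurable_deliveryTime.comp
      (by fun_prop : Measurable fun J : Input => (((1, 0, 0), y, J) : Conf))
  have hbv : Conf.busyValue lam ν (Conf.completion (fun y _ => ENNReal.ofReal (y ^ 2))
      (fun y => ENNReal.ofReal (y ^ 2 + 2 * y * M + Q)))
      (fun c y => ENNReal.ofReal (y ^ 2 + 2 * y * b c + q c)) (1, 0, 0) y =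
      ENNReal.ofReal (y ^ 2 + 2 * y * M + Q) := by
    rw [hm.busyValue_eq 1 0 le_rfl hy, trialValue, hm.a_one, hm.g_one]
    simp
  have hred : ∀ J, Conf.reward (fun y _ => ENNReal.ofReal (y ^ 2)) 1
      (Conf.final ((1, 0, 0), y, J)) =
      ENNReal.ofReal ((Conf.deliveryTime ((1, 0, 0), y, J)) ^ 2) := by
    intro J
    rw [Conf.reward_final]
    simp
  -- The squared delivery time is integrable; this makes it admissible as majorant below.
  have hle := hv.lintegral_final_le hν (c := 1) (z := 0) le_rfl hy hs
  simp_rw [hred] at hle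
  rw [← hbv]
  simp_rw [← hred]
  refine hv.lintegral_final hν le_rfl hy hs ?_
  -- The value grows at most like (1 + clock)², uniformly in the residual service, and up to the
  -- delivery the clock is at most the delivery time.
  obtain ⟨C, hC⟩ : ∃ C : Fin 2 → ℝ, ∀ c, ∀ r y : ℝ, 0 ≤ r → 0 ≤ y →
      trialValue (lam c) (a c) (g c) (b c) (q c) y r ≤ C c * (1 + y) ^ 2 ∧ 0 ≤ C c := by
    refine ⟨fun c => 1 + (1 / lam c + b c + a c) + (2 * a c * (1 / lam c) + g c +
      (2 / lam c + 2 * b c) * (1 / lam c) + q c), fun c r y hr hy => ?_⟩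
    have h0 := (hlam c).out
    have := hm.a_nonneg c
    have := hm.b_nonneg c
    have := hm.g_nonneg c
    have := hm.q_nonneg c
    refine ⟨(trialValue_le (hm.a_nonneg c) (hm.g_nonneg c) (hm.b_nonneg c) (hm.q_nonneg c) hy hr).trans ?_,
      by positivity⟩
    have e1 : 0 ≤ 1 / lam c + b c + a c := by positivity
    have e2 : 0 ≤ 2 * a c * (1 / lam c) + g c + (2 / lam c + 2 * b c) * (1 / lam c) + q c := by
      positivity
    nlinarith [mul_nonneg e1 hy, mul_nonneg e2 hy, mul_nonneg e1 (sq_nonneg y),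
      mul_nonneg e2 (sq_nonneg y)]
  have hCn : ∀ c, 0 ≤ C c := fun c => (hC c 0 0 le_rfl le_rfl).2
  refine Conf.tendsto_avg_run_of_dominated hv.measurable_value hs
    (fun J => ENNReal.ofReal (2 * (C 0 + C 1)) *
      (1 + ENNReal.ofReal ((Conf.deliveryTime ((1, 0, 0), y, J)) ^ 2))) ?_ ?_
  · rw [lintegral_const_mul _ (by fun_prop), lintegral_add_left measurable_const]
    refine ENNReal.mul_ne_top ENNReal.ofReal_ne_top (ENNReal.add_ne_top.2 ⟨by simp, ?_⟩)
    refine ne_top_of_le_ne_top ?_ hle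
    rw [hbv]
    exact ENNReal.ofReal_ne_top
  · filter_upwards [ae_good lam ν hν] with J hJ n hn
    have hg : Conf.Good ((1, 0, 0), y, J) := ⟨le_rfl, hy, hJ⟩
    have hgn := hg.iterate n
    have hcl := hg.clock_le_deliveryTime hn
    set s := Conf.next^[n] ((1, 0, 0), y, J)
    set D := Conf.deliveryTime ((1, 0, 0), y, J)
    have hval := hm.busyValue_eq s.1.1 s.1.2.2 hgn.1 hgn.2.1
    rw [Conf.value]
    refine (le_of_eq hval).trans ?_
    rw [← ENNReal.ofReal_one, ← ENNReal.ofReal_add zero_le_one (sq_nonneg _),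
      ← ENNReal.ofReal_mul (by linarith [hCn 0, hCn 1])]
    refine ENNReal.ofReal_le_ofReal ((hC _ _ _ hgn.1 hgn.2.1).1.trans ?_)
    have hc : C s.1.1 ≤ C 0 + C 1 := by
      rcases (by omega : s.1.1 = 0 ∨ s.1.1 = 1) with h | h <;> rw [h] <;> linarith [hCn 0, hCn 1]
    have h1 : (1 + s.2.1) ^ 2 ≤ (1 + D) ^ 2 := pow_le_pow_left₀ (by linarith [hgn.2.1]) (by linarith) 2
    have h2 : (1 + D) ^ 2 ≤ 2 * (1 + D ^ 2) := by nlinarith [sq_nonneg (1 - D)]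
    calc C s.1.1 * (1 + s.2.1) ^ 2 ≤ (C 0 + C 1) * (2 * (1 + D ^ 2)) :=
          mul_le_mul hc (h1.trans h2) (sq_nonneg _) (by linarith [hCn 0, hCn 1])
      _ = _ := by ring

end IsMoments

end

/-! ### Closed forms: cycle moments and the law of the delivered service times -/

section

variable {lam : Fin 2 → ℝ} [hlam : ∀ c, Fact (0 < lam c)] {ν : Measure ℝ} [IsProbabilityMeasure ν]

/-- The mean time from the empty system to the next delivery of source 1. -/
def cycleMean (lam : Fin 2 → ℝ) (ν : Measure ℝ) : ℝ :=
  (L ν (lam 0) + L ν (lam 1) - L ν (lam 0) * L ν (lam 1)) / (lam 0 * L ν (lam 0) * L ν (lam 1))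

/-- The mean service time of the delivered packets of source 1. -/
def serviceMean (lam : Fin 2 → ℝ) (ν : Measure ℝ) : ℝ := L' ν (lam 0) / L ν (lam 0)

lemma cycleMean_pos (hν : ∀ᵐ s ∂ν, 0 ≤ s) : 0 < cycleMean lam ν := by
  have h0 := (hlam 0).out
  have hL0 := L_pos ν hν h0
  have hL1 := L_pos ν hν (hlam 1).out
  have hL0' := L_le_one ν hν h0
  unfold cycleMean
  refine div_pos ?_ (by positivity)
  nlinarith

/-- The second moment of the time from the empty system to the next delivery of source 1. -/
def cycleSecondMoment (lam : Fin 2 → ℝ) (ν : Measure ℝ) : ℝ :=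
  2 * cycleMean lam ν * (ageValue (lam 0) (lam 1) (L ν (lam 0)) (L ν (lam 1)) (L' ν (lam 0))
    (L' ν (lam 1)) - serviceMean lam ν)

/-- The system is triangular up to one loop: the `b` and `q` of source 2 contain the moments of the
empty system, which reappear on the right of `M_eq` and `Q_eq` with factor `lam 1`. These terms
cancel and leave M and Q multiplied by `lam 0`. -/
lemma exists_isMoments (hν : ∀ᵐ s ∂ν, 0 ≤ s) :
    ∃ a g b q, IsMoments lam ν (cycleMean lam ν) (cycleSecondMoment lam ν) a g b q := by
  have h0 := (hlam 0).out
  have h1 := (hlam 1).out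
  have hL0 := L_pos ν hν h0
  have hL1 := L_pos ν hν h1
  have hL0' := sub_nonneg.2 (L_le_one ν hν h0)
  have hL1' := sub_nonneg.2 (L_le_one ν hν h1)
  have hD0 : 0 ≤ L' ν (lam 0) := L'_nonneg ν hν
  have hD1 : 0 ≤ L' ν (lam 1) := L'_nonneg ν hν
  have hD0' := sub_nonneg.2 (L'_le ν hν h0)
  have hD1' := sub_nonneg.2 (L'_le ν hν h1)
  have hM : 0 < cycleMean lam ν := cycleMean_pos hν
  -- `cycleSecondMoment` is defined backwards from `ageValue`; here it is shown to be the solution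
  -- of the moment equations. This is where the explicit age formula is verified, and the right side
  -- also shows that it is nonnegative.
  have hQ : cycleSecondMoment lam ν = (2 / (lam 0 + lam 1) + 2 / (lam 0 + lam 1) *
      (lam 0 * ((1 - L ν (lam 0)) / (lam 0 * L ν (lam 0))) + lam 1 *
        ((1 - L ν (lam 1)) / (lam 1 * L ν (lam 1)) + cycleMean lam ν)) +
      lam 0 * ((2 / lam 0 + 2 * ((1 - L ν (lam 0)) / (lam 0 * L ν (lam 0)))) *
        ((1 - L ν (lam 0)) / lam 0 - L' ν (lam 0)) / L ν (lam 0)) +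
      lam 1 * ((2 * cycleMean lam ν * L' ν (lam 1) + (2 / lam 1 +
        2 * ((1 - L ν (lam 1)) / (lam 1 * L ν (lam 1)) + cycleMean lam ν)) *
        ((1 - L ν (lam 1)) / lam 1 - L' ν (lam 1))) / L ν (lam 1))) / lam 0 := by
    have hne : L ν (lam 0) + L ν (lam 1) - L ν (lam 0) * L ν (lam 1) ≠ 0 := by
      have : 0 < L ν (lam 0) + L ν (lam 1) - L ν (lam 0) * L ν (lam 1) := by nlinarith
      exact this.ne'
    rw [cycleSecondMoment, cycleMean, ageValue, serviceMean]
    generalize L ν (lam 0) = x at *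
    generalize L ν (lam 1) = y at *
    generalize L' ν (lam 0) = D at *
    generalize L' ν (lam 1) = E at *
    generalize lam 0 = l at *
    generalize lam 1 = m at *
    field_simp
    ring
  set M := cycleMean lam ν with hMdef
  set Q := cycleSecondMoment lam ν
  have hQ0 : 0 ≤ Q := by
    rw [hQ]
    positivity
  refine ⟨![0, M], ![0, Q], ![(1 - L ν (lam 0)) / (lam 0 * L ν (lam 0)),
    (1 - L ν (lam 1)) / (lam 1 * L ν (lam 1)) + M],
    ![(2 / lam 0 + 2 * ((1 - L ν (lam 0)) / (lam 0 * L ν (lam 0)))) *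
        ((1 - L ν (lam 0)) / lam 0 - L' ν (lam 0)) / L ν (lam 0),
      (2 * M * L' ν (lam 1) + (2 / lam 1 +
        2 * ((1 - L ν (lam 1)) / (lam 1 * L ν (lam 1)) + M)) *
        ((1 - L ν (lam 1)) / lam 1 - L' ν (lam 1))) / L ν (lam 1) + Q], ?_⟩
  constructor
  · rfl
  · rfl
  · rfl
  · rfl
  · rw [Fin.forall_fin_two]; exact ⟨le_rfl, hM.le⟩
  · rw [Fin.forall_fin_two]; exact ⟨le_rfl, hQ0⟩
  · rw [Fin.forall_fin_two]
    simp only [Matrix.cons_val_zero, Matrix.cons_val_one]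
    constructor <;> positivity
  · rw [Fin.forall_fin_two]
    simp only [Matrix.cons_val_zero, Matrix.cons_val_one]
    constructor <;> positivity
  · rw [Fin.forall_fin_two]
    simp only [Matrix.cons_val_zero, Matrix.cons_val_one]
    constructor <;> field_simp
    ring
  · rw [Fin.forall_fin_two]
    simp only [Matrix.cons_val_zero, Matrix.cons_val_one]
    constructor <;> field_simp <;> ring
  · simp only [Matrix.cons_val_zero, Matrix.cons_val_one]
    rw [hMdef, cycleMean]
    field_simp
    ring
  · simp only [Matrix.cons_val_zero, Matrix.cons_val_one]
    have e := (eq_div_iff h0.ne').1 hQ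
    linarith

namespace Conf

/-- The empty system at time `0`. -/
def idle (J : Input) : Conf := ((1, 0, 0), 0, J)

lemma measurable_idle : Measurable idle := by unfold idle; fun_prop

lemma ae_stops (hν : ∀ᵐ s ∂ν, 0 ≤ s) (c : Fin 2) {r y : ℝ} (z : ℝ) (hr : 0 ≤ r) (hy : 0 ≤ y) :
    ∀ᵐ J ∂(inputMeasure lam ν), Stops ((c, r, z), y, J) := by
  obtain ⟨a, g, b, q, hm⟩ := exists_isMoments (lam := lam) hν
  exact hm.ae_stops hν c z hr hy

lemma lintegral_exp_rates (c : Fin 2) :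
    ∫⁻ t, ENNReal.ofReal (Real.exp (-(lam (1 - c) * t))) ∂(expMeasure (lam c)) =
      ENNReal.ofReal (lam c / (lam c + lam (1 - c))) := by
  have h := lintegral_exp_mul_quadratic (lam c) (hlam (1 - c)).out.le (α := 1) (β := 0) (γ := 0)
    zero_le_one le_rfl le_rfl
  simpa using h

/-- The value of a bounded function `u` of the service time of the first delivered packet. -/
lemma isValue_service (hν : ∀ᵐ s ∂ν, 0 ≤ s) {u : ℝ → ℝ≥0∞} (hu : Measurable u) {κ : ℝ≥0∞}
    (hκ : κ * ENNReal.ofReal (L ν (lam 0)) =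
      ∫⁻ s, u s * ENNReal.ofReal (Real.exp (-(lam 0 * s))) ∂ν) :
    IsValue lam ν (fun _ z => u z) (fun _ => κ) (fun _ _ => κ) where
  meas_h := by fun_prop
  meas_e := by fun_prop
  meas_k := by intro c; fun_prop
  start c y hy := by
    have hsplit : ∀ s : ℝ, busyValue lam ν (completion (fun _ z => u z) fun _ => κ) (fun _ _ => κ)
        (c, s, s) y = ∫⁻ x, (if s ≤ x then completion (fun _ z => u z) (fun _ => κ) c (y + s) s
          else κ) ∂(expMeasure (lam c)) := fun s => by
      rw [busyValue_eq_lintegral_exp (by intro c; fun_prop)]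
    simp_rw [hsplit]
    rcases (by omega : c = 0 ∨ c = 1) with rfl | rfl
    · have h0 := (hlam 0).out
      -- Success pays `u s`, failure returns to the constant value κ. Averaging over s gives back κ
      -- by the choice of κ in `hκ`.
      have h1 : ∀ᵐ s ∂ν, ∫⁻ x, (if s ≤ x then completion (fun _ z => u z) (fun _ => κ) 0 (y + s) s
          else κ) ∂(expMeasure (lam 0)) = u s * ENNReal.ofReal (Real.exp (-(lam 0 * s))) +
            κ * ENNReal.ofReal (1 - Real.exp (-(lam 0 * s))) := by
        filter_upwards [hν] with s hs
        have e1 := lintegral_expMeasure_memoryless (lam 0) hs (F := fun _ => u s) measurable_const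
        have e2 := lintegral_exp_service (lam 0) (α := 1) (β := 0) (γ := 0) (v := 0) (s := s)
          zero_le_one le_rfl le_rfl le_rfl hs
        have hm : Measurable fun x : ℝ => if s ≤ x then ENNReal.ofReal 0 else
            ENNReal.ofReal (1 + 0 * x + 0 * x ^ 2) :=
          Measurable.ite measurableSet_Ici measurable_const (by fun_prop)
        calc _ = ∫⁻ x, ((if s ≤ x then u s else 0) + κ * (if s ≤ x then ENNReal.ofReal 0 else
            ENNReal.ofReal (1 + 0 * x + 0 * x ^ 2))) ∂(expMeasure (lam 0)) := by
              refine lintegral_congr fun x => ?_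
              by_cases hx : s ≤ x <;> simp [hx, completion]
          _ = _ := by
              rw [lintegral_add_right _ (hm.const_mul _), lintegral_const_mul _ hm, e1, e2]
              simp [mul_comm]
      rw [lintegral_congr_ae h1, lintegral_add_left (by fun_prop), ← hκ,
        lintegral_const_mul _ (by fun_prop)]
      have h2 : ∫⁻ s, ENNReal.ofReal (1 - Real.exp (-(lam 0 * s))) ∂ν =
          ENNReal.ofReal (1 - L ν (lam 0)) := by
        have hi := integrable_exp_service ν hν h0
        rw [L, ← ofReal_integral_eq_lintegral_ofReal]
        · rw [integral_sub (integrable_const _) (by simpa using hi)]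
          simp
        · exact (integrable_const _).sub (by simpa using hi)
        · filter_upwards [hν] with s hs
          simp only [Pi.zero_apply, sub_nonneg, Real.exp_le_one_iff]
          nlinarith
      rw [h2, ← mul_add, ← ENNReal.ofReal_add (L_pos ν hν h0).le
        (sub_nonneg.2 (L_le_one ν hν h0))]
      simp
    · simp [completion]
  empty y hy := by
    have h0 := (hlam 0).out
    have h1 := (hlam 1).out
    have e : ∀ c : Fin 2, ∫⁻ t, ENNReal.ofReal (Real.exp (-(lam (1 - c) * t))) * κ
        ∂(expMeasure (lam c)) = ENNReal.ofReal (lam c / (lam c + lam (1 - c))) * κ := by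
      intro c
      rw [lintegral_mul_const _ (by fun_prop), lintegral_exp_rates]
    rw [Fin.sum_univ_two, e 0, e 1, ← add_mul, ← ENNReal.ofReal_add (by simp; positivity)
      (by simp; positivity)]
    simp only [Fin.isValue, sub_zero, sub_self]
    have : lam 0 / (lam 0 + lam 1) + lam 1 / (lam 1 + lam 0) = 1 := by
      field_simp
      ring
    rw [this]
    simp

/-- The law of the service time of the delivered packets of source 1. -/
lemma lintegral_service_of_le_one (hν : ∀ᵐ s ∂ν, 0 ≤ s) {u : ℝ → ℝ≥0∞} (hu : Measurable u)
    (hu1 : ∀ s, u s ≤ 1) :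
    (∫⁻ J, u (service (idle J)) ∂(inputMeasure lam ν)) * ENNReal.ofReal (L ν (lam 0)) =
      ∫⁻ s, u s * ENNReal.ofReal (Real.exp (-(lam 0 * s))) ∂ν := by
  have h0 := (hlam 0).out
  have hL := L_pos ν hν h0
  have hL0 : ENNReal.ofReal (L ν (lam 0)) ≠ 0 := by simpa using hL
  -- A reward depending only on the service time has the same value κ at every start, since only
  -- successful trials of source 1 count; κ is the mean of `u` given success.
  set κ := (∫⁻ s, u s * ENNReal.ofReal (Real.exp (-(lam 0 * s))) ∂ν) /
    ENNReal.ofReal (L ν (lam 0)) with hκ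
  have hκL : κ * ENNReal.ofReal (L ν (lam 0)) =
      ∫⁻ s, u s * ENNReal.ofReal (Real.exp (-(lam 0 * s))) ∂ν :=
    ENNReal.div_mul_cancel hL0 ENNReal.ofReal_ne_top
  have hκt : κ ≠ ∞ := by
    refine ENNReal.div_ne_top (ne_top_of_le_ne_top ENNReal.one_ne_top ?_) hL0
    calc _ ≤ ∫⁻ _, 1 ∂ν := by
          refine lintegral_mono_ae ?_
          filter_upwards [hν] with s hs
          refine mul_le_one' (hu1 s) ?_
          simp only [ENNReal.ofReal_le_one, Real.exp_le_one_iff]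
          nlinarith
      _ = 1 := by simp
  have hv := isValue_service (lam := lam) hν hu hκL
  have hs := Conf.ae_stops (lam := lam) hν 1 0 le_rfl le_rfl
  have h := hv.lintegral_final hν (c := 1) (z := 0) le_rfl le_rfl hs ?_
  · rw [← hκL]
    congr 1
    calc _ = ∫⁻ J, reward (fun _ z => u z) 1 (final ((1, 0, 0), 0, J)) ∂(inputMeasure lam ν) := by
          refine lintegral_congr fun J => ?_
          rw [reward_final]
          simp [idle]
      _ = _ := by
          rw [h]
          simp [busyValue, completion]
  -- As `u` is at most 1, all values are bounded by the constant 1 + κ.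
  · refine tendsto_avg_run_of_dominated hv.measurable_value hs (fun _ => 1 + κ) (by simp [hκt]) ?_
    refine Eventually.of_forall fun J n _ => ?_
    set s := next^[n] ((1, 0, 0), 0, J)
    calc value lam ν (fun _ z => u z) (fun _ => κ) (fun _ _ => κ) s
        ≤ ∫⁻ _, 1 + κ ∂(inputMeasure lam ν) := by
          refine lintegral_mono fun J => ?_
          unfold completion
          split_ifs
          · exact (hu1 _).trans le_self_add
          · exact le_add_self
          · exact le_add_self
      _ = _ := by simp

lemma measurable_service_idle : Measurable fun J => service (idle J) :=
  measurable_service.comp measurable_idle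

lemma measurable_deliveryTime_idle : Measurable fun J => deliveryTime (idle J) :=
  measurable_deliveryTime.comp measurable_idle

/-- The identity for indicators determines the law: ν weighted by the probability exp (-λ₁ s) of not
being preempted. As a law it also yields the mean of the unbounded service time. -/
lemma map_service_idle (hν : ∀ᵐ s ∂ν, 0 ≤ s) :
    (inputMeasure lam ν).map (fun J => service (idle J)) =
      (ENNReal.ofReal (L ν (lam 0)))⁻¹ •
        ν.withDensity (fun s => ENNReal.ofReal (Real.exp (-(lam 0 * s)))) := by
  have hL0 : ENNReal.ofReal (L ν (lam 0)) ≠ 0 := by simpa using L_pos ν hν (hlam 0).out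
  ext B hB
  have h := lintegral_service_of_le_one (lam := lam) hν (u := B.indicator 1) (measurable_one.indicator hB)
    (fun s => Set.indicator_le (fun _ _ => le_rfl) s)
  rw [Measure.smul_apply, withDensity_apply _ hB, Measure.map_apply measurable_service_idle hB,
    smul_eq_mul]
  have e1 : ∫⁻ J, B.indicator (1 : ℝ → ℝ≥0∞) (service (idle J)) ∂(inputMeasure lam ν) =
      inputMeasure lam ν ((fun J => service (idle J)) ⁻¹' B) := by
    rw [← lintegral_indicator_one (measurable_service_idle hB)]
    rfl
  have e2 : ∫⁻ s, B.indicator (1 : ℝ → ℝ≥0∞) s * ENNReal.ofReal (Real.exp (-(lam 0 * s))) ∂ν =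
      ∫⁻ s in B, ENNReal.ofReal (Real.exp (-(lam 0 * s))) ∂ν := by
    rw [← lintegral_indicator hB]
    refine lintegral_congr fun s => ?_
    by_cases hs : s ∈ B <;> simp [hs]
  rw [e1, e2] at h
  rw [← h, mul_comm, mul_assoc, ENNReal.mul_inv_cancel hL0 ENNReal.ofReal_ne_top, mul_one]

lemma ae_service_idle_nonneg (hν : ∀ᵐ s ∂ν, 0 ≤ s) :
    ∀ᵐ J ∂(inputMeasure lam ν), 0 ≤ service (idle J) := by
  refine ae_of_ae_map measurable_service_idle.aemeasurable (p := fun s => 0 ≤ s) ?_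
  rw [map_service_idle hν]
  exact Measure.ae_smul_measure (withDensity_absolutelyContinuous _ _ hν) _

lemma integral_service_idle (hν : ∀ᵐ s ∂ν, 0 ≤ s) :
    Integrable (fun J => service (idle J)) (inputMeasure lam ν) ∧
      ∫ J, service (idle J) ∂(inputMeasure lam ν) = serviceMean lam ν := by
  have h0 := (hlam 0).out
  have hL := L_pos ν hν h0
  have hi := integrable_mul_exp_service ν hν h0
  have h : ∫⁻ J, ENNReal.ofReal (service (idle J)) ∂(inputMeasure lam ν) =
      ENNReal.ofReal (serviceMean lam ν) := by
    rw [← lintegral_map (f := fun s => ENNReal.ofReal s) (by fun_prop) measurable_service_idle, map_service_idle hν,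
      lintegral_smul_measure, lintegral_withDensity_eq_lintegral_mul _ (by fun_prop) (by fun_prop),
      serviceMean, ENNReal.ofReal_div_of_pos hL, L', ofReal_integral_eq_lintegral_ofReal hi,
      div_eq_mul_inv, smul_eq_mul, mul_comm]
    · congr 1
      refine lintegral_congr fun s => ?_
      rw [Pi.mul_apply, ← ENNReal.ofReal_mul (Real.exp_pos _).le, mul_comm, neg_mul]
    · filter_upwards [hν] with s hs
      have := Real.exp_pos (-lam 0 * s)
      simp only [Pi.zero_apply]
      positivity
  have hpos : 0 ≤ᵐ[inputMeasure lam ν] fun J => service (idle J) := ae_service_idle_nonneg hν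
  have hint : Integrable (fun J => service (idle J)) (inputMeasure lam ν) := by
    refine ⟨measurable_service_idle.aestronglyMeasurable, ?_⟩
    rw [hasFiniteIntegral_iff_ofReal hpos, h]
    exact ENNReal.ofReal_lt_top
  refine ⟨hint, ?_⟩
  rw [integral_eq_lintegral_of_nonneg_ae hpos measurable_service_idle.aestronglyMeasurable, h,
    ENNReal.toReal_ofReal]
  exact div_nonneg (L'_nonneg ν hν) hL.le

lemma ae_deliveryTime_idle_nonneg (hν : ∀ᵐ s ∂ν, 0 ≤ s) :
    ∀ᵐ J ∂(inputMeasure lam ν), 0 ≤ deliveryTime (idle J) := by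
  filter_upwards [ae_good lam ν hν] with J hJ
  have hg : (idle J).Good := ⟨le_rfl, le_rfl, hJ⟩
  exact hg.clock_le_deliveryTime (n := 0) (zero_le)

/-- Starting the clock at 0 and at 1 gives the means of D² and of (1 + D)²; the mean of D is half
the difference minus one half. -/
lemma integral_deliveryTime_idle (hν : ∀ᵐ s ∂ν, 0 ≤ s) :
    Integrable (fun J => deliveryTime (idle J)) (inputMeasure lam ν) ∧
      Integrable (fun J => deliveryTime (idle J) ^ 2) (inputMeasure lam ν) ∧
      ∫ J, deliveryTime (idle J) ∂(inputMeasure lam ν) = cycleMean lam ν ∧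
      ∫ J, deliveryTime (idle J) ^ 2 ∂(inputMeasure lam ν) = cycleSecondMoment lam ν := by
  obtain ⟨a, g, b, q, hm⟩ := exists_isMoments (lam := lam) hν
  have hm0 := hm.lintegral_sq_deliveryTime hν (y := 0) le_rfl
  have hm1 := hm.lintegral_sq_deliveryTime hν (y := 1) zero_le_one
  have hM := hm.M_nonneg
  have hQ := hm.Q_nonneg
  set M := cycleMean lam ν
  set Q := cycleSecondMoment lam ν
  have hsh : ∀ J : Input, deliveryTime ((1, 0, 0), 1, J) = 1 + deliveryTime (idle J) := by
    intro J
    rw [← deliveryTime_shift]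
    simp [shift, idle]
  have hD := measurable_deliveryTime_idle
  have key : ∀ (f : Input → ℝ) (v : ℝ), Measurable f → 0 ≤ v →
      ∫⁻ J, ENNReal.ofReal (f J ^ 2) ∂(inputMeasure lam ν) = ENNReal.ofReal v →
      Integrable (fun J => f J ^ 2) (inputMeasure lam ν) ∧
        ∫ J, f J ^ 2 ∂(inputMeasure lam ν) = v := by
    intro f v hf hv h
    have hpos : 0 ≤ᵐ[inputMeasure lam ν] fun J => f J ^ 2 :=
      Eventually.of_forall fun J => sq_nonneg _
    have hm : Measurable fun J => f J ^ 2 := by fun_prop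
    refine ⟨⟨hm.aestronglyMeasurable, ?_⟩, ?_⟩
    · rw [hasFiniteIntegral_iff_ofReal hpos, h]
      exact ENNReal.ofReal_lt_top
    · rw [integral_eq_lintegral_of_nonneg_ae hpos hm.aestronglyMeasurable, h,
        ENNReal.toReal_ofReal hv]
  obtain ⟨i0, e0⟩ := key (fun J => deliveryTime (idle J)) Q hD hQ (by simpa [idle] using hm0)
  obtain ⟨i1, e1⟩ := key (fun J => 1 + deliveryTime (idle J)) (1 + 2 * M + Q) (by fun_prop) (by positivity)
    (by simpa [hsh] using hm1)
  have hlin : ∀ J, deliveryTime (idle J) =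
      ((1 + deliveryTime (idle J)) ^ 2 - deliveryTime (idle J) ^ 2 - 1) / 2 := fun J => by ring
  have i2 : Integrable (fun J => (1 + deliveryTime (idle J)) ^ 2 - deliveryTime (idle J) ^ 2)
    (inputMeasure lam ν) := i1.sub i0
  have i3 : Integrable (fun J => (1 + deliveryTime (idle J)) ^ 2 - deliveryTime (idle J) ^ 2 - 1)
    (inputMeasure lam ν) := i2.sub (integrable_const _)
  refine ⟨?_, i0, ?_, e0⟩
  · exact (i3.div_const 2).congr (Eventually.of_forall fun J => (hlin J).symm)
  · rw [integral_congr_ae (Eventually.of_forall hlin), integral_div,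
      integral_sub i2 (integrable_const _), integral_sub i1 i0, e0, e1]
    simp

end Conf

end

section

/-! ### Strong laws for renewal sequences -/

section Renewal

variable {E D : Type*} [MeasurableSpace E] [MeasurableSpace D] {μ : Measure E}
  [IsProbabilityMeasure μ] {θ : E → E} {C : E → D}

/-- The observation `C` is independent of the shifted point `θ`, which has the same law as the
original point. -/
structure IsRenewal (μ : Measure E) (C : E → D) (θ : E → E) : Prop where
  meas_C : Measurable C
  meas_θ : Measurable θ
  map_eq : μ.map (fun x => (C x, θ x)) = (μ.map C).prod μ

namespace IsRenewal

lemma measurePreserving (h : IsRenewal μ C θ) : MeasurePreserving θ μ μ := by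
  refine ⟨h.meas_θ, ?_⟩
  have := Measure.isProbabilityMeasure_map (μ := μ) h.meas_C.aemeasurable
  have h1 := congrArg (Measure.map Prod.snd) h.map_eq
  rw [Measure.map_map measurable_snd (h.meas_C.prodMk h.meas_θ), Measure.map_snd_prod] at h1
  simpa [Function.comp_def] using h1

lemma indepFun (h : IsRenewal μ C θ) : IndepFun C θ μ := by
  rw [indepFun_iff_map_prod_eq_prod_map_map h.meas_C.aemeasurable h.meas_θ.aemeasurable, h.map_eq,
    h.measurePreserving.map_eq]

/-- Two consecutive observations. -/
lemma pair (h : IsRenewal μ C θ) : IsRenewal μ (fun x => (C x, C (θ x))) (θ^[2]) := by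
  have := Measure.isProbabilityMeasure_map (μ := μ) h.meas_C.aemeasurable
  have hC := h.meas_C
  have hθ := h.meas_θ
  -- The renewal factorization is applied twice, the second time to the shifted point, and the
  -- triple product is reassociated.
  have key : μ.map (fun x => ((C x, C (θ x)), θ^[2] x)) =
      ((μ.map C).prod (μ.map C)).prod μ := by
    have e1 : (fun x => ((C x, C (θ x)), θ^[2] x)) = (MeasurableEquiv.prodAssoc.symm) ∘
        (Prod.map id fun x => (C x, θ x)) ∘ fun x => (C x, θ x) := rfl
    have hm : Measurable (Prod.map (id : D → D) fun x => (C x, θ x)) := by fun_prop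
    rw [e1, ← Measure.map_map (MeasurableEquiv.measurable _) (hm.comp (by fun_prop)),
      ← Measure.map_map hm (by fun_prop), h.map_eq,
      ← Measure.map_prod_map _ _ measurable_id (by fun_prop), Measure.map_id, h.map_eq,
      ← Measure.prodAssoc_prod, MeasurableEquiv.map_symm_map]
  refine ⟨by fun_prop, hθ.iterate 2, ?_⟩
  have h2 := congrArg (Measure.map Prod.fst) key
  rw [Measure.map_map measurable_fst (by fun_prop), Measure.map_fst_prod] at h2
  rw [key]
  congr 1
  simpa [Function.comp_def] using h2.symm

lemma identDistrib (h : IsRenewal μ C θ) {f : D → ℝ} (hf : Measurable f) (i : ℕ) :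
    IdentDistrib (fun x => f (C (θ^[i] x))) (fun x => f (C x)) μ μ := by
  have hC := h.meas_C
  have hi := (h.measurePreserving.iterate i)
  have hfC : Measurable fun x => f (C x) := by fun_prop
  refine ⟨(hfC.comp hi.measurable).aemeasurable, hfC.aemeasurable, ?_⟩
  have : (fun x => f (C (θ^[i] x))) = (fun x => f (C x)) ∘ θ^[i] := rfl
  rw [this, ← Measure.map_map hfC hi.measurable, hi.map_eq]

/-- The first observation is independent of everything after the shift; applying θ i times, which
preserves μ, moves this statement to index i. -/
lemma indepFun_of_lt (h : IsRenewal μ C θ) {f : D → ℝ} (hf : Measurable f) {i j : ℕ} (hij : i < j) :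
    IndepFun (fun x => f (C (θ^[i] x))) (fun x => f (C (θ^[j] x))) μ := by
  obtain ⟨k, rfl⟩ := Nat.exists_eq_add_of_lt hij
  have hC := h.meas_C
  have hi := (h.measurePreserving.iterate i)
  have hk := (h.measurePreserving.iterate k)
  have hfC : Measurable fun x => f (C x) := by fun_prop
  have hfCk : Measurable fun x => f (C (θ^[k] (θ x))) := hfC.comp (hk.measurable.comp h.meas_θ)
  have h0 : IndepFun (fun x => f (C x)) (fun x => f (C (θ^[k] (θ x)))) μ :=
    h.indepFun.comp hf (hfC.comp hk.measurable)
  have e : (fun x => f (C (θ^[i + k + 1] x))) = fun x => f (C (θ^[k] (θ (θ^[i] x)))) := by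
    funext x
    rw [← Function.iterate_succ_apply, ← Function.iterate_add_apply]
    congr 3
    omega
  rw [e]
  rw [indepFun_iff_map_prod_eq_prod_map_map hfC.aemeasurable hfCk.aemeasurable] at h0
  refine (indepFun_iff_map_prod_eq_prod_map_map (hfC.comp hi.measurable).aemeasurable
    (hfCk.comp hi.measurable).aemeasurable).2 ?_
  change μ.map ((fun x => (f (C x), f (C (θ^[k] (θ x))))) ∘ θ^[i]) = _
  rw [← Measure.map_map (hfC.prodMk hfCk) hi.measurable,
    ← Measure.map_map hfC hi.measurable, ← Measure.map_map hfCk hi.measurable, hi.map_eq, h0]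

lemma strong_law (h : IsRenewal μ C θ) {f : D → ℝ} (hf : Measurable f)
    (hint : Integrable (fun x => f (C x)) μ) :
    ∀ᵐ x ∂μ, Tendsto (fun n : ℕ => (∑ i ∈ Finset.range n, f (C (θ^[i] x))) / n) atTop
      (𝓝 (∫ x, f (C x) ∂μ)) := by
  refine strong_law_ae_real (fun i x => f (C (θ^[i] x))) hint (fun i j hij => ?_)
    (fun i => h.identDistrib hf i)
  rcases lt_or_gt_of_ne hij with hlt | hlt
  · exact h.indepFun_of_lt hf hlt
  · exact (h.indepFun_of_lt hf hlt).symm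

end IsRenewal

/-- A range of length n contains (n + 1) / 2 even and n / 2 odd indices; adding the two errors, each
o(n), avoids a case distinction on limits. -/
lemma tendsto_average_of_even_odd {a : ℕ → ℝ} {v : ℝ}
    (h0 : Tendsto (fun n : ℕ => (∑ i ∈ Finset.range n, a (2 * i)) / n) atTop (𝓝 v))
    (h1 : Tendsto (fun n : ℕ => (∑ i ∈ Finset.range n, a (2 * i + 1)) / n) atTop (𝓝 v)) :
    Tendsto (fun n : ℕ => (∑ i ∈ Finset.range n, a i) / n) atTop (𝓝 v) := by
  have key : ∀ S : ℕ → ℝ, S 0 = 0 → (Tendsto (fun n : ℕ => S n / n) atTop (𝓝 v) ↔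
      (fun n : ℕ => S n - v * n) =o[atTop] fun n : ℕ => (n : ℝ)) := by
    intro S hS
    rw [Asymptotics.isLittleO_iff_tendsto']
    · rw [← tendsto_sub_nhds_zero_iff]
      refine tendsto_congr' ?_
      filter_upwards [eventually_gt_atTop 0] with n hn
      have : (n : ℝ) ≠ 0 := by positivity
      field_simp
    · filter_upwards [eventually_gt_atTop 0] with n hn h
      exact absurd (Nat.cast_eq_zero.1 h) hn.ne'
  rw [key _ (by simp)] at h0 h1 ⊢
  have hb : ∀ (m : ℕ → ℕ) (_ : ∀ n, m n ≤ n) (_ : Tendsto m atTop atTop) (S : ℕ → ℝ),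
      (fun n : ℕ => S n) =o[atTop] (fun n : ℕ => (n : ℝ)) →
      (fun n : ℕ => S (m n)) =o[atTop] fun n : ℕ => (n : ℝ) := by
    intro m hm ht S hS
    refine (hS.comp_tendsto ht).trans_isBigO ?_
    refine Asymptotics.IsBigO.of_bound 1 (Eventually.of_forall fun n => ?_)
    simpa using hm n
  have t0 : Tendsto (fun n : ℕ => (n + 1) / 2) atTop atTop :=
    tendsto_atTop_atTop.2 fun b => ⟨2 * b, fun n hn => by omega⟩
  have t1 : Tendsto (fun n : ℕ => n / 2) atTop atTop :=
    tendsto_atTop_atTop.2 fun b => ⟨2 * b, fun n hn => by omega⟩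
  have hsum := (hb (fun n => (n + 1) / 2) (fun n => by omega) t0 _ h0).add
    (hb (fun n => n / 2) (fun n => by omega) t1 _ h1)
  refine hsum.congr_left fun n => ?_
  have hsplit : ∑ i ∈ Finset.range n, a i = ∑ i ∈ Finset.range ((n + 1) / 2), a (2 * i) +
      ∑ i ∈ Finset.range (n / 2), a (2 * i + 1) := by
    induction n with
    | zero => simp
    | succ n ih =>
      rw [Finset.sum_range_succ, ih]
      rcases Nat.even_or_odd' n with ⟨k, rfl | rfl⟩
      · have e1 : (2 * k + 1) / 2 = k := by omega
        have e2 : (2 * k + 1 + 1) / 2 = k + 1 := by omega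
        have e3 : 2 * k / 2 = k := by omega
        rw [e1, e2, e3, Finset.sum_range_succ _ k]
        ring
      · have e1 : (2 * k + 1) / 2 = k := by omega
        have e2 : (2 * k + 1 + 1) / 2 = k + 1 := by omega
        have e3 : (2 * k + 1 + 1 + 1) / 2 = k + 1 := by omega
        rw [e1, e2, e3, Finset.sum_range_succ (fun i => a (2 * i + 1)) k]
        ring
  have hn : ((n : ℕ) : ℝ) = (((n + 1) / 2 : ℕ) : ℝ) + ((n / 2 : ℕ) : ℝ) := by
    rw [← Nat.cast_add]
    congr 1
    omega
  rw [hsplit, hn]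
  ring

/-- The strong law of large numbers for functions of two consecutive observations. -/
lemma IsRenewal.strong_law_pair (h : IsRenewal μ C θ) {f : D × D → ℝ} (hf : Measurable f)
    (hint : Integrable (fun x => f (C x, C (θ x))) μ) :
    ∀ᵐ x ∂μ, Tendsto (fun n : ℕ => (∑ i ∈ Finset.range n, f (C (θ^[i] x), C (θ^[i + 1] x))) / n)
      atTop (𝓝 (∫ x, f (C x, C (θ x)) ∂μ)) := by
  -- Overlapping pairs are dependent, but the pairs starting at even indices form a renewal sequence
  -- for θ². The odd ones are the even ones of the shifted point.
  have h0 := h.pair.strong_law hf hint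
  have h1 := h.measurePreserving.quasiMeasurePreserving.ae h0
  filter_upwards [h0, h1] with x h0 h1
  refine tendsto_average_of_even_odd ?_ ?_
  · refine h0.congr fun n => ?_
    congr 1
    refine Finset.sum_congr rfl fun i _ => ?_
    rw [← Function.iterate_mul, ← Function.iterate_succ_apply' θ]
  · refine h1.congr fun n => ?_
    congr 1
    refine Finset.sum_congr rfl fun i _ => ?_
    rw [← Function.iterate_mul, ← Function.iterate_succ_apply' θ, ← Function.iterate_succ_apply,
      ← Function.iterate_succ_apply]

end Renewal

/-! ### The cycles between the deliveries of source 1 -/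

variable {lam : Fin 2 → ℝ} [hlam : ∀ c, Fact (0 < lam c)] {ν : Measure ℝ} [IsProbabilityMeasure ν]

/-- The length of a cycle that starts with the empty system and ends with the next delivery of
source 1, and the service time of the delivered packet. -/
def cycle (J : Input) : ℝ × ℝ := (Conf.deliveryTime (Conf.idle J), Conf.service (Conf.idle J))

/-- The future after a cycle. -/
def renew (J : Input) : Input := Conf.rest (Conf.idle J)

lemma measurable_cycle : Measurable cycle :=
  Conf.measurable_deliveryTime_idle.prodMk Conf.measurable_service_idle

lemma measurable_renew : Measurable renew := Conf.measurable_rest.comp Conf.measurable_idle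

/-- The constant reward 1 in `Conf.lintegral_reward_final`: whatever the packet in service, the
future seen at the first delivery has the original law. -/
lemma measurePreserving_rest (hν : ∀ᵐ s ∂ν, 0 ≤ s) (c : Fin 2) {r : ℝ} (z : ℝ) (hr : 0 ≤ r) :
    MeasurePreserving (fun J => Conf.rest ((c, r, z), 0, J)) (inputMeasure lam ν)
      (inputMeasure lam ν) := by
  have hm : Measurable (fun J : Input => Conf.rest ((c, r, z), 0, J)) :=
    Conf.measurable_rest.comp (by fun_prop : Measurable fun J : Input => (((c, r, z), 0, J) : Conf))
  refine ⟨hm, ?_⟩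
  ext B hB
  have h := Conf.lintegral_reward_final (h := fun _ _ => 1) (f := B.indicator 1) hν hr le_rfl
    (Conf.ae_stops (lam := lam) hν c z hr le_rfl) measurable_const (measurable_one.indicator hB) ?_
  · simp only [Conf.reward_final, one_mul, Pi.one_apply, lintegral_const, measure_univ] at h
    rw [lintegral_indicator_one hB] at h
    rw [← h, Measure.map_apply hm hB, ← lintegral_indicator_one (hm hB)]
    rfl
  · rw [lintegral_indicator_one hB]
    exact measure_ne_top _ _

/-- Independence of past and future at a delivery, tested on rectangles: the reward sees the cycle,
the function of the future sees the renewed input. -/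
lemma isRenewal_cycle (hν : ∀ᵐ s ∂ν, 0 ≤ s) : IsRenewal (inputMeasure lam ν) cycle renew := by
  refine ⟨measurable_cycle, measurable_renew, ?_⟩
  have := Measure.isProbabilityMeasure_map (μ := inputMeasure lam ν) measurable_cycle.aemeasurable
  have hmm := measurable_cycle.prodMk measurable_renew
  symm
  refine Measure.prod_eq fun A B hA hB => ?_
  have h := Conf.lintegral_reward_final (h := fun y z => A.indicator 1 (y, z)) (f := B.indicator 1)
    hν le_rfl le_rfl (Conf.ae_stops (lam := lam) hν 1 0 le_rfl le_rfl)
    (measurable_one.indicator hA) (measurable_one.indicator hB) ?_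
  · simp only [Conf.reward_final, Pi.one_apply, mul_one] at h
    rw [lintegral_indicator_one hB] at h
    rw [Measure.map_apply hmm (hA.prod hB), Measure.map_apply measurable_cycle hA,
      ← lintegral_indicator_one (measurable_cycle hA),
      ← lintegral_indicator_one (hmm (hA.prod hB))]
    refine Eq.trans ?_ (h.trans ?_)
    · refine lintegral_congr fun J => ?_
      by_cases h1 : cycle J ∈ A <;> by_cases h2 : renew J ∈ B
      all_goals
        have h1' := h1
        have h2' := h2
        unfold cycle Conf.idle at h1'
        unfold renew Conf.idle at h2'
        simp [h1, h2, h1', h2']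
    · rfl
  · rw [lintegral_indicator_one hB]
    exact measure_ne_top _ _

end

/-! ### From sample paths to configurations and cycles -/

section

namespace Input

lemma wait_delay (r : ℝ) (J : Input) : (J.delay r).wait = J.wait - r := by
  simp [Input.delay, Input.wait, Stream.delay, min_sub_sub_right]

lemma src_delay (r : ℝ) (J : Input) : (J.delay r).src = J.src := by
  simp [Input.delay, Input.src, Stream.delay]

lemma serv_delay (r : ℝ) (J : Input) : (J.delay r).serv = J.serv := by
  simp [Input.delay, Input.serv, Stream.delay, Stream.serv]

lemma pop_delay (r : ℝ) (J : Input) : (J.delay r).pop = J.pop := by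
  by_cases hle : J.1.1 ≤ J.2.1 <;> simp [Input.delay, Input.pop, Stream.delay, Stream.pop, hle]

end Input

namespace Conf

/-- After a delivery the system continues like the empty system. -/
lemma next_of_le_wait {s : Conf} (h : s.1.2.1 ≤ s.2.2.wait) :
    s.next = (idle (s.2.2.delay s.1.2.1)).next.shift (s.2.1 + s.1.2.1) := by
  have h1 : ¬ (s.2.2.wait < s.1.2.1 ∧ s.1.1 ≠ s.2.2.src) := fun h' => absurd h'.1 (not_lt.2 h)
  have h2 : ¬ (s.2.2.wait - s.1.2.1 < 0 ∧ (1 : Fin 2) ≠ s.2.2.src) := fun h' => by linarith [h'.1]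
  simp only [next, shift, idle, Input.wait_delay, Input.src_delay, Input.serv_delay,
    Input.pop_delay, if_neg h1, if_neg h2, zero_add]
  congr 2
  ring

/-- False for k = 0, because the delivered packet is still recorded in the configuration; from the
next arrival on it has been forgotten. -/
lemma iterate_of_done {s : Conf} (h : s.Done) {k : ℕ} (hk : 0 < k) :
    next^[k] s = (next^[k] (idle (s.2.2.delay s.1.2.1))).shift (s.2.1 + s.1.2.1) := by
  obtain ⟨k, rfl⟩ := Nat.exists_eq_succ_of_ne_zero hk.ne'
  rw [Function.iterate_succ_apply, next_of_le_wait h.2, iterate_shift, ← Function.iterate_succ_apply]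

/-- The empty system is encoded as a completed packet of source 2, so it never counts as a delivery
of source 1. -/
lemma not_done_idle (J : Input) : ¬ (idle J).Done := fun h => absurd h.1 (by simp [idle])

lemma stopIndex_idle_pos {J : Input} (h : (idle J).Stops) : 0 < (idle J).stopIndex := by
  rw [Nat.pos_iff_ne_zero]
  intro h0
  have := h.done_final
  rw [final, h0] at this
  exact not_done_idle J this

/-- The index of the `i`th delivery of source 1. -/
def deliveryIndex (s : Conf) : ℕ → ℕ
  | 0 => s.stopIndex
  | i + 1 => deliveryIndex s i + (idle (renew^[i] s.rest)).stopIndex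

/-- The time of the `i`th delivery of source 1. -/
def epoch (s : Conf) : ℕ → ℝ
  | 0 => s.deliveryTime
  | i + 1 => epoch s i + (cycle (renew^[i] s.rest)).1

/-- The service time of the `i`th delivered packet of source 1. -/
def epochService (s : Conf) : ℕ → ℝ
  | 0 => s.service
  | i + 1 => (cycle (renew^[i] s.rest)).2

lemma count_done_stopIndex [DecidablePred fun n => (next^[n] s).Done] :
    Nat.count (fun n => (next^[n] s).Done) s.stopIndex = 0 := by
  rw [Nat.count_eq_card_filter_range, Finset.card_eq_zero, Finset.filter_eq_empty_iff]
  intro k hk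
  exact not_done_of_lt (Finset.mem_range.1 hk)

/-- Each delivery is followed by a shifted copy of the chain from the empty system, whose first
delivery closes the next cycle. -/
lemma delivery_data {s : Conf} (hs : s.Stops) (hJ : ∀ i, (idle (renew^[i] s.rest)).Stops) (i : ℕ) :
    (next^[s.deliveryIndex i] s).Done ∧
    (next^[s.deliveryIndex i] s).2.1 + (next^[s.deliveryIndex i] s).1.2.1 = s.epoch i ∧
    (next^[s.deliveryIndex i] s).1.2.2 = s.epochService i ∧
    (next^[s.deliveryIndex i] s).2.2.delay (next^[s.deliveryIndex i] s).1.2.1 = renew^[i] s.rest := by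
  induction i with
  | zero => exact ⟨hs.done_final, rfl, rfl, rfl⟩
  | succ i ih =>
    obtain ⟨h1, h2, h3, h4⟩ := ih
    have hpos := stopIndex_idle_pos (hJ i)
    have e : next^[s.deliveryIndex (i + 1)] s =
        (idle (renew^[i] s.rest)).final.shift (s.epoch i) := by
      rw [deliveryIndex, add_comm, Function.iterate_add_apply, iterate_of_done h1 hpos, h2, h4]
      rfl
    rw [e]
    refine ⟨(hJ i).done_final, ?_, rfl, ?_⟩
    · exact add_assoc _ _ _
    · rw [Function.iterate_succ_apply']
      rfl

/-- Counting: between consecutive delivery indices there is exactly one delivery, the one at the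
left end. -/
lemma nth_done {s : Conf} (hs : s.Stops) (hJ : ∀ i, (idle (renew^[i] s.rest)).Stops) (i : ℕ) :
    Nat.nth (fun n => (next^[n] s).Done) i = s.deliveryIndex i := by
  classical
  have hcount : Nat.count (fun n => (next^[n] s).Done) (s.deliveryIndex i) = i := by
    induction i with
    | zero => exact count_done_stopIndex
    | succ i ih =>
      obtain ⟨h1, h2, h3, h4⟩ := delivery_data hs hJ i
      have hpos := stopIndex_idle_pos (hJ i)
      rw [deliveryIndex, Nat.count_add, ih]
      congr 1
      rw [Nat.count_eq_card_filter_range, Finset.card_eq_one]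
      refine ⟨0, ?_⟩
      ext k
      simp only [Finset.mem_filter, Finset.mem_range, Finset.mem_singleton]
      constructor
      · rintro ⟨hk, hd⟩
        by_contra h0
        rw [add_comm, Function.iterate_add_apply, iterate_of_done h1 (Nat.pos_of_ne_zero h0), h4,
          done_shift] at hd
        exact not_done_of_lt hk hd
      · rintro rfl
        exact ⟨hpos, h1⟩
  have h := Nat.nth_count (p := fun n => (next^[n] s).Done) (delivery_data hs hJ i).1
  rwa [hcount] at h

end Conf

namespace Path

variable (p : Path)

/-- The arrivals after time `y`, when `k c` packets of source `c` have arrived. -/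
def future (k : Fin 2 → ℕ) (y : ℝ) : Input :=
  ((p.gen 0 (k 0) - y, fun n => (p.S 0 (k 0 + n), p.X 0 (k 0 + n + 1))),
    (p.gen 1 (k 1) - y, fun n => (p.S 1 (k 1 + n), p.X 1 (k 1 + n + 1))))

/-- The arrivals after time `0`. -/
def input : Input := ((p.X 0 0, fun n => (p.S 0 n, p.X 0 (n + 1))),
  (p.X 1 0, fun n => (p.S 1 n, p.X 1 (n + 1))))

open Classical in
/-- The packet in the server at time `0`. -/
def mode : Fin 2 × ℝ × ℝ :=
  if p.pkt₀.fin ≤ 0 then (1, 0, 0) else (p.pkt₀.src, p.pkt₀.fin, p.pkt₀.fin - p.pkt₀.gen)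

/-- The configuration at time `0`. -/
def conf : Conf := (p.mode, 0, p.input)

/-- The last packet of the state is the packet of the configuration. -/
def SamePacket (st : State) (s : Conf) : Prop :=
  st.last.src = s.1.1 ∧ st.last.fin = s.2.1 + s.1.2.1 ∧ st.last.gen = st.last.fin - s.1.2.2

/-- The state and the configuration describe the same system. -/
def Matches (st : State) (s : Conf) : Prop :=
  s.2.2 = p.future st.count s.2.1 ∧
    (SamePacket st s ∨ (st.last.fin ≤ s.2.1 ∧ s.1 = (1, 0, 0)))

variable {p}

lemma gen_succ (c : Fin 2) (n : ℕ) : p.gen c (n + 1) = p.gen c n + p.X c (n + 1) := by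
  rw [gen, Finset.sum_range_succ, ← gen]

lemma nextSrc_eq {st : State} {s : Conf} (h : s.2.2 = p.future st.count s.2.1) :
    p.nextSrc st = s.2.2.src := by
  rw [h]
  simp [nextSrc, Input.src, future]

lemma nextTime_eq {st : State} {s : Conf} (h : s.2.2 = p.future st.count s.2.1) :
    p.nextTime st = s.2.1 + s.2.2.wait := by
  have h1 : s.2.2.wait = p.nextTime st - s.2.1 := by
    rw [h]
    by_cases hle : p.gen 0 (st.count 0) ≤ p.gen 1 (st.count 1)
    · simp [nextTime, nextSrc, Input.wait, future, hle]
    · simp [nextTime, nextSrc, Input.wait, future, hle, (not_le.1 hle).le]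
  rw [h1]
  ring

lemma serv_eq {st : State} {s : Conf} (h : s.2.2 = p.future st.count s.2.1) :
    p.S (p.nextSrc st) (st.count (p.nextSrc st)) = s.2.2.serv := by
  rw [h]
  by_cases hle : p.gen 0 (st.count 0) ≤ p.gen 1 (st.count 1)
  · simp [nextSrc, Input.serv, Stream.serv, future, hle]
  · simp [nextSrc, Input.serv, Stream.serv, future, hle]

lemma pop_eq {st : State} {s : Conf} (h : s.2.2 = p.future st.count s.2.1) :
    s.2.2.pop = p.future (p.step st).count (s.2.1 + s.2.2.wait) := by
  rw [← nextTime_eq h, h]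
  by_cases hle : p.gen 0 (st.count 0) ≤ p.gen 1 (st.count 1)
  · simp [nextTime, nextSrc, step, Input.pop, Stream.pop, Stream.delay, future, hle, gen_succ,
      add_right_comm _ 1, add_assoc]
  · simp [nextTime, nextSrc, step, Input.pop, Stream.pop, Stream.delay, future, hle, gen_succ,
      add_right_comm _ 1, add_assoc]

lemma Matches.step {st : State} {s : Conf} (h : p.Matches st s) (hs : s.Good) :
    p.Matches (p.step st) s.next ∧ SamePacket (p.step st) s.next := by
  have h1 := nextSrc_eq h.1
  have h2 := nextTime_eq h.1
  have h3 := serv_eq h.1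
  have hw := hs.2.2.wait_nonneg
  have key : SamePacket (p.step st) s.next := by
    have hnew : ¬ (p.nextTime st < st.last.fin ∧ st.last.src ≠ p.nextSrc st) →
        ¬ (s.2.2.wait < s.1.2.1 ∧ s.1.1 ≠ s.2.2.src) → SamePacket (p.step st) s.next := by
      intro hn hn'
      have e : (p.step st).last = p.nextPacket st := if_neg hn
      have e' : s.next.1 = (s.2.2.src, s.2.2.serv, s.2.2.serv) := if_neg hn'
      rw [SamePacket, e, e']
      refine ⟨h1, ?_, ?_⟩
      · change p.nextTime st + p.S (p.nextSrc st) (st.count (p.nextSrc st)) =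
          s.2.1 + s.2.2.wait + s.2.2.serv
        rw [h2, h3]
      · change p.nextTime st = p.nextTime st +
          p.S (p.nextSrc st) (st.count (p.nextSrc st)) - s.2.2.serv
        rw [h3]
        ring
    rcases h.2 with hp | ⟨hf, hm⟩
    · have hiff : (p.nextTime st < st.last.fin ∧ st.last.src ≠ p.nextSrc st) ↔
          (s.2.2.wait < s.1.2.1 ∧ s.1.1 ≠ s.2.2.src) := by
        rw [h2, hp.2.1, hp.1, h1, add_lt_add_iff_left]
      by_cases hc : s.2.2.wait < s.1.2.1 ∧ s.1.1 ≠ s.2.2.src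
      · have hc' := hiff.2 hc
        unfold SamePacket
        simp only [Path.step, Conf.next, if_pos hc, if_pos hc']
        refine ⟨hp.1, ?_, hp.2.2⟩
        rw [hp.2.1]
        ring
      · exact hnew (fun h' => hc (hiff.1 h')) hc
    · refine hnew (fun h' => ?_) (fun h' => ?_)
      · have := h'.1
        rw [h2] at this
        linarith
      · have := h'.1
        rw [hm] at this
        simp only at this
        linarith
  exact ⟨⟨pop_eq h.1, Or.inl key⟩, key⟩

lemma matches_conf : p.Matches (p.state 0) p.conf := by
  refine ⟨?_, ?_⟩
  · simp [conf, state, future, input, gen]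
  · unfold SamePacket conf mode state
    by_cases h : p.pkt₀.fin ≤ 0
    · right; simp [h]
    · left; simp [h]

lemma matches_state (hp : p.conf.Good) (n : ℕ) : p.Matches (p.state n) (Conf.next^[n] p.conf) := by
  induction n with
  | zero => exact matches_conf
  | succ n ih =>
    rw [Function.iterate_succ_apply']
    exact (ih.step (hp.iterate n)).1

lemma samePacket_of_delivers (hp : p.conf.Good) {n : ℕ} (h : n = 0 → 0 < p.pkt₀.fin) :
    SamePacket (p.state n) (Conf.next^[n] p.conf) := by
  cases n with
  | zero =>
    have := h rfl
    unfold SamePacket conf mode state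
    simp [not_le.2 this]
  | succ n =>
    rw [Function.iterate_succ_apply']
    exact ((matches_state hp n).step (hp.iterate n)).2

/-- The positivity clause of `Delivers` at index 0 corresponds to `mode` replacing a packet that
left before time 0 by the empty system. -/
lemma delivers_iff (hp : p.conf.Good) (n : ℕ) : p.Delivers 0 n ↔ (Conf.next^[n] p.conf).Done := by
  have hm := matches_state hp n
  by_cases h0 : n = 0 → 0 < p.pkt₀.fin
  · have hs := samePacket_of_delivers hp h0
    unfold Delivers Conf.Done
    rw [hs.1, nextTime_eq hm.1, hs.2.1, add_le_add_iff_left]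
    constructor
    · rintro ⟨h1, h2, _⟩
      exact ⟨h1, h2⟩
    · rintro ⟨h1, h2⟩
      refine ⟨h1, h2, fun hn => ?_⟩
      rw [← hs.2.1]
      subst hn
      exact h0 rfl
  · push Not at h0
    obtain ⟨rfl, hf⟩ := h0
    constructor
    · intro h
      exact absurd (h.2.2 rfl) (not_lt.2 hf)
    · intro h
      have : p.conf.1.1 = 0 := h.1
      simp [conf, mode, hf] at this

/-- The generation time is recovered from the recorded total service time, because an accepted
packet starts service on arrival. -/
lemma delivered_data (hp : p.conf.Good) (hs : p.conf.Stops)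
    (hJ : ∀ i, (Conf.idle (renew^[i] p.conf.rest)).Stops) (i : ℕ) :
    p.deliveryTime 0 i = p.conf.epoch i ∧
      (p.delivered 0 i).gen = p.conf.epoch i - p.conf.epochService i := by
  have hfun : p.Delivers 0 = fun n => (Conf.next^[n] p.conf).Done :=
    funext fun n => propext (delivers_iff hp n)
  obtain ⟨h1, h2, h3, h4⟩ := Conf.delivery_data hs hJ i
  have hn : Nat.nth (p.Delivers 0) i = p.conf.deliveryIndex i := by
    rw [hfun]
    exact Conf.nth_done hs hJ i
  have hd := (delivers_iff hp (p.conf.deliveryIndex i)).2 h1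
  have hsame := samePacket_of_delivers hp (n := p.conf.deliveryIndex i) fun h0 => by
    have := hd.2.2 h0
    rw [h0] at this
    exact this
  have e1 : p.deliveryTime 0 i = p.conf.epoch i := by
    rw [deliveryTime, delivered, hn, hsame.2.1, h2]
  refine ⟨e1, ?_⟩
  have e2 := hsame.2.2
  rw [h3] at e2
  rw [← e1, deliveryTime, delivered, hn, e2]

end Path

end

section

/-! ### The law of the arrivals after time `0` -/

/-- The indices of the interarrival times and of the service times. -/
abbrev InputIndex := (Fin 2 × ℕ) ⊕ (Fin 2 × ℕ)

namespace Input

/-- The interarrival times and the service times of the arrivals. -/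
def flatten (J : Input) : InputIndex → ℝ
  | .inl (c, 0) => (stream c J).1
  | .inl (c, n + 1) => ((stream c J).2 n).2
  | .inr (c, n) => ((stream c J).2 n).1

/-- The arrivals with the given interarrival times and service times. -/
def unflatten (Z : InputIndex → ℝ) : Input :=
  ((Z (.inl (0, 0)), fun n => (Z (.inr (0, n)), Z (.inl (0, n + 1)))),
    (Z (.inl (1, 0)), fun n => (Z (.inr (1, n)), Z (.inl (1, n + 1)))))

lemma measurable_unflatten : Measurable unflatten := by unfold unflatten; fun_prop

lemma measurable_flatten : Measurable flatten := by
  rw [measurable_pi_iff]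
  rintro (⟨c, n⟩ | ⟨c, n⟩)
  · cases n with
    | zero => exact (Conf.measurable_stream c).fst
    | succ n => exact ((measurable_pi_apply n).comp (Conf.measurable_stream c).snd).snd
  · exact ((measurable_pi_apply n).comp (Conf.measurable_stream c).snd).fst

end Input

section Law

variable (lam : Fin 2 → ℝ) [hlam : ∀ c, Fact (0 < lam c)] (ν : Measure ℝ) [IsProbabilityMeasure ν]

/-- The laws of the interarrival times and of the service times. -/
def coordMeasure (k : InputIndex) : Measure ℝ :=
  k.elim (fun a => expMeasure (lam a.1)) (fun _ => ν)

instance (k : InputIndex) : IsProbabilityMeasure (coordMeasure lam ν k) := by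
  rcases k with ⟨c, n⟩ | ⟨c, n⟩
  · exact isProbabilityMeasure_expMeasure (hlam c).out
  · unfold coordMeasure
    simpa

lemma streamMeasure_box (l : ℝ) [Fact (0 < l)] (N : ℕ) (A B : ℕ → Set ℝ)
    (hA : ∀ n, MeasurableSet (A n)) (hB : ∀ n, MeasurableSet (B n)) :
    streamMeasure l ν (A 0 ×ˢ Set.pi (Finset.range N) fun n => B n ×ˢ A (n + 1)) =
      (∏ n ∈ Finset.range (N + 1), expMeasure l (A n)) * ∏ n ∈ Finset.range N, ν (B n) := by
  rw [streamMeasure, Measure.prod_prod, pairMeasure,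
    Measure.infinitePi_pi _ fun n _ => (hB n).prod (hA (n + 1))]
  simp only [Measure.prod_prod]
  rw [Finset.prod_mul_distrib, Finset.prod_range_succ' _ N]
  ring

/-- The nested product of streams is a rearrangement of one product over all interarrival and
service times; both are compared on boxes. -/
lemma map_flatten : (inputMeasure lam ν).map Input.flatten =
    Measure.infinitePi (coordMeasure lam ν) := by
  classical
  refine Measure.eq_infinitePi _ fun s t ht => ?_
  obtain ⟨N, hN⟩ : ∃ N : ℕ, ∀ k ∈ s, k.elim (fun a => a.2) (fun a => a.2) < N :=
    ⟨s.sup (fun k => k.elim (fun a => a.2) (fun a => a.2)) + 1, fun k hk =>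
      Nat.lt_succ_of_le (Finset.le_sup (f := fun k : InputIndex => k.elim (fun a => a.2) fun a => a.2) hk)⟩
  set t' : InputIndex → Set ℝ := fun k => if k ∈ s then t k else Set.univ with ht'
  have hms : ∀ k, MeasurableSet (t' k) := fun k => by
    by_cases h : k ∈ s <;> simp [ht', h, ht k]
  -- N services come with N + 1 interarrival times, because the first arrival time precedes all the
  -- pairs of a stream.
  set u : Finset InputIndex := (Finset.univ ×ˢ Finset.range (N + 1)).disjSum
    (Finset.univ ×ˢ Finset.range N) with hu
  have hsu : s ⊆ u := by
    rintro (⟨c, n⟩ | ⟨c, n⟩) hk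
    · have := hN _ hk
      simp only [Sum.elim_inl] at this
      simp [hu]
      omega
    · have := hN _ hk
      simp only [Sum.elim_inr] at this
      simp [hu, this]
  have e1 : Set.pi (↑s) t = Set.pi (↑u) t' := by
    ext f
    simp only [Set.mem_pi, Finset.mem_coe, ht']
    constructor
    · intro h n _
      by_cases hn : n ∈ s <;> simp [hn, h n]
    · intro h n hn
      simpa [hn] using h n (hsu hn)
  have e2 : ∏ i ∈ s, coordMeasure lam ν i (t i) = ∏ i ∈ u, coordMeasure lam ν i (t' i) := by
    rw [← Finset.prod_subset hsu]
    · exact Finset.prod_congr rfl fun n hn => by simp [ht', hn]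
    · intro n _ hn
      simp [ht', hn]
  have e3 : Input.flatten ⁻¹' (Set.pi (↑u) t') =
      (t' (.inl (0, 0)) ×ˢ Set.pi (Finset.range N) fun n => t' (.inr (0, n)) ×ˢ t' (.inl (0, n + 1))) ×ˢ
      (t' (.inl (1, 0)) ×ˢ Set.pi (Finset.range N) fun n => t' (.inr (1, n)) ×ˢ t' (.inl (1, n + 1))) := by
    ext J
    simp only [Set.mem_preimage, Set.mem_pi, Finset.mem_coe, hu, Finset.mem_disjSum, Finset.mem_product,
      Finset.mem_univ, true_and, Finset.mem_range, Set.mem_prod]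
    constructor
    · intro h
      refine ⟨⟨h (.inl (0, 0)) (Or.inl ⟨(0, 0), by simp, rfl⟩), fun n hn => ⟨?_, ?_⟩⟩,
        ⟨h (.inl (1, 0)) (Or.inl ⟨(1, 0), by simp, rfl⟩), fun n hn => ⟨?_, ?_⟩⟩⟩
      · exact h (.inr (0, n)) (Or.inr ⟨(0, n), by simpa using hn, rfl⟩)
      · exact h (.inl (0, n + 1)) (Or.inl ⟨(0, n + 1), by simpa using hn, rfl⟩)
      · exact h (.inr (1, n)) (Or.inr ⟨(1, n), by simpa using hn, rfl⟩)
      · exact h (.inl (1, n + 1)) (Or.inl ⟨(1, n + 1), by simpa using hn, rfl⟩)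
    · rintro ⟨⟨h00, h0⟩, ⟨h10, h1⟩⟩ k hk
      rcases hk with ⟨⟨c, n⟩, hn, rfl⟩ | ⟨⟨c, n⟩, hn, rfl⟩
      · simp only at hn
        rcases (by omega : c = 0 ∨ c = 1) with rfl | rfl
        · cases n with
          | zero => exact h00
          | succ n => exact (h0 n (by omega)).2
        · cases n with
          | zero => exact h10
          | succ n => exact (h1 n (by omega)).2
      · simp only at hn
        rcases (by omega : c = 0 ∨ c = 1) with rfl | rfl
        · exact (h0 n hn).1
        · exact (h1 n hn).1
  rw [e1, e2, Measure.map_apply Input.measurable_flatten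
    (MeasurableSet.pi (Finset.countable_toSet _) fun n _ => hms n), e3, inputMeasure,
    Measure.prod_prod,
    streamMeasure_box ν (lam 0) N (fun n => t' (.inl (0, n))) (fun n => t' (.inr (0, n)))
      (fun n => hms _) (fun n => hms _),
    streamMeasure_box ν (lam 1) N (fun n => t' (.inl (1, n))) (fun n => t' (.inr (1, n)))
      (fun n => hms _) (fun n => hms _), hu, Finset.prod_disjSum, Finset.prod_product,
    Finset.prod_product, Fin.prod_univ_two, Fin.prod_univ_two]
  simp only [coordMeasure, Sum.elim_inl, Sum.elim_inr]
  ring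

lemma map_unflatten : (Measure.infinitePi (coordMeasure lam ν)).map Input.unflatten =
    inputMeasure lam ν := by
  rw [← map_flatten, Measure.map_map Input.measurable_unflatten Input.measurable_flatten]
  have : Input.unflatten ∘ Input.flatten = id := rfl
  rw [this, Measure.map_id]

end Law

/-! ### The configuration at time `0` -/

/-- The packet in the server at time `0`. -/
def initMode (x : ℝ × Fin 2 × ℝ × ℝ) : Fin 2 × ℝ × ℝ :=
  if x.2.2.2 ≤ 0 then (1, 0, 0) else (x.2.1, x.2.2.2, x.2.2.2 - x.2.2.1)

/-- The configuration at time `0`. -/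
def initConf (w : (ℝ × Fin 2 × ℝ × ℝ) × Input) : Conf := (initMode w.1, 0, w.2)

lemma measurable_initMode : Measurable initMode :=
  Measurable.ite (measurableSet_le (by fun_prop) (by fun_prop)) (by fun_prop) (by fun_prop)

lemma measurable_initConf : Measurable initConf :=
  (measurable_initMode.comp measurable_fst).prodMk (by fun_prop)

lemma initMode_nonneg (x : ℝ × Fin 2 × ℝ × ℝ) : 0 ≤ (initMode x).2.1 := by
  unfold initMode
  split_ifs with h
  · exact le_rfl
  · exact (not_le.1 h).le

lemma conf_mkPath (i : ℝ × Fin 2 × ℝ × ℝ) (X S : Fin 2 → ℕ → ℝ) :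
    (mkPath i X S).conf = initConf (i, Input.unflatten fun k =>
      k.elim (fun a => X a.1 a.2) (fun a => S a.1 a.2)) := by
  refine Prod.ext ?_ rfl
  by_cases h : i.2.2.2 ≤ 0 <;> simp [Path.conf, Path.mode, initConf, initMode, mkPath, h]

variable {lam : Fin 2 → ℝ} [hlam : ∀ c, Fact (0 < lam c)] {ν : Measure ℝ} [IsProbabilityMeasure ν]

lemma ae_initConf (hν : ∀ᵐ s ∂ν, 0 ≤ s) (κ : Measure (ℝ × Fin 2 × ℝ × ℝ)) [IsProbabilityMeasure κ] :
    ∀ᵐ w ∂(κ.prod (inputMeasure lam ν)), (initConf w).Good ∧ (initConf w).Stops := by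
  have h1 : ∀ᵐ w ∂(κ.prod (inputMeasure lam ν)), (initConf w).Good := by
    have : ∀ᵐ w ∂(κ.prod (inputMeasure lam ν)), w.2.Good :=
      Measure.quasiMeasurePreserving_snd.ae (ae_good lam ν hν)
    filter_upwards [this] with w hw using ⟨initMode_nonneg _, le_rfl, hw⟩
  have h2 : ∀ᵐ w ∂(κ.prod (inputMeasure lam ν)), (initConf w).Stops := by
    have hm : MeasurableSet {w | (initConf w).Stops} := Conf.measurableSet_stops.preimage measurable_initConf
    rw [ae_iff]
    refine (Measure.measure_prod_null hm.compl).2 (Eventually.of_forall fun x => ?_)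
    have := Conf.ae_stops (lam := lam) hν (initMode x).1 (r := (initMode x).2.1) (y := 0) (initMode x).2.2
      (initMode_nonneg x) le_rfl
    exact ae_iff.1 this
  filter_upwards [h1, h2] with w h1 h2 using ⟨h1, h2⟩

/-- For each fixed initial state the future after the first delivery has law `inputMeasure lam ν`;
integrating over the initial state erases its influence. -/
lemma map_rest_initConf (hν : ∀ᵐ s ∂ν, 0 ≤ s) (κ : Measure (ℝ × Fin 2 × ℝ × ℝ))
    [IsProbabilityMeasure κ] :
    MeasurePreserving (fun w => (initConf w).rest) (κ.prod (inputMeasure lam ν))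
      (inputMeasure lam ν) := by
  have hm : Measurable fun w => (initConf w).rest := Conf.measurable_rest.comp measurable_initConf
  refine ⟨hm, ?_⟩
  ext B hB
  rw [Measure.map_apply hm hB, Measure.prod_apply (hm hB)]
  have : ∀ x, inputMeasure lam ν (Prod.mk x ⁻¹' ((fun w => (initConf w).rest) ⁻¹' B)) =
      inputMeasure lam ν B := by
    intro x
    have h := measurePreserving_rest (lam := lam) hν (initMode x).1 (r := (initMode x).2.1)
      (initMode x).2.2 (initMode_nonneg x)
    exact h.measure_preimage hB.nullMeasurableSet
  simp [this]

/-- Translates the independence assumptions into a product law for the initial state and the input.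
-/
lemma IsTwoSource.map_eq {Ω : Type*} [MeasurableSpace Ω] {P : Measure Ω} [IsProbabilityMeasure P]
    {init : Ω → ℝ × Fin 2 × ℝ × ℝ} {X S : Ω → Fin 2 → ℕ → ℝ} (h : IsTwoSource P lam ν init X S) :
    AEMeasurable (fun ω => (init ω, Input.unflatten fun k =>
      k.elim (fun a => X ω a.1 a.2) (fun a => S ω a.1 a.2))) P ∧
    P.map (fun ω => (init ω, Input.unflatten fun k =>
      k.elim (fun a => X ω a.1 a.2) (fun a => S ω a.1 a.2))) =
      (P.map init).prod (inputMeasure lam ν) := by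
  set Z : Ω → InputIndex → ℝ := fun ω k => k.elim (fun a => X ω a.1 a.2) (fun a => S ω a.1 a.2) with hZ
  have hl : ∀ k, HasLaw (fun ω => Z ω k) (coordMeasure lam ν k) P := by
    rintro (⟨c, n⟩ | ⟨c, n⟩)
    · exact h.law_interarrival c n
    · exact h.law_service c n
  have hZm : AEMeasurable Z P := aemeasurable_pi_iff.2 fun k => (hl k).aemeasurable
  have hlaw := h.indep.hasLaw_infinitePi hl hZm
  have hU : AEMeasurable (fun ω => Input.unflatten (Z ω)) P :=
    Input.measurable_unflatten.comp_aemeasurable hZm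
  refine ⟨h.aemeasurable_init.prodMk hU, ?_⟩
  have hind : IndepFun init (fun ω => Input.unflatten (Z ω)) P :=
    h.indep_init.comp measurable_id Input.measurable_unflatten
  rw [(indepFun_iff_map_prod_eq_prod_map_map h.aemeasurable_init hU).1 hind]
  congr 1
  rw [← map_unflatten, ← hlaw.map_eq,
    AEMeasurable.map_map_of_aemeasurable Input.measurable_unflatten.aemeasurable hZm]
  rfl

end

/-! ### Renewal-reward on a single sample path -/

section

namespace Path

/-- A sample path on which source 1 delivers infinitely many packets. -/
structure Regular (p : Path) : Prop where
  nonneg : 0 ≤ p.deliveryTime 0 0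
  mono : Monotone (p.deliveryTime 0)
  tendsto : Tendsto (p.deliveryTime 0) atTop atTop
  systemTime_nonneg : ∀ i, 0 ≤ p.systemTime (i + 1)

namespace Regular

variable {p : Path} (hp : p.Regular)
include hp

lemma lastIndex_eq {i : ℕ} {t : ℝ} (h1 : p.deliveryTime 0 i ≤ t) (h2 : t < p.deliveryTime 0 (i + 1)) :
    p.lastIndex 0 t = i := by
  have : {j | p.deliveryTime 0 j ≤ t} = Set.Iic i := by
    ext j
    simp only [Set.mem_ofPred_eq, Set.mem_Iic]
    constructor
    · intro hj
      by_contra hlt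
      exact absurd (hp.mono (Nat.succ_le_of_lt (not_le.1 hlt))) (not_le.2 (hj.trans_lt h2))
    · intro hj
      exact (hp.mono hj).trans h1
  rw [lastIndex, this, csSup_Iic]

lemma exists_mem {t : ℝ} (h : p.deliveryTime 0 0 ≤ t) :
    p.deliveryTime 0 (p.lastIndex 0 t) ≤ t ∧ t < p.deliveryTime 0 (p.lastIndex 0 t + 1) := by
  classical
  have hex : ∃ n, t < p.deliveryTime 0 n := (hp.tendsto.eventually_gt_atTop t).exists
  have h1 := Nat.find_spec hex
  obtain ⟨i, hi⟩ : ∃ i, Nat.find hex = i + 1 := by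
    refine Nat.exists_eq_succ_of_ne_zero fun h0 => ?_
    rw [h0] at h1
    linarith
  have h2 : p.deliveryTime 0 i ≤ t := not_lt.1 (Nat.find_min hex (by omega))
  rw [hi] at h1
  rw [hp.lastIndex_eq h2 h1]
  exact ⟨h2, h1⟩

lemma tendsto_lastIndex : Tendsto (p.lastIndex 0) atTop atTop := by
  refine tendsto_atTop.2 fun k => ?_
  filter_upwards [eventually_ge_atTop (p.deliveryTime 0 k)] with t ht
  by_contra hlt
  have h0 : p.deliveryTime 0 0 ≤ t := (hp.mono (Nat.zero_le k)).trans ht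
  have h1 := (hp.exists_mem h0).2
  have h2 := hp.mono (Nat.succ_le_of_lt (not_le.1 hlt))
  simp only [Nat.succ_eq_add_one] at h2
  linarith

lemma age_of_lt {t : ℝ} (h : t < p.deliveryTime 0 0) : p.age t = t - p.stamp₀ := by
  have : ¬ ∃ i, p.deliveryTime 0 i ≤ t := by
    rintro ⟨i, hi⟩
    have := hp.mono (Nat.zero_le i)
    linarith
  rw [age, stamp, if_neg this]

lemma age_of_mem {i : ℕ} {t : ℝ} (h1 : p.deliveryTime 0 i ≤ t) (h2 : t < p.deliveryTime 0 (i + 1)) :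
    p.age t = t + (p.systemTime i - p.deliveryTime 0 i) := by
  rw [age, stamp, if_pos ⟨i, h1⟩, hp.lastIndex_eq h1 h2, systemTime]
  ring

/-- Before the second delivery the age depends on the arbitrary initial data and may be negative, so
sign arguments start at `p.deliveryTime 0 1`. -/
lemma age_nonneg {t : ℝ} (h : p.deliveryTime 0 1 ≤ t) : 0 ≤ p.age t := by
  have h0 := (hp.mono zero_le_one).trans h
  obtain ⟨h1, h2⟩ := hp.exists_mem h0
  rw [hp.age_of_mem h1 h2]
  have hpos : p.lastIndex 0 t ≠ 0 := fun h3 => by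
    rw [h3] at h2
    simp only [zero_add] at h2
    linarith
  obtain ⟨i, hi⟩ := Nat.exists_eq_succ_of_ne_zero hpos
  have := hp.systemTime_nonneg i
  rw [hi] at h1 ⊢
  simp only [Nat.succ_eq_add_one] at *
  linarith

variable {φ : ℝ → ℝ} (hφ : Continuous φ)
include hφ

/-- Between deliveries the age is a translate of time. Only the right endpoint, a null set, can
violate this, since the age drops there. -/
lemma intervalIntegral_age {i : ℕ} {x y : ℝ} (hx : p.deliveryTime 0 i ≤ x) (hxy : x ≤ y)
    (hy : y ≤ p.deliveryTime 0 (i + 1)) :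
    IntervalIntegrable (fun t => φ (p.age t)) volume x y ∧ ∫ t in x..y, φ (p.age t) =
      ∫ t in x + (p.systemTime i - p.deliveryTime 0 i)..y + (p.systemTime i - p.deliveryTime 0 i),
        φ t := by
  set a := p.systemTime i - p.deliveryTime 0 i
  have hae : ∀ᵐ t ∂(volume : Measure ℝ), t ∈ Set.uIoc x y → φ (t + a) = φ (p.age t) := by
    have : ∀ᵐ t ∂(volume : Measure ℝ), t ≠ y := by simp [ae_iff]
    filter_upwards [this] with t ht hmem
    rw [Set.uIoc_of_le hxy] at hmem
    rw [hp.age_of_mem (hx.trans hmem.1.le) ((lt_of_le_of_ne hmem.2 ht).trans_le hy)]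
  have hint : IntervalIntegrable (fun t => φ (t + a)) volume x y :=
    (hφ.comp (continuous_id.add continuous_const)).intervalIntegrable _ _
  refine ⟨hint.congr_ae ((ae_restrict_iff' measurableSet_uIoc).2 hae), ?_⟩
  rw [← intervalIntegral.integral_congr_ae hae, intervalIntegral.integral_comp_add_right]

lemma intervalIntegrable_start {y : ℝ} (hy : y ≤ p.deliveryTime 0 0) (h0 : 0 ≤ y) :
    IntervalIntegrable (fun t => φ (p.age t)) volume 0 y := by
  have hae : ∀ᵐ t ∂(volume : Measure ℝ), t ∈ Set.uIoc 0 y → φ (t - p.stamp₀) = φ (p.age t) := by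
    have : ∀ᵐ t ∂(volume : Measure ℝ), t ≠ y := by simp [ae_iff]
    filter_upwards [this] with t ht hmem
    rw [Set.uIoc_of_le h0] at hmem
    rw [hp.age_of_lt ((lt_of_le_of_ne hmem.2 ht).trans_le hy)]
  have hint : IntervalIntegrable (fun t => φ (t - p.stamp₀)) volume 0 y :=
    (hφ.comp (continuous_id.sub continuous_const)).intervalIntegrable _ _
  exact hint.congr_ae ((ae_restrict_iff' measurableSet_uIoc).2 hae)

lemma intervalIntegrable_deliveryTime (n : ℕ) :
    IntervalIntegrable (fun t => φ (p.age t)) volume 0 (p.deliveryTime 0 n) := by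
  induction n with
  | zero => exact hp.intervalIntegrable_start hφ le_rfl hp.nonneg
  | succ n ih => exact ih.trans (hp.intervalIntegral_age hφ le_rfl (hp.mono (Nat.le_succ n)) le_rfl).1

lemma intervalIntegrable_age {τ : ℝ} (hτ : 0 ≤ τ) :
    IntervalIntegrable (fun t => φ (p.age t)) volume 0 τ := by
  by_cases h : p.deliveryTime 0 0 ≤ τ
  · obtain ⟨h1, h2⟩ := hp.exists_mem h
    exact (hp.intervalIntegrable_deliveryTime hφ _).trans (hp.intervalIntegral_age hφ le_rfl h1 h2.le).1
  · exact hp.intervalIntegrable_start hφ (not_le.1 h).le hτ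

/-- The reward of a period between two deliveries. -/
lemma integral_deliveryTime (n : ℕ) :
    ∫ t in p.deliveryTime 0 1..p.deliveryTime 0 (n + 1), φ (p.age t) =
      ∑ i ∈ Finset.range n, ∫ t in p.systemTime (i + 1)..p.systemTime (i + 1) + p.interdeparture (i + 1),
        φ t := by
  induction n with
  | zero => simp
  | succ n ih =>
    have h1 := hp.intervalIntegrable_deliveryTime hφ 1
    have h2 := hp.intervalIntegrable_deliveryTime hφ (n + 1)
    obtain ⟨h3, h4⟩ := hp.intervalIntegral_age hφ (i := n + 1) le_rfl (hp.mono (Nat.le_succ _)) le_rfl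
    rw [Finset.sum_range_succ, ← ih, ← intervalIntegral.integral_add_adjacent_intervals
      (h1.symm.trans h2) h3, h4]
    congr 2
    · ring
    · rw [interdeparture]; ring

/-- The renewal-reward theorem on a sample path. -/
lemma tendsto_average (hφ0 : ∀ x, 0 ≤ x → 0 ≤ φ x) {v M : ℝ} (hM : 0 < M)
    (hd : Tendsto (fun n : ℕ => p.deliveryTime 0 n / n) atTop (𝓝 M))
    (hR : Tendsto (fun n : ℕ => (∑ i ∈ Finset.range n,
      ∫ t in p.systemTime (i + 1)..p.systemTime (i + 1) + p.interdeparture (i + 1), φ t) / n)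
      atTop (𝓝 v)) :
    Tendsto (fun τ : ℝ => (1 / τ) * ∫ t in (0 : ℝ)..τ, φ (p.age t)) atTop (𝓝 (v / M)) := by
  set S : ℕ → ℝ := fun n => ∑ i ∈ Finset.range n,
      ∫ t in p.systemTime (i + 1)..p.systemTime (i + 1) + p.interdeparture (i + 1), φ t with hS
  set d := p.deliveryTime 0 with hdef
  have hd1 : 0 ≤ d 1 := hp.nonneg.trans (hp.mono zero_le_one)
  have hint : ∀ {x y : ℝ}, 0 ≤ x → 0 ≤ y → IntervalIntegrable (fun t => φ (p.age t)) volume x y :=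
    fun hx hy => (hp.intervalIntegrable_age hφ hx).symm.trans (hp.intervalIntegrable_age hφ hy)
  -- Nonnegativity of the integrand makes the accumulated reward monotone, which permits the
  -- sandwich between consecutive deliveries.
  have hmono : ∀ {x y : ℝ}, d 1 ≤ x → x ≤ y → ∫ t in d 1..x, φ (p.age t) ≤ ∫ t in d 1..y, φ (p.age t) := by
    intro x y hx hxy
    rw [← intervalIntegral.integral_add_adjacent_intervals (hint hd1 (hd1.trans hx))
      (hint (hd1.trans hx) (hd1.trans (hx.trans hxy)))]
    refine le_add_of_nonneg_right (intervalIntegral.integral_nonneg hxy fun t ht => ?_)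
    exact hφ0 _ (hp.age_nonneg (hx.trans ht.1))
  have hSint : ∀ n, ∫ t in d 1..d (n + 1), φ (p.age t) = S n := hp.integral_deliveryTime hφ
  have hS0 : ∀ n, 0 ≤ S n := fun n => by
    have := hmono le_rfl (hp.mono (by omega : 1 ≤ n + 1))
    rw [intervalIntegral.integral_same, ← hdef, hSint n] at this
    exact this
  have hratio : Tendsto (fun n : ℕ => (n : ℝ) / ((n : ℝ) + 2)) atTop (𝓝 1) :=
    tendsto_natCast_div_add_atTop 2
  -- With N the last delivery before τ, the reward collected from `d 1` up to `d N` is `S (N - 1)`,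
  -- and τ is at most `d (N + 1)`; the index shifts are harmless because n / (n + 2) tends to 1.
  have hlow : Tendsto (fun m : ℕ => S (m - 1) / d (m + 1)) atTop (𝓝 (v / M)) := by
    rw [← tendsto_add_atTop_iff_nat 1]
    have h1 : Tendsto (fun n : ℕ => S n / ((n : ℝ) + 2)) atTop (𝓝 v) := by
      have := hR.mul hratio
      rw [mul_one] at this
      refine this.congr' ?_
      filter_upwards [eventually_gt_atTop 0] with n hn
      have : (n : ℝ) ≠ 0 := by positivity
      field_simp
      rfl
    have h2 : Tendsto (fun n : ℕ => d (n + 2) / ((n : ℝ) + 2)) atTop (𝓝 M) := by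
      have := (tendsto_add_atTop_iff_nat 2).2 hd
      refine this.congr fun n => ?_
      push_cast
      rfl
    refine (h1.div h2 hM.ne').congr fun n => ?_
    have : (n : ℝ) + 2 ≠ 0 := by positivity
    simp only [Nat.add_sub_cancel, Pi.div_apply]
    rw [div_div_div_cancel_right₀ this]
  have hup : Tendsto (fun m : ℕ => S m / d m) atTop (𝓝 (v / M)) := by
    refine (hR.div hd hM.ne').congr' ?_
    filter_upwards [eventually_gt_atTop 0] with n hn
    have : (n : ℝ) ≠ 0 := by positivity
    simp only [Pi.div_apply]
    rw [div_div_div_cancel_right₀ this]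
  have hG : Tendsto (fun τ : ℝ => (1 / τ) * ∫ t in d 1..τ, φ (p.age t)) atTop (𝓝 (v / M)) := by
    refine tendsto_of_tendsto_of_tendsto_of_le_of_le' (hlow.comp hp.tendsto_lastIndex)
      (hup.comp hp.tendsto_lastIndex) ?_ ?_
    · filter_upwards [eventually_ge_atTop (d 1), eventually_gt_atTop 0] with τ h1 hτ0
      obtain ⟨h2, h3⟩ := hp.exists_mem ((hp.mono zero_le_one).trans h1)
      simp only [Function.comp_apply]
      set N := p.lastIndex 0 τ
      have hN : 1 ≤ N := by
        by_contra hlt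
        have : N = 0 := by omega
        rw [this, zero_add] at h3
        linarith
      have e : S (N - 1) = ∫ t in d 1..d N, φ (p.age t) := by
        rw [← hSint, Nat.sub_add_cancel hN]
      rw [one_div_mul_eq_div]
      have hle : S (N - 1) ≤ ∫ t in d 1..τ, φ (p.age t) := by
        rw [e]
        exact hmono (hp.mono hN) h2
      exact div_le_div₀ ((hS0 _).trans hle) hle hτ0 h3.le
    · have hpos : ∀ᶠ τ in atTop, 0 < d (p.lastIndex 0 τ) :=
        (hp.tendsto.comp hp.tendsto_lastIndex).eventually_gt_atTop 0
      filter_upwards [eventually_ge_atTop (d 1), hpos] with τ h1 hpos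
      obtain ⟨h2, h3⟩ := hp.exists_mem ((hp.mono zero_le_one).trans h1)
      simp only [Function.comp_apply]
      set N := p.lastIndex 0 τ
      rw [one_div_mul_eq_div]
      have hle : ∫ t in d 1..τ, φ (p.age t) ≤ S N := by
        rw [← hSint]
        exact hmono h1 h3.le
      exact div_le_div₀ (hS0 _) hle hpos h2
  -- The piece before `d 1`, which carries the initial state, is a fixed finite number and
  -- disappears in the average.
  have h0 : Tendsto (fun τ : ℝ => (1 / τ) * ∫ t in (0 : ℝ)..d 1, φ (p.age t)) atTop (𝓝 0) := by
    have : Tendsto (fun τ : ℝ => 1 / τ) atTop (𝓝 0) := by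
      simp only [one_div]
      exact tendsto_inv_atTop_zero
    simpa using this.mul_const (∫ t in (0 : ℝ)..d 1, φ (p.age t))
  have hsum := h0.add hG
  rw [zero_add] at hsum
  refine hsum.congr' ?_
  filter_upwards [eventually_ge_atTop 0] with τ hτ
  rw [← mul_add, intervalIntegral.integral_add_adjacent_intervals (hint le_rfl hd1) (hint hd1 hτ)]

end Regular

end Path

end

section

variable {lam : Fin 2 → ℝ} [hlam : ∀ c, Fact (0 < lam c)] {ν : Measure ℝ} [IsProbabilityMeasure ν]

/-! ### The reward of a cycle -/

/-- The integral of `φ` over the ages in a period between two deliveries, for the data of the cycle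
that ends with the first delivery and of the cycle that ends with the second one. -/
def ageReward (φ : ℝ → ℝ) (x : (ℝ × ℝ) × ℝ × ℝ) : ℝ := ∫ t in x.1.2..x.1.2 + x.2.1, φ t

/-- The mean reward of a cycle. -/
def meanAgeReward (lam : Fin 2 → ℝ) (ν : Measure ℝ) (φ : ℝ → ℝ) : ℝ :=
  ∫ J, ageReward φ (cycle J, cycle (renew J)) ∂(inputMeasure lam ν)

section AgeReward

variable {φ : ℝ → ℝ}

lemma measurable_ageReward (hφ : Continuous φ) : Measurable (ageReward φ) := by
  have hi : ∀ a b : ℝ, IntervalIntegrable φ volume a b := fun a b => hφ.intervalIntegrable a b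
  have hc : Continuous fun b => ∫ t in (0 : ℝ)..b, φ t := intervalIntegral.continuous_primitive hi 0
  have e : ageReward φ = fun x => (∫ t in (0 : ℝ)..x.1.2 + x.2.1, φ t) - ∫ t in (0 : ℝ)..x.1.2, φ t := by
    funext x
    rw [ageReward, intervalIntegral.integral_interval_sub_left (hi _ _) (hi _ _)]
  rw [e]
  exact ((hc.comp (by fun_prop)).sub (hc.comp (by fun_prop))).measurable

lemma ageReward_id (x : (ℝ × ℝ) × ℝ × ℝ) : ageReward id x = x.1.2 * x.2.1 + x.2.1 ^ 2 / 2 := by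
  simp only [ageReward, id, integral_id]
  ring

/-- The identity is the integrable majorant for all truncations of the age. -/
lemma abs_ageReward_le (hφ : Continuous φ) (hφ1 : ∀ x, |φ x| ≤ |x|) {x : (ℝ × ℝ) × ℝ × ℝ} (h1 : 0 ≤ x.1.2)
    (h2 : 0 ≤ x.2.1) : |ageReward φ x| ≤ ageReward id x := by
  have h : x.1.2 ≤ x.1.2 + x.2.1 := le_add_of_nonneg_right h2
  refine (intervalIntegral.abs_integral_le_integral_abs h).trans ?_
  refine intervalIntegral.integral_mono_on h (hφ.abs.intervalIntegrable _ _)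
    (continuous_id.intervalIntegrable _ _) fun t ht => ?_
  exact (hφ1 t).trans (abs_of_nonneg (h1.trans ht.1)).le

end AgeReward

lemma ae_cycle_nonneg (hν : ∀ᵐ s ∂ν, 0 ≤ s) :
    ∀ᵐ J ∂(inputMeasure lam ν), 0 ≤ (cycle J).1 ∧ 0 ≤ (cycle J).2 := by
  filter_upwards [Conf.ae_deliveryTime_idle_nonneg hν, Conf.ae_service_idle_nonneg hν] with J h1 h2
    using ⟨h1, h2⟩

lemma ae_cycle_renew_nonneg (hν : ∀ᵐ s ∂ν, 0 ≤ s) :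
    ∀ᵐ J ∂(inputMeasure lam ν), 0 ≤ (cycle J).2 ∧ 0 ≤ (cycle (renew J)).1 := by
  filter_upwards [ae_cycle_nonneg hν,
    (isRenewal_cycle hν).measurePreserving.quasiMeasurePreserving.ae (ae_cycle_nonneg hν)] with J h1 h2
    using ⟨h1.2, h2.1⟩

/-- The trapezoid T Y + Y² / 2: the service time comes from the first cycle and the length from the
second, so the mean of T Y factors. -/
lemma integral_ageReward_id (hν : ∀ᵐ s ∂ν, 0 ≤ s) :
    Integrable (fun J => ageReward id (cycle J, cycle (renew J))) (inputMeasure lam ν) ∧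
      meanAgeReward lam ν id = serviceMean lam ν * cycleMean lam ν + cycleSecondMoment lam ν / 2 := by
  have hR := isRenewal_cycle (lam := lam) hν
  obtain ⟨i1, i2, e1, e2⟩ := Conf.integral_deliveryTime_idle (lam := lam) hν
  obtain ⟨i3, e3⟩ := Conf.integral_service_idle (lam := lam) hν
  have hpr := hR.measurePreserving
  have hind : IndepFun (fun J => (cycle J).2) (fun J => (cycle (renew J)).1) (inputMeasure lam ν) :=
    hR.indepFun.comp (φ := Prod.snd) (ψ := fun J => (cycle J).1) measurable_snd measurable_cycle.fst
  have j1 : Integrable (fun J => (cycle (renew J)).1) (inputMeasure lam ν) := hpr.integrable_comp_of_integrable i1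
  have j2 : Integrable (fun J => (cycle (renew J)).1 ^ 2) (inputMeasure lam ν) :=
    hpr.integrable_comp_of_integrable (g := fun J => (cycle J).1 ^ 2) i2
  have j3 : Integrable (fun J => (cycle J).2) (inputMeasure lam ν) := i3
  have hcm : ∀ f : Input → ℝ, Measurable f → ∫ J, f (renew J) ∂(inputMeasure lam ν) =
      ∫ J, f J ∂(inputMeasure lam ν) := fun f hf => by
    rw [← integral_map hR.meas_θ.aemeasurable hf.aestronglyMeasurable, hpr.map_eq]
  have f1 : ∫ J, (cycle (renew J)).1 ∂(inputMeasure lam ν) = cycleMean lam ν :=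
    (hcm _ measurable_cycle.fst).trans e1
  have f2 : ∫ J, (cycle (renew J)).1 ^ 2 ∂(inputMeasure lam ν) = cycleSecondMoment lam ν :=
    (hcm (fun J => (cycle J).1 ^ 2) (measurable_cycle.fst.pow_const 2)).trans e2
  have f3 : ∫ J, (cycle J).2 ∂(inputMeasure lam ν) = serviceMean lam ν := e3
  have jm : Integrable (fun J => (cycle J).2 * (cycle (renew J)).1) (inputMeasure lam ν) :=
    hind.integrable_mul j3 j1
  have fm : ∫ J, (cycle J).2 * (cycle (renew J)).1 ∂(inputMeasure lam ν) =
      serviceMean lam ν * cycleMean lam ν := by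
    rw [hind.integral_fun_mul_eq_mul_integral j3.1 j1.1, f1, f3]
  simp only [meanAgeReward, ageReward_id]
  refine ⟨jm.add (j2.div_const 2), ?_⟩
  rw [integral_add jm (j2.div_const 2), fm, integral_div, f2]

lemma meanAgeReward_id_div (hν : ∀ᵐ s ∂ν, 0 ≤ s) :
    meanAgeReward lam ν id / cycleMean lam ν =
      ageValue (lam 0) (lam 1) (L ν (lam 0)) (L ν (lam 1)) (L' ν (lam 0)) (L' ν (lam 1)) := by
  have hM := (cycleMean_pos (lam := lam) hν).ne'
  rw [(integral_ageReward_id hν).2, cycleSecondMoment]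
  field_simp
  ring

lemma integrable_ageReward (hν : ∀ᵐ s ∂ν, 0 ≤ s) {φ : ℝ → ℝ} (hφ : Continuous φ) (hφ1 : ∀ x, |φ x| ≤ |x|) :
    Integrable (fun J => ageReward φ (cycle J, cycle (renew J))) (inputMeasure lam ν) := by
  refine (integral_ageReward_id hν).1.mono' ((measurable_ageReward hφ).comp
    (measurable_cycle.prodMk (measurable_cycle.comp measurable_renew))).aestronglyMeasurable ?_
  filter_upwards [ae_cycle_renew_nonneg hν] with J hJ
  exact abs_ageReward_le hφ hφ1 hJ.1 hJ.2

lemma meanAgeReward_le (hν : ∀ᵐ s ∂ν, 0 ≤ s) {φ : ℝ → ℝ} (hφ : Continuous φ) (hφ1 : ∀ x, |φ x| ≤ |x|) :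
    meanAgeReward lam ν φ ≤ meanAgeReward lam ν id := by
  refine integral_mono_ae (integrable_ageReward hν hφ hφ1) (integral_ageReward_id hν).1 ?_
  filter_upwards [ae_cycle_renew_nonneg hν] with J hJ
  exact (le_abs_self _).trans (abs_ageReward_le hφ hφ1 hJ.1 hJ.2)

lemma tendsto_meanAgeReward (hν : ∀ᵐ s ∂ν, 0 ≤ s) {φ : ℕ → ℝ → ℝ} (hφ : ∀ K, Continuous (φ K))
    (hφ1 : ∀ K x, |φ K x| ≤ |x|) (hlim : ∀ x, Tendsto (fun K => φ K x) atTop (𝓝 x)) :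
    Tendsto (fun K => meanAgeReward lam ν (φ K)) atTop (𝓝 (meanAgeReward lam ν id)) := by
  refine tendsto_integral_of_dominated_convergence _
    (fun K => (integrable_ageReward hν (hφ K) (hφ1 K)).1) (integral_ageReward_id hν).1 (fun K => ?_) ?_
  · filter_upwards [ae_cycle_renew_nonneg hν] with J hJ
    exact abs_ageReward_le (hφ K) (hφ1 K) hJ.1 hJ.2
  · refine Eventually.of_forall fun J => ?_
    exact intervalIntegral.tendsto_integral_filter_of_dominated_convergence (fun t => |t|)
      (Eventually.of_forall fun K => (hφ K).aestronglyMeasurable)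
      (Eventually.of_forall fun K => Eventually.of_forall fun t _ => hφ1 K t)
      (continuous_abs.intervalIntegrable _ _) (Eventually.of_forall fun t _ => hlim t)

/-! ### Sample paths -/

/-- The future after a renewal sequence of cycles that all end. -/
def Input.Recurrent (J : Input) : Prop :=
  ∀ i, (Conf.idle (renew^[i] J)).Stops ∧ 0 ≤ (cycle (renew^[i] J)).1 ∧ 0 ≤ (cycle (renew^[i] J)).2

lemma ae_recurrent (hν : ∀ᵐ s ∂ν, 0 ≤ s) : ∀ᵐ J ∂(inputMeasure lam ν), J.Recurrent := by
  have h : ∀ᵐ J ∂(inputMeasure lam ν), (Conf.idle J).Stops ∧ 0 ≤ (cycle J).1 ∧ 0 ≤ (cycle J).2 := by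
    filter_upwards [Conf.ae_stops (lam := lam) hν 1 0 le_rfl le_rfl, ae_cycle_nonneg hν] with J h1 h2
      using ⟨h1, h2⟩
  exact ae_all_iff.2 fun i =>
    ((isRenewal_cycle hν).measurePreserving.iterate i).quasiMeasurePreserving.ae h

lemma ae_tendsto_cycle_fst (hν : ∀ᵐ s ∂ν, 0 ≤ s) : ∀ᵐ J ∂(inputMeasure lam ν),
    Tendsto (fun n : ℕ => (∑ i ∈ Finset.range n, (cycle (renew^[i] J)).1) / n) atTop
      (𝓝 (cycleMean lam ν)) := by
  obtain ⟨i1, -, e1, -⟩ := Conf.integral_deliveryTime_idle (lam := lam) hν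
  have := (isRenewal_cycle (lam := lam) hν).strong_law (f := Prod.fst) measurable_fst i1
  rwa [← e1]

lemma ae_tendsto_cycle_snd (hν : ∀ᵐ s ∂ν, 0 ≤ s) : ∀ᵐ J ∂(inputMeasure lam ν),
    Tendsto (fun n : ℕ => (∑ i ∈ Finset.range n, (cycle (renew^[i] J)).2) / n) atTop
      (𝓝 (serviceMean lam ν)) := by
  obtain ⟨i1, e1⟩ := Conf.integral_service_idle (lam := lam) hν
  have := (isRenewal_cycle (lam := lam) hν).strong_law (f := Prod.snd) measurable_snd i1
  rwa [← e1]

lemma ae_tendsto_ageReward (hν : ∀ᵐ s ∂ν, 0 ≤ s) {φ : ℝ → ℝ} (hφ : Continuous φ) (hφ1 : ∀ x, |φ x| ≤ |x|) :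
    ∀ᵐ J ∂(inputMeasure lam ν), Tendsto (fun n : ℕ => (∑ i ∈ Finset.range n,
      ageReward φ (cycle (renew^[i] J), cycle (renew^[i + 1] J))) / n) atTop
      (𝓝 (meanAgeReward lam ν φ)) :=
  (isRenewal_cycle (lam := lam) hν).strong_law_pair (measurable_ageReward hφ) (integrable_ageReward hν hφ hφ1)

/-- One extra initial term does not change the averages; it absorbs the system time of the first
delivered packet, which may stem from the initial state. -/
lemma tendsto_average_cons {a b : ℕ → ℝ} (hab : ∀ i, b (i + 1) = a i) {v : ℝ}
    (ha : Tendsto (fun n : ℕ => (∑ i ∈ Finset.range n, a i) / n) atTop (𝓝 v)) :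
    Tendsto (fun n : ℕ => (∑ i ∈ Finset.range n, b i) / n) atTop (𝓝 v) := by
  rw [← tendsto_add_atTop_iff_nat 1]
  have h1 : Tendsto (fun n : ℕ => b 0 / ((n + 1 : ℕ) : ℝ)) atTop (𝓝 0) :=
    (tendsto_const_div_atTop_nhds_zero_nat (b 0)).comp (tendsto_add_atTop_nat 1)
  have h2 : Tendsto (fun n : ℕ => (n : ℝ) / (n + 1)) atTop (𝓝 1) := tendsto_natCast_div_add_atTop 1
  have h := (ha.mul h2).add h1
  rw [mul_one, add_zero] at h
  refine h.congr fun n => ?_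
  rw [Finset.sum_range_succ', Finset.sum_congr rfl fun i _ => hab i]
  rcases Nat.eq_zero_or_pos n with rfl | hn
  · simp
  · push_cast
    field_simp

namespace Conf

lemma epoch_eq (s : Conf) (n : ℕ) :
    s.epoch n = s.deliveryTime + ∑ i ∈ Finset.range n, (cycle (renew^[i] s.rest)).1 := by
  induction n with
  | zero => simp [epoch]
  | succ n ih => rw [epoch, ih, Finset.sum_range_succ, add_assoc]

end Conf

namespace Path

/-- A sample path on which every cycle ends and the cycles have mean length `M`. -/
structure Typical (p : Path) (M : ℝ) : Prop where
  good : p.conf.Good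
  stops : p.conf.Stops
  recurrent : p.conf.rest.Recurrent
  tendsto : Tendsto (fun n : ℕ => (∑ i ∈ Finset.range n, (cycle (renew^[i] p.conf.rest)).1) / n) atTop (𝓝 M)

namespace Typical

variable {p : Path} {M : ℝ} (hp : p.Typical M)
include hp

lemma deliveryTime_eq (i : ℕ) : p.deliveryTime 0 i = p.conf.epoch i :=
  (delivered_data hp.good hp.stops (fun i => (hp.recurrent i).1) i).1

lemma interdeparture_eq (i : ℕ) : p.interdeparture i = (cycle (renew^[i] p.conf.rest)).1 := by
  rw [interdeparture, hp.deliveryTime_eq, hp.deliveryTime_eq, Conf.epoch]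
  ring

lemma systemTime_eq (i : ℕ) : p.systemTime (i + 1) = (cycle (renew^[i] p.conf.rest)).2 := by
  rw [systemTime, hp.deliveryTime_eq,
    (delivered_data hp.good hp.stops (fun i => (hp.recurrent i).1) (i + 1)).2]
  simp [Conf.epochService]

lemma tendsto_deliveryTime : Tendsto (fun n : ℕ => p.deliveryTime 0 n / n) atTop (𝓝 M) := by
  have h := (tendsto_const_div_atTop_nhds_zero_nat p.conf.deliveryTime).add hp.tendsto
  rw [zero_add] at h
  refine h.congr fun n => ?_
  rw [hp.deliveryTime_eq, Conf.epoch_eq, add_div]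

lemma regular (hM : 0 < M) : p.Regular where
  nonneg := by
    rw [hp.deliveryTime_eq]
    exact hp.good.clock_le_deliveryTime (n := 0) (zero_le)
  mono := monotone_nat_of_le_succ fun n => by
    have h := (hp.recurrent n).2.1
    rw [hp.deliveryTime_eq, hp.deliveryTime_eq, Conf.epoch]
    linarith
  tendsto := by
    have h := hp.tendsto_deliveryTime.pos_mul_atTop hM tendsto_natCast_atTop_atTop
    refine h.congr' ?_
    filter_upwards [eventually_gt_atTop 0] with n hn
    field_simp
  systemTime_nonneg i := by
    rw [hp.systemTime_eq]
    exact (hp.recurrent i).2.2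

lemma tendsto_average_age (hM : 0 < M) {φ : ℝ → ℝ} (hφ : Continuous φ) (hφ0 : ∀ x, 0 ≤ x → 0 ≤ φ x) {v : ℝ}
    (hv : Tendsto (fun n : ℕ => (∑ i ∈ Finset.range n, ageReward φ (cycle (renew^[i] p.conf.rest),
      cycle (renew^[i + 1] p.conf.rest))) / n) atTop (𝓝 v)) :
    Tendsto (fun τ : ℝ => (1 / τ) * ∫ t in (0 : ℝ)..τ, φ (p.age t)) atTop (𝓝 (v / M)) := by
  refine (hp.regular hM).tendsto_average hφ hφ0 hM hp.tendsto_deliveryTime (hv.congr fun n => ?_)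
  congr 1
  refine Finset.sum_congr rfl fun i _ => ?_
  rw [hp.systemTime_eq, hp.interdeparture_eq, ageReward]

lemma peakAge_eq (i : ℕ) : p.peakAge (i + 1) =
    (cycle (renew^[i + 1] p.conf.rest)).1 + (cycle (renew^[i] p.conf.rest)).2 := by
  rw [peakAge, hp.systemTime_eq, hp.interdeparture_eq]

lemma tendsto_average_peakAge {v : ℝ}
    (hv : Tendsto (fun n : ℕ => (∑ i ∈ Finset.range n, (cycle (renew^[i] p.conf.rest)).2) / n) atTop (𝓝 v)) :
    Tendsto (fun n : ℕ => (1 / (n : ℝ)) * ∑ i ∈ Finset.range n, p.peakAge i) atTop (𝓝 (M + v)) := by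
  have h := hp.tendsto.add (tendsto_average_cons (b := p.systemTime) hp.systemTime_eq hv)
  refine h.congr fun n => ?_
  rw [← add_div, ← Finset.sum_add_distrib, one_div_mul_eq_div]
  congr 1
  exact Finset.sum_congr rfl fun i _ => by rw [peakAge, hp.interdeparture_eq]

end Typical

end Path

/-! ### Transfer to the probability space of the system -/

namespace IsTwoSource

variable {Ω : Type*} [MeasurableSpace Ω] {P : Measure Ω} [IsProbabilityMeasure P]
  {init : Ω → ℝ × Fin 2 × ℝ × ℝ} {X S : Ω → Fin 2 → ℕ → ℝ}

/-- All almost sure and mean statements about cycles under `inputMeasure` pass to the path through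
this law. -/
lemma hasLaw_rest (h : IsTwoSource P lam ν init X S) (hν : ∀ᵐ s ∂ν, 0 ≤ s) :
    HasLaw (fun ω => (mkPath (init ω) (X ω) (S ω)).conf.rest) (inputMeasure lam ν) P := by
  have := Measure.isProbabilityMeasure_map (μ := P) h.aemeasurable_init
  simp only [conf_mkPath]
  exact (map_rest_initConf hν (P.map init)).comp_hasLaw ⟨h.map_eq.1, h.map_eq.2⟩

lemma ae_typical (h : IsTwoSource P lam ν init X S) (hν : ∀ᵐ s ∂ν, 0 ≤ s) :
    ∀ᵐ ω ∂P, (mkPath (init ω) (X ω) (S ω)).Typical (cycleMean lam ν) := by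
  have := Measure.isProbabilityMeasure_map (μ := P) h.aemeasurable_init
  have h1 : ∀ᵐ ω ∂P, (mkPath (init ω) (X ω) (S ω)).conf.Good ∧ (mkPath (init ω) (X ω) (S ω)).conf.Stops := by
    have := ae_initConf (lam := lam) hν (P.map init)
    rw [← h.map_eq.2] at this
    simpa only [conf_mkPath] using ae_of_ae_map h.map_eq.1 this
  have h2 := (h.hasLaw_rest hν).map_eq ▸ (ae_recurrent (lam := lam) hν).and (ae_tendsto_cycle_fst hν)
  filter_upwards [h1, ae_of_ae_map (h.hasLaw_rest hν).aemeasurable h2] with ω h1 h2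
    using ⟨h1.1, h1.2, h2.1, h2.2⟩

lemma ae_tendsto_average_age (h : IsTwoSource P lam ν init X S) (hν : ∀ᵐ s ∂ν, 0 ≤ s) {φ : ℝ → ℝ}
    (hφ : Continuous φ) (hφ0 : ∀ x, 0 ≤ x → 0 ≤ φ x) (hφ1 : ∀ x, |φ x| ≤ |x|) :
    ∀ᵐ ω ∂P, Tendsto (fun τ : ℝ => (1 / τ) * ∫ t in (0 : ℝ)..τ, φ ((mkPath (init ω) (X ω) (S ω)).age t)) atTop
      (𝓝 (meanAgeReward lam ν φ / cycleMean lam ν)) := by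
  have h2 := (h.hasLaw_rest hν).map_eq ▸ ae_tendsto_ageReward (lam := lam) hν hφ hφ1
  filter_upwards [h.ae_typical hν, ae_of_ae_map (h.hasLaw_rest hν).aemeasurable h2] with ω h1 h2
  exact h1.tendsto_average_age (cycleMean_pos hν) hφ hφ0 h2

lemma ae_tendsto_average_peakAge (h : IsTwoSource P lam ν init X S) (hν : ∀ᵐ s ∂ν, 0 ≤ s) :
    ∀ᵐ ω ∂P, Tendsto (fun n : ℕ => (1 / (n : ℝ)) * ∑ i ∈ Finset.range n,
      (mkPath (init ω) (X ω) (S ω)).peakAge i) atTop (𝓝 (cycleMean lam ν + serviceMean lam ν)) := by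
  have h2 := (h.hasLaw_rest hν).map_eq ▸ ae_tendsto_cycle_snd (lam := lam) hν
  filter_upwards [h.ae_typical hν, ae_of_ae_map (h.hasLaw_rest hν).aemeasurable h2] with ω h1 h2
  exact h1.tendsto_average_peakAge h2

/-- For index i + 1 both terms come from cycles after the first delivery, whose law is that of a
fresh cycle; linearity suffices. -/
lemma integral_peakAge (h : IsTwoSource P lam ν init X S) (hν : ∀ᵐ s ∂ν, 0 ≤ s) (i : ℕ) :
    Integrable (fun ω => (mkPath (init ω) (X ω) (S ω)).peakAge (i + 1)) P ∧
      ∫ ω, (mkPath (init ω) (X ω) (S ω)).peakAge (i + 1) ∂P = cycleMean lam ν + serviceMean lam ν := by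
  set J : Ω → Input := fun ω => (mkPath (init ω) (X ω) (S ω)).conf.rest
  have hae : (fun ω => (mkPath (init ω) (X ω) (S ω)).peakAge (i + 1)) =ᵐ[P]
      fun ω => (cycle (renew^[i + 1] (J ω))).1 + (cycle (renew^[i] (J ω))).2 := by
    filter_upwards [h.ae_typical hν] with ω hω using hω.peakAge_eq i
  have key : ∀ (k : ℕ) (f : Input → ℝ), Measurable f → Integrable f (inputMeasure lam ν) →
      Integrable (fun ω => f (renew^[k] (J ω))) P ∧
      ∫ ω, f (renew^[k] (J ω)) ∂P = ∫ J, f J ∂(inputMeasure lam ν) := by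
    intro k f hf hi
    have hl : HasLaw (fun ω => renew^[k] (J ω)) (inputMeasure lam ν) P :=
      ((isRenewal_cycle hν).measurePreserving.iterate k).comp_hasLaw (h.hasLaw_rest hν)
    refine ⟨?_, hl.integral_comp hf.aestronglyMeasurable⟩
    have := hl.map_eq ▸ hi
    exact this.comp_aemeasurable hl.aemeasurable
  obtain ⟨i1, -, e1, -⟩ := Conf.integral_deliveryTime_idle (lam := lam) hν
  obtain ⟨i2, e2⟩ := Conf.integral_service_idle (lam := lam) hν
  obtain ⟨j1, f1⟩ := key (i + 1) (fun J => (cycle J).1) measurable_cycle.fst i1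
  obtain ⟨j2, f2⟩ := key i (fun J => (cycle J).2) measurable_cycle.snd i2
  refine ⟨(j1.add j2).congr hae.symm, ?_⟩
  rw [integral_congr_ae hae, integral_add j1 j2, f1, f2, ← e1, ← e2]
  rfl

end IsTwoSource

lemma cycleMean_add_serviceMean (hν : ∀ᵐ s ∂ν, 0 ≤ s) : cycleMean lam ν + serviceMean lam ν =
    peakAgeValue (lam 0) (L ν (lam 0)) (L ν (lam 1)) (L' ν (lam 0)) := by
  have h0 := (hlam 0).out
  have hL0 := L_pos ν hν h0
  have hL1 := L_pos ν hν (hlam 1).out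
  unfold cycleMean serviceMean peakAgeValue
  field_simp

end

section

/-! ### Stationary processes -/

section Stationary

variable {Ω : Type*} [MeasurableSpace Ω] {P : Measure Ω} [IsProbabilityMeasure P]

/-- The points of a lattice that lie to the right of `t` and tend to `t`. -/
lemma tendsto_lattice {t : ℝ} (ht : 0 ≤ t) :
    Tendsto (fun n : ℕ => ((⌊t * (n + 1)⌋₊ : ℝ) + 1) / ((n : ℝ) + 1)) atTop (𝓝[>] t) := by
  have hn : ∀ n : ℕ, (0 : ℝ) < n + 1 := fun n => by positivity
  have hlt : ∀ n : ℕ, t < ((⌊t * (n + 1)⌋₊ : ℝ) + 1) / ((n : ℝ) + 1) := fun n => by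
    rw [lt_div_iff₀ (hn n)]
    exact Nat.lt_floor_add_one _
  have hlim : Tendsto (fun n : ℕ => t + 1 / ((n : ℝ) + 1)) atTop (𝓝 t) := by
    simpa using tendsto_const_nhds.add (tendsto_one_div_add_atTop_nhds_zero_nat (𝕜 := ℝ))
  refine tendsto_nhdsWithin_iff.2 ⟨tendsto_of_tendsto_of_tendsto_of_le_of_le tendsto_const_nhds hlim
    (fun n => (hlt n).le) fun n => ?_, Eventually.of_forall hlt⟩
  change ((⌊t * (n + 1)⌋₊ : ℝ) + 1) / ((n : ℝ) + 1) ≤ t + 1 / ((n : ℝ) + 1)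
  rw [div_le_iff₀ (hn n), add_mul, div_mul_cancel₀ _ (hn n).ne']
  have := Nat.floor_le (mul_nonneg ht (hn n).le)
  linarith

/-- A right-continuous process is jointly measurable. -/
lemma aemeasurable_uncurry_of_continuousWithinAt {f : ℝ → Ω → ℝ} (hm : ∀ t, 0 ≤ t → AEMeasurable (f t) P)
    (hc : ∀ᵐ ω ∂P, ∀ t, 0 ≤ t → ContinuousWithinAt (fun s => f s ω) (Set.Ioi t) t) (m : Measure ℝ) [SFinite m]
    (hpos : ∀ᵐ t ∂m, 0 ≤ t) :
    AEMeasurable (fun x : Ω × ℝ => f x.2 x.1) (P.prod m) := by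
  obtain ⟨g, hg, hfg⟩ : ∃ g : ℕ → ℕ → Ω → ℝ, (∀ n k, Measurable (g n k)) ∧
      ∀ᵐ ω ∂P, ∀ n k : ℕ, f (((k : ℝ) + 1) / ((n : ℝ) + 1)) ω = g n k ω := by
    have hgm : ∀ n k : ℕ, AEMeasurable (f (((k : ℝ) + 1) / ((n : ℝ) + 1))) P :=
      fun n k => hm _ (by positivity)
    exact ⟨fun n k => (hgm n k).mk _, fun n k => (hgm n k).measurable_mk,
      ae_all_iff.2 fun n => ae_all_iff.2 fun k => (hgm n k).ae_eq_mk⟩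
  have hFm : ∀ n : ℕ, Measurable fun x : Ω × ℝ => g n ⌊x.2 * (n + 1)⌋₊ x.1 := fun n => by
    have h1 : Measurable fun y : Ω × ℕ => g n y.2 y.1 := measurable_from_prod_countable_left (hg n)
    have h2 : Measurable fun x : Ω × ℝ => ⌊x.2 * ((n : ℝ) + 1)⌋₊ :=
      Nat.measurable_floor.comp (measurable_snd.mul_const _)
    exact h1.comp (measurable_fst.prodMk h2)
  refine aemeasurable_of_tendsto_metrizable_ae atTop (fun n => (hFm n).aemeasurable) ?_
  have hfst := Measure.quasiMeasurePreserving_fst (μ := P) (ν := m).ae (hc.and hfg)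
  have hsnd := Measure.quasiMeasurePreserving_snd (μ := P) (ν := m).ae hpos
  filter_upwards [hfst, hsnd] with x h1 h2
  refine ((h1.1 x.2 h2).tendsto.comp (tendsto_lattice h2)).congr fun n => ?_
  exact h1.2 n _

/-- A bounded process with constant mean whose time averages converge to a constant. -/
lemma mean_eq_of_tendsto_average {f : ℝ → Ω → ℝ} (hm : ∀ t, 0 ≤ t → AEMeasurable (f t) P)
    (hc : ∀ᵐ ω ∂P, ∀ t, 0 ≤ t → ContinuousWithinAt (fun s => f s ω) (Set.Ioi t) t) {K e v : ℝ}
    (hb : ∀ t ω, |f t ω| ≤ K) (he : ∀ t, 0 ≤ t → ∫ ω, f t ω ∂P = e)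
    (hv : ∀ᵐ ω ∂P, Tendsto (fun τ : ℝ => (1 / τ) * ∫ t in (0 : ℝ)..τ, f t ω) atTop (𝓝 v)) : e = v := by
  obtain ⟨ω₀⟩ : Nonempty Ω := nonempty_of_isProbabilityMeasure P
  have hK : 0 ≤ K := (abs_nonneg _).trans (hb 0 ω₀)
  -- Fubini needs joint measurability, but only measurability at fixed times is available;
  -- right-continuity supplies it.
  have hjoint : ∀ n : ℕ, Integrable (fun x : Ω × ℝ => f x.2 x.1)
      (P.prod (volume.restrict (Set.Ioc (0 : ℝ) n))) := fun n => by
    have h1 := aemeasurable_uncurry_of_continuousWithinAt hm hc (volume.restrict (Set.Ioc (0 : ℝ) n))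
      ((ae_restrict_mem measurableSet_Ioc).mono fun t ht => ht.1.le)
    exact Integrable.of_bound h1.aestronglyMeasurable K (Eventually.of_forall fun x => hb _ _)
  have hg : ∀ n : ℕ, AEStronglyMeasurable (fun ω => (1 / (n : ℝ)) * ∫ t in (0 : ℝ)..n, f t ω) P := fun n => by
    simp only [intervalIntegral.integral_of_le (Nat.cast_nonneg n)]
    exact (hjoint n).1.integral_prod_right'.const_mul _
  have hgb : ∀ (n : ℕ) ω, ‖(1 / (n : ℝ)) * ∫ t in (0 : ℝ)..n, f t ω‖ ≤ K := fun n ω => by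
    rcases Nat.eq_zero_or_pos n with rfl | hn
    · simpa
    · have h1 := intervalIntegral.norm_integral_le_of_norm_le_const (a := 0) (b := (n : ℝ)) (C := K)
        (f := fun t => f t ω) fun t _ => hb t ω
      have hn' : (0 : ℝ) < n := by positivity
      rw [sub_zero, abs_of_pos hn'] at h1
      rw [norm_mul, Real.norm_of_nonneg (by positivity), one_div_mul_eq_div, div_le_iff₀ hn']
      exact h1
  have hint : ∀ n : ℕ, 0 < n → ∫ ω, (1 / (n : ℝ)) * (∫ t in (0 : ℝ)..n, f t ω) ∂P = e := fun n hn => by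
    have hn' : (0 : ℝ) < n := by positivity
    simp only [intervalIntegral.integral_of_le hn'.le]
    rw [integral_const_mul, integral_integral_swap (hjoint n), setIntegral_congr_fun measurableSet_Ioc
      fun t ht => he t ht.1.le]
    simp [hn'.ne']
  have hlim : Tendsto (fun n : ℕ => ∫ ω, (1 / (n : ℝ)) * (∫ t in (0 : ℝ)..n, f t ω) ∂P) atTop (𝓝 v) := by
    have := tendsto_integral_of_dominated_convergence (fun _ => K) hg (integrable_const K)
      (fun n => Eventually.of_forall (hgb n))
      (hv.mono fun ω hω => (hω.comp tendsto_natCast_atTop_atTop : Tendsto _ atTop (𝓝 v)))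
    simpa using this
  refine tendsto_nhds_unique (tendsto_const_nhds.congr' ?_) hlim
  filter_upwards [eventually_gt_atTop 0] with n hn using (hint n hn).symm

end Stationary

/-- On a regular path every time has a right neighbourhood without further deliveries, on which the
age is affine. -/
lemma Path.Regular.continuousWithinAt_age {p : Path} (hp : p.Regular) (t : ℝ) :
    ContinuousWithinAt p.age (Set.Ioi t) t := by
  by_cases h : p.deliveryTime 0 0 ≤ t
  · obtain ⟨h1, h2⟩ := hp.exists_mem h
    have hc : ContinuousWithinAt (fun s => s + (p.systemTime (p.lastIndex 0 t) -
      p.deliveryTime 0 (p.lastIndex 0 t))) (Set.Ioi t) t := by fun_prop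
    refine hc.congr_of_eventuallyEq ?_ (hp.age_of_mem h1 h2)
    filter_upwards [Ioo_mem_nhdsGT h2] with s hs using hp.age_of_mem (h1.trans hs.1.le) hs.2
  · have hc : ContinuousWithinAt (fun s => s - p.stamp₀) (Set.Ioi t) t := by fun_prop
    refine hc.congr_of_eventuallyEq ?_ (hp.age_of_lt (not_le.1 h))
    filter_upwards [Ioo_mem_nhdsGT (not_le.1 h)] with s hs using hp.age_of_lt hs.2

/-- The function that truncates its argument to `[-K, K]`. -/
def clamp (K : ℕ) (x : ℝ) : ℝ := max (-(K : ℝ)) (min x K)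

lemma continuous_clamp (K : ℕ) : Continuous (clamp K) := by unfold clamp; fun_prop

lemma abs_clamp_le (K : ℕ) (x : ℝ) : |clamp K x| ≤ K := by
  have hK : (0 : ℝ) ≤ K := Nat.cast_nonneg K
  exact abs_le.2 ⟨le_max_left _ _, max_le (by linarith) (min_le_right _ _)⟩

lemma clamp_nonneg (K : ℕ) {x : ℝ} (hx : 0 ≤ x) : 0 ≤ clamp K x :=
  le_max_of_le_right (le_min hx (Nat.cast_nonneg K))

lemma abs_clamp_le_abs (K : ℕ) (x : ℝ) : |clamp K x| ≤ |x| := by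
  have hK : (0 : ℝ) ≤ K := Nat.cast_nonneg K
  refine abs_le.2 ⟨?_, max_le (by linarith [abs_nonneg x]) ((min_le_left _ _).trans (le_abs_self x))⟩
  by_cases h : x ≤ K
  · exact (neg_abs_le x).trans (le_max_of_le_right (le_min le_rfl h))
  · exact (neg_nonpos.2 (abs_nonneg x)).trans (clamp_nonneg K (hK.trans (not_le.1 h).le))

lemma clamp_of_abs_le {K : ℕ} {x : ℝ} (h : |x| ≤ K) : clamp K x = x := by
  rw [clamp, min_eq_left (abs_le.1 h).2, max_eq_right (abs_le.1 h).1]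

lemma tendsto_clamp (x : ℝ) : Tendsto (fun K => clamp K x) atTop (𝓝 x) := by
  refine tendsto_const_nhds.congr' ?_
  filter_upwards [tendsto_natCast_atTop_atTop.eventually_ge_atTop |x|] with K hK
  exact (clamp_of_abs_le hK).symm

namespace IsTwoSource

variable {lam : Fin 2 → ℝ} [hlam : ∀ c, Fact (0 < lam c)] {ν : Measure ℝ} [IsProbabilityMeasure ν]
  {Ω : Type*} [MeasurableSpace Ω] {P : Measure Ω} [IsProbabilityMeasure P]
  {init : Ω → ℝ × Fin 2 × ℝ × ℝ} {X S : Ω → Fin 2 → ℕ → ℝ}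

lemma integral_comp_age_of_stationary (h : IsTwoSource P lam ν init X S) (hν : ∀ᵐ s ∂ν, 0 ≤ s)
    (hs : ∀ t : ℝ, 0 ≤ t → IdentDistrib (fun ω => (mkPath (init ω) (X ω) (S ω)).age t)
      (fun ω => (mkPath (init ω) (X ω) (S ω)).age 0) P P)
    {φ : ℝ → ℝ} (hφ : Continuous φ) (hφ0 : ∀ x, 0 ≤ x → 0 ≤ φ x) (hφ1 : ∀ x, |φ x| ≤ |x|) {K : ℝ}
    (hφK : ∀ x, |φ x| ≤ K) :
    ∫ ω, φ ((mkPath (init ω) (X ω) (S ω)).age 0) ∂P = meanAgeReward lam ν φ / cycleMean lam ν := by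
  refine mean_eq_of_tendsto_average (f := fun t ω => φ ((mkPath (init ω) (X ω) (S ω)).age t)) (K := K)
    (fun t ht => hφ.measurable.comp_aemeasurable (hs t ht).aemeasurable_fst) ?_ (fun t ω => hφK _)
    (fun t ht => ((hs t ht).comp hφ.measurable).integral_eq) (h.ae_tendsto_average_age hν hφ hφ0 hφ1)
  filter_upwards [h.ae_typical hν] with ω hω t _
  exact hφ.continuousAt.comp_continuousWithinAt ((hω.regular (cycleMean_pos hν)).continuousWithinAt_age t)

/-- Truncations are bounded, so their means are already known. The means of |clamp| are bounded
uniformly in K, Fatou gives integrability of the age, and dominated convergence on both sides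
identifies its mean. -/
lemma integral_age_of_stationary (h : IsTwoSource P lam ν init X S) (hν : ∀ᵐ s ∂ν, 0 ≤ s)
    (hs : ∀ t : ℝ, 0 ≤ t → IdentDistrib (fun ω => (mkPath (init ω) (X ω) (S ω)).age t)
      (fun ω => (mkPath (init ω) (X ω) (S ω)).age 0) P P) :
    Integrable (fun ω => (mkPath (init ω) (X ω) (S ω)).age 0) P ∧
      ∫ ω, (mkPath (init ω) (X ω) (S ω)).age 0 ∂P = meanAgeReward lam ν id / cycleMean lam ν := by
  set A : Ω → ℝ := fun ω => (mkPath (init ω) (X ω) (S ω)).age 0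
  have hA : AEMeasurable A P := (hs 0 le_rfl).aemeasurable_fst
  have hM := cycleMean_pos (lam := lam) hν
  have h1 : ∀ K, ∫ ω, clamp K (A ω) ∂P = meanAgeReward lam ν (clamp K) / cycleMean lam ν := fun K =>
    h.integral_comp_age_of_stationary hν hs (continuous_clamp K) (fun _ => clamp_nonneg K)
      (abs_clamp_le_abs K) (abs_clamp_le K)
  have h2 : ∀ K, ∫ ω, |clamp K (A ω)| ∂P ≤ meanAgeReward lam ν id / cycleMean lam ν := fun K => by
    have hφ : Continuous fun x => |clamp K x| := (continuous_clamp K).abs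
    have hφ1 : ∀ x, |(|clamp K x|)| ≤ |x| := fun x => by rw [abs_abs]; exact abs_clamp_le_abs K x
    rw [h.integral_comp_age_of_stationary hν hs (K := K) hφ (fun _ _ => abs_nonneg _) hφ1
      fun x => by rw [abs_abs]; exact abs_clamp_le K x]
    exact div_le_div_of_nonneg_right (meanAgeReward_le hν hφ hφ1) hM.le
  have hm : ∀ K, AEStronglyMeasurable (fun ω => clamp K (A ω)) P := fun K =>
    ((continuous_clamp K).measurable.comp_aemeasurable hA).aestronglyMeasurable
  have hi : ∀ K, Integrable (fun ω => clamp K (A ω)) P := fun K =>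
    Integrable.of_bound (hm K) K (Eventually.of_forall fun ω => abs_clamp_le K _)
  have hint : Integrable A P := by
    refine ⟨hA.aestronglyMeasurable, ?_⟩
    have h3 : ∫⁻ ω, ‖A ω‖ₑ ∂P ≤ liminf (fun K => ∫⁻ ω, ‖clamp K (A ω)‖ₑ ∂P) atTop := by
      rw [← lintegral_congr fun ω => (tendsto_clamp (A ω)).enorm.liminf_eq]
      exact lintegral_liminf_le' fun K => (hm K).enorm
    refine (h3.trans (liminf_le_of_frequently_le' (Frequently.of_forall fun K => ?_))).trans_lt
      (ENNReal.ofReal_lt_top (r := meanAgeReward lam ν id / cycleMean lam ν))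
    rw [← ofReal_integral_norm_eq_lintegral_enorm (hi K)]
    exact ENNReal.ofReal_le_ofReal (h2 K)
  refine ⟨hint, tendsto_nhds_unique ?_ ((tendsto_meanAgeReward hν continuous_clamp abs_clamp_le_abs
    tendsto_clamp).div_const _)⟩
  simp only [← h1]
  exact tendsto_integral_of_dominated_convergence (fun ω => |A ω|) hm hint.abs
    (fun K => Eventually.of_forall fun ω => abs_clamp_le_abs K _)
    (Eventually.of_forall fun ω => tendsto_clamp _)

end IsTwoSource

end

end MG11

end

theorem corollary1 {Ω : Type*} [MeasurableSpace Ω] (P : Measure Ω) [IsProbabilityMeasure P]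
    (lam : Fin 2 → ℝ) (hlam : ∀ c, 0 < lam c)
    (ν : Measure ℝ) [IsProbabilityMeasure ν] (hν : ∀ᵐ s ∂ν, 0 ≤ s)
    (init : Ω → ℝ × Fin 2 × ℝ × ℝ) (X S : Ω → Fin 2 → ℕ → ℝ)
    (hsys : MG11.IsTwoSource P lam ν init X S)
    (path : Ω → MG11.Path) (hpath : ∀ ω, path ω = MG11.mkPath (init ω) (X ω) (S ω))
    (L₁ L₂ D₁ D₂ : ℝ) (hL₁ : L₁ = MG11.L ν (lam 0)) (hL₂ : L₂ = MG11.L ν (lam 1))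
    (hD₁ : D₁ = MG11.L' ν (lam 0)) (hD₂ : D₂ = MG11.L' ν (lam 1)) :
    -- the long-run time average of the age of source 1
    (∀ᵐ ω ∂P, Tendsto (fun τ : ℝ => (1 / τ) * ∫ t in (0 : ℝ)..τ, (path ω).age t) atTop
      (𝓝 (MG11.ageValue (lam 0) (lam 1) L₁ L₂ D₁ D₂))) ∧
    -- the mean of the age of source 1 if its marginal distribution is stationary
    ((∀ t : ℝ, 0 ≤ t → IdentDistrib (fun ω => (path ω).age t) (fun ω => (path ω).age 0) P P) →
      ∀ t : ℝ, 0 ≤ t → Integrable (fun ω => (path ω).age t) P ∧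
        ∫ ω, (path ω).age t ∂P = MG11.ageValue (lam 0) (lam 1) L₁ L₂ D₁ D₂) ∧
    -- the long-run average of the peak ages of source 1
    (∀ᵐ ω ∂P, Tendsto (fun n : ℕ => (1 / (n : ℝ)) * ∑ i ∈ Finset.range n, (path ω).peakAge i)
      atTop (𝓝 (MG11.peakAgeValue (lam 0) L₁ L₂ D₁))) ∧
    -- the mean of each peak age of source 1 that does not involve the initial state
    (∀ i : ℕ, 1 ≤ i → Integrable (fun ω => (path ω).peakAge i) P ∧
      ∫ ω, (path ω).peakAge i ∂P = MG11.peakAgeValue (lam 0) L₁ L₂ D₁) := by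
  subst hL₁ hL₂ hD₁ hD₂
  obtain rfl : path = fun ω => MG11.mkPath (init ω) (X ω) (S ω) := funext hpath
  have : ∀ c, Fact (0 < lam c) := fun c => ⟨hlam c⟩
  -- The closed formulas are traded for mean reward per mean cycle length, and for mean cycle length
  -- plus mean service time.
  rw [← MG11.meanAgeReward_id_div hν, ← MG11.cycleMean_add_serviceMean hν]
  refine ⟨?_, fun hs t ht => ?_, hsys.ae_tendsto_average_peakAge hν, fun i hi => ?_⟩
  · exact hsys.ae_tendsto_average_age hν continuous_id (fun _ h => h) fun _ => le_rfl
  · obtain ⟨hint, hval⟩ := hsys.integral_age_of_stationary hν hs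
    exact ⟨(hs t ht).integrable_iff.2 hint, (hs t ht).integral_eq.trans hval⟩
  · obtain ⟨i, rfl⟩ := Nat.exists_eq_add_of_le' hi
    exact hsys.integral_peakAge hν i
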